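/- Let $A$ be a $C^*$-algebra and let $X$ be a Hilbert $A$-bimodule, i.e. a right Hilbert $A$-module with a $*$-homomorphism $\varphi:A\to\mathcal L(X)$. Neither injectivity nor nondegeneracy of $\varphi$, nor fullness of $X$, is assumed. **Notation.** Let $X^{\otimes 0}=A$, $X^{\otimes 1}=X$, and let $X^{\otimes n}$ be the $n$-fold balanced tensor power over $A$. Its left action is $\varphi_n:A\to\mathcal L(X^{\otimes n})$, where $\varphi_0(a)=L_a$ is left multiplication, $\varphi_1=\varphi$ and $\varphi_n(a)=\varphi(a)\otimes 1_{n-1}$. Write $\mathcal K(Y)$ for the closed linear span of the operators $\theta_{\xi,\eta}:\zeta\mapsto\xi\langle\eta,\zeta\rangle$ on a Hilbert module $Y$. For $p\le q$ let $\iota_p^q:\mathcal K(X^{\otimes p})\to\mathcal L(X^{\otimes q})$ be $S\mapsto S\otimes 1_{q-p}$ if $p\ge1$, and $L_a\mapsto\varphi_q(a)$ if $p=0$. Put $I_0=A$ and $I_k=\bigcap_{0<m\le k}\ker\varphi_m$, and let $X^{\otimes q}I_k=\{\xi\in X^{\otimes q}:\langle\xi,\xi\rangle\in I_k\}$, a Hilbert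 submodule of $X^{\otimes q}$. For $p\le n\le m$ and $S\in\mathcal K(X^{\otimes p})$ let $$\tilde\iota_p^{\,m}(S)\in\bigoplus_{0\le q\le m}\mathcal L(X^{\otimes q}I_{m-q})$$ have $q$-th component $\iota_p^q(S)|_{X^{\otimes q}I_{m-q}}$ if $q\ge p$ and $0$ if $q<p$. Let $$C_n=\Bigl\{\sum_{p\le n}\tilde\iota_p^{\,n}(S_p): S_p\in\mathcal K(X^{\otimes p})\Bigr\},\qquad j_{m,n}:C_n\to C_m,\quad \sum_{p\le n}\tilde\iota_p^{\,n}(S_p)\mapsto\sum_{p\le n}\tilde\iota_p^{\,m}(S_p),$$ and let $\varinjlim C_n$ be the $C^*$-algebraic inductive limit of the $C_n$ along the $*$-homomorphisms $j_{m,n}$. A representation $(\pi,t)$ of $X$ on a $C^*$-algebra $B$ is a $*$-homomorphism $\pi:A\to B$ and a linear map $t:X\to B$ with $t(\xi)^*t(\eta)=\pi(\langle\xi,\eta\rangle)$ and $\pi(a)t(\xi)=t(\varphi(a)\xi)$. It induces linear maps $t_n:X^{\otimes n}\to B$ with $t_0=\pi$ and $t_n(\xi_1\otimes\cdots\otimes\xi_n)=t(\xi_1)\cdots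 t(\xi_n)$ for $n\ge1$, and $*$-homomorphisms $t^{(n)}:\mathcal K(X^{\otimes n})\to B$ with $t^{(n)}(\theta_{\xi,\eta})=t_n(\xi)t_n(\eta)^*$. The core $C^*(\pi,t)^{\mathrm{core}}$ is the closed linear span of $\{t_n(\xi)t_n(\eta)^*:n\ge0,\ \xi,\eta\in X^{\otimes n}\}$. The representation is *Cuntz–Pimsner covariant* if $\pi(a)=t^{(1)}(\varphi(a))$ for all $a$ in $J_X=\{a\in A:\varphi(a)\in\mathcal K(X)\text{ and }ab=0\text{ for all }b\in\ker\varphi\}$. **Theorem.** Let $(\pi,t)$ be a Cuntz–Pimsner covariant representation of $X$. For every $n\ge0$ there is a well-defined $*$-homomorphism $$\kappa_n^{(\pi,t)}:C_n\to C^*(\pi,t)^{\mathrm{core}},\qquad \sum_{p\le n}\tilde\iota_p^{\,n}(S_p)\mapsto\sum_{p\le n}t^{(p)}(S_p).$$ These satisfy $\kappa_m^{(\pi,t)}\circ j_{m,n}=\kappa_n^{(\pi,t)}$ for $n\le m$, and so they induce a $*$-homomorphism $\kappa^{(\pi,t)}:\varinjlim C_n\to C^*(\pi,t)^{\mathrm{core}}$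 whose composition with the canonical map $C_n\to\varinjlim C_n$ is $\kappa_n^{(\pi,t)}$ for every $n$. If $\pi$ is injective, then every $\kappa_n^{(\pi,t)}$ is injective, and $\kappa^{(\pi,t)}$ is isometric with range $C^*(\pi,t)^{\mathrm{core}}$. -/

import Mathlib

open scoped TensorProduct

universe u v

noncomputable section

namespace CuntzPimsner

variable {A : Type u} [NonUnitalCStarAlgebra A] [PartialOrder A] [StarOrderedRing A]


/-- A right `A`-action together with a (possibly degenerate) positive `A`-valued sesquilinear form
on a complex vector space `E`, conjugate-linear in the first and linear in the second variable:
a semi-inner-product right `A`-module. -/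
structure RightForm (A : Type u) [NonUnitalCStarAlgebra A] [PartialOrder A] [StarOrderedRing A]
    (E : Type u) [AddCommGroup E] [Module ℂ E] where
  /-- the right action `ξ ↦ ξ a` -/
  act : A → E →ₗ[ℂ] E
  /-- the form `⟨ξ, η⟩` -/
  form : E → E → A
  form_add_right : ∀ x y z, form x (y + z) = form x y + form x z
  form_smul_right : ∀ (c : ℂ) x y, form x (c • y) = c • form x y
  form_act_right : ∀ x y a, form x (act a y) = form x y * a
  star_form : ∀ x y, star (form x y) = form y x
  form_self_nonneg : ∀ x, 0 ≤ form x x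

namespace RightForm

variable {E : Type u} [AddCommGroup E] [Module ℂ E] (F : RightForm A E)

lemma form_add_left (x y z : E) : F.form (x + y) z = F.form x z + F.form y z := by
  rw [← F.star_form, F.form_add_right, star_add, F.star_form, F.star_form]

lemma form_smul_left (c : ℂ) (x z : E) : F.form (c • x) z = star c • F.form x z := by
  rw [← F.star_form, F.form_smul_right, star_smul, F.star_form]

lemma form_act_left (x z : E) (a : A) : F.form (F.act a x) z = star a * F.form x z := by
  rw [← F.star_form, F.form_act_right, star_mul, F.star_form]

/-- The form as a sesquilinear map. -/
def formₛₗ : E →ₗ⋆[ℂ] E →ₗ[ℂ] A :=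
  LinearMap.mk₂'ₛₗ (starRingEnd ℂ) (RingHom.id ℂ) F.form F.form_add_left
    (fun c x y => F.form_smul_left c x y) F.form_add_right
    (fun c x y => F.form_smul_right c x y)

lemma formₛₗ_apply (x y : E) : F.formₛₗ x y = F.form x y := rfl

lemma form_zero_right (x : E) : F.form x 0 = 0 := by simp [← formₛₗ_apply]
lemma form_zero_left (x : E) : F.form 0 x = 0 := by simp [← formₛₗ_apply]
lemma form_sub_right (x y z : E) : F.form x (y - z) = F.form x y - F.form x z := by
  simp [← formₛₗ_apply]
lemma form_sub_left (x y z : E) : F.form (x - y) z = F.form x z - F.form y z := by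
  simp [← formₛₗ_apply]
lemma form_sum_right {ι : Type*} (s : Finset ι) (x : E) (y : ι → E) :
    F.form x (∑ i ∈ s, y i) = ∑ i ∈ s, F.form x (y i) := by
  simp [← formₛₗ_apply]
lemma form_sum_left {ι : Type*} (s : Finset ι) (x : E) (y : ι → E) :
    F.form (∑ i ∈ s, y i) x = ∑ i ∈ s, F.form (y i) x := by
  simp [← formₛₗ_apply]

lemma cauchy_schwarz_order (x y : E) {k : ℝ} (hk : 0 < k) (hx : ‖F.form x x‖ ≤ k) :
    F.form y x * F.form x y ≤ k • F.form y y := by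
  have h0 := F.form_self_nonneg (F.act (F.form x y) x - k • y)
  have e1 : F.form (F.act (F.form x y) x - k • y) (F.act (F.form x y) x - k • y) =
      F.form y x * F.form x x * F.form x y - k • (F.form y x * F.form x y)
        - k • (F.form y x * F.form x y) + k • (k • F.form y y) := by
    have hs : ∀ z w : E, F.form z (k • w) = k • F.form z w := fun z w => by
      have := F.form_smul_right (k : ℂ) z w
      simpa using this
    have hs' : ∀ z w : E, F.form (k • z) w = k • F.form z w := fun z w => by
      have := F.form_smul_left (k : ℂ) z w
      simpa using this
    simp only [form_sub_left, form_sub_right, form_act_right, form_act_left, hs, hs',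
      F.star_form, smul_sub, mul_assoc, smul_mul_assoc, sub_mul]
    abel
  rw [e1] at h0
  have h2 : F.form y x * F.form x x * F.form x y ≤ k • (F.form y x * F.form x y) := by
    have h3 : star (F.form x y) * F.form x x * F.form x y
        ≤ ‖F.form x x‖ • (star (F.form x y) * F.form x y) :=
      CStarAlgebra.star_left_conjugate_le_norm_smul (hb := .of_nonneg (F.form_self_nonneg x))
    rw [F.star_form] at h3
    refine h3.trans ?_
    have : (0 : A) ≤ F.form y x * F.form x y := by
      rw [← F.star_form x y]; exact star_mul_self_nonneg _
    gcongr
  have h4 : (0 : A) ≤ k • (k • F.form y y - F.form y x * F.form x y) := by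
    refine h0.trans ?_
    rw [smul_sub, add_comm, ← sub_nonneg]
    have := sub_nonneg.2 h2
    convert this using 1
    abel
  have h5 : (0 : A) ≤ k⁻¹ • (k • (k • F.form y y - F.form y x * F.form x y)) :=
    smul_nonneg (by positivity) h4
  rw [smul_smul, inv_mul_cancel₀ hk.ne', one_smul] at h5
  exact sub_nonneg.1 h5

lemma norm_form_sq_le (x y : E) : ‖F.form x y‖ ^ 2 ≤ ‖F.form x x‖ * ‖F.form y y‖ := by
  have key : ∀ k : ℝ, ‖F.form x x‖ < k → ‖F.form x y‖ ^ 2 ≤ k * ‖F.form y y‖ := by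
    intro k hk
    have hk0 : 0 < k := (norm_nonneg _).trans_lt hk
    have h := F.cauchy_schwarz_order x y hk0 hk.le
    have h1 : ‖F.form y x * F.form x y‖ ≤ ‖k • F.form y y‖ := by
      refine CStarAlgebra.norm_le_norm_of_nonneg_of_le ?_ h
      rw [← F.star_form x y]; exact star_mul_self_nonneg _
    rw [← F.star_form x y, CStarRing.norm_star_mul_self, norm_smul, Real.norm_of_nonneg hk0.le,
      ← pow_two] at h1
    exact h1
  have ht : Filter.Tendsto (fun k : ℝ => k * ‖F.form y y‖) (nhdsWithin ‖F.form x x‖ (Set.Ioi ‖F.form x x‖))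
      (nhds (‖F.form x x‖ * ‖F.form y y‖)) :=
    (Continuous.tendsto (f := fun k : ℝ => k * ‖F.form y y‖) (by fun_prop) _).mono_left
      nhdsWithin_le_nhds
  exact ge_of_tendsto ht (Filter.eventually_of_mem self_mem_nhdsWithin key)

lemma norm_form_le (x y : E) : ‖F.form x y‖ ≤ √‖F.form x x‖ * √‖F.form y y‖ := by
  rw [← Real.sqrt_mul (norm_nonneg _)]
  exact Real.le_sqrt_of_sq_le (F.norm_form_sq_le x y)

/-- The space `E` regarded as carrying the seminorm `‖ξ‖ = ‖⟨ξ, ξ⟩‖^{1/2}`. -/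
def Space (_F : RightForm A E) : Type u := E

instance : AddCommGroup F.Space := inferInstanceAs (AddCommGroup E)
instance : Module ℂ F.Space := inferInstanceAs (Module ℂ E)

/-- The form, on `F.Space`. -/
def onSpace : RightForm A F.Space := F

instance : Norm F.Space := ⟨fun x => √‖F.onSpace.form x x‖⟩

lemma norm_def (x : F.Space) : ‖x‖ = √‖F.onSpace.form x x‖ := rfl

lemma spaceCore : SeminormedSpace.Core ℂ F.Space where
  norm_nonneg _ := Real.sqrt_nonneg _
  norm_smul c x := by
    rw [norm_def, norm_def, form_smul_left, form_smul_right, norm_smul, norm_smul, norm_star,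
      ← mul_assoc, Real.sqrt_mul (by positivity), Real.sqrt_mul_self (norm_nonneg _)]
  norm_triangle x y := by
    rw [norm_def, norm_def, norm_def]
    refine Real.sqrt_le_iff.2 ⟨by positivity, ?_⟩
    have h1 : F.onSpace.form (x + y) (x + y) = F.onSpace.form x x + F.onSpace.form x y
        + (F.onSpace.form y x + F.onSpace.form y y) := by
      rw [← form_add_right, ← form_add_right, ← form_add_left]
    rw [h1]
    have h2 := F.onSpace.norm_form_le x y
    have h3 := F.onSpace.norm_form_le y x
    have h4 := norm_add_le (F.onSpace.form x x + F.onSpace.form x y)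
      (F.onSpace.form y x + F.onSpace.form y y)
    have h5 := norm_add_le (F.onSpace.form x x) (F.onSpace.form x y)
    have h6 := norm_add_le (F.onSpace.form y x) (F.onSpace.form y y)
    have h7 := Real.sq_sqrt (norm_nonneg (F.onSpace.form x x))
    have h8 := Real.sq_sqrt (norm_nonneg (F.onSpace.form y y))
    nlinarith

instance : SeminormedAddCommGroup F.Space := .ofCore F.spaceCore
instance : NormedSpace ℂ F.Space where
  norm_smul_le c x := (F.spaceCore.norm_smul c x).le

lemma norm_form_le_norm (x y : F.Space) : ‖F.onSpace.form x y‖ ≤ ‖x‖ * ‖y‖ :=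
  F.onSpace.norm_form_le x y

lemma norm_sq (x : F.Space) : ‖x‖ ^ 2 = ‖F.onSpace.form x x‖ := Real.sq_sqrt (norm_nonneg _)

/-- The form as an additive map in each variable on the seminormed space. -/
def formAdd : F.Space →+ F.Space →+ A :=
  AddMonoidHom.mk' (fun x => AddMonoidHom.mk' (fun y => F.onSpace.form x y)
    (F.onSpace.form_add_right x))
    (fun x y => by ext z; exact F.onSpace.form_add_left x y z)

lemma continuous_form : Continuous fun p : F.Space × F.Space => F.onSpace.form p.1 p.2 := by
  have h : Continuous fun p : F.Space × F.Space =>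
      LinearMap.mkContinuous₂ F.onSpace.formₛₗ 1
        (fun x y => by simpa using! F.norm_form_le_norm x y) p.1 p.2 := by fun_prop
  exact h

lemma norm_act_le (a : A) (x : F.Space) : ‖F.onSpace.act a x‖ ≤ ‖a‖ * ‖x‖ := by
  refine le_of_sq_le_sq ?_ (by positivity)
  rw [mul_pow, norm_sq, norm_sq, form_act_right, form_act_left]
  calc ‖star a * F.onSpace.form x x * a‖ ≤ ‖star a‖ * ‖F.onSpace.form x x‖ * ‖a‖ := norm_mul₃_le
    _ = ‖a‖ ^ 2 * ‖F.onSpace.form x x‖ := by rw [norm_star]; ring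

end RightForm

/-- A (right) Hilbert `A`-module: a Banach space with a right action of `A` and an `A`-valued inner
product `⟨ξ, η⟩`, linear in `η`, with `⟨ξ, η a⟩ = ⟨ξ, η⟩ a`, inducing the norm. -/
structure HilbMod (A : Type u) [NonUnitalCStarAlgebra A] [PartialOrder A] [StarOrderedRing A] where
  /-- the underlying space -/
  carrier : Type u
  [normedAddCommGroup : NormedAddCommGroup carrier]
  [normedSpace : NormedSpace ℂ carrier]
  [completeSpace : CompleteSpace carrier]
  /-- the right action and the inner product -/
  toForm : RightForm A carrier
  norm_sq' : ∀ x : carrier, ‖x‖ ^ 2 = ‖toForm.form x x‖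

namespace HilbMod

instance : CoeSort (HilbMod A) (Type u) := ⟨HilbMod.carrier⟩

attribute [instance] HilbMod.normedAddCommGroup HilbMod.normedSpace HilbMod.completeSpace

variable (Y : HilbMod A)

/-- The inner product `⟨ξ, η⟩`. -/
def ip (x y : Y) : A := Y.toForm.form x y

/-- The right action `ξ a`. -/
def act (x : Y) (a : A) : Y := Y.toForm.act a x

end HilbMod

namespace RightForm

open UniformSpace

variable {E : Type u} [AddCommGroup E] [Module ℂ E] (F : RightForm A E)

/-- The extension of the form to the completion. -/
def formCompl (x y : Completion F.Space) : A :=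
  (Completion.isDenseInducing_coe.prodMap Completion.isDenseInducing_coe).extend
    (fun p : F.Space × F.Space => F.onSpace.form p.1 p.2) (x, y)

lemma formCompl_coe (x y : F.Space) : F.formCompl x y = F.onSpace.form x y :=
  (Completion.isDenseInducing_coe.prodMap Completion.isDenseInducing_coe).extend_eq
    F.continuous_form (x, y)

lemma continuous_formCompl :
    Continuous fun p : Completion F.Space × Completion F.Space => F.formCompl p.1 p.2 := by
  have h : Continuous fun p : F.Space × F.Space => F.formAdd p.1 p.2 := F.continuous_form
  exact (Completion.isDenseInducing_toCompl F.Space).extend_Z_bilin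
    (Completion.isDenseInducing_toCompl F.Space) h

/-- The right action on the completion. -/
def actCompl (a : A) : Completion F.Space →L[ℂ] Completion F.Space :=
  ((F.onSpace.act a).mkContinuous ‖a‖ (F.norm_act_le a)).completion

lemma actCompl_coe (a : A) (x : F.Space) : F.actCompl a x = (F.onSpace.act a x : Completion F.Space) :=
  ContinuousLinearMap.completion_apply_coe _ _

lemma continuous_formCompl_comp {α : Type*} [TopologicalSpace α] {f g : α → Completion F.Space}
    (hf : Continuous f) (hg : Continuous g) : Continuous fun x => F.formCompl (f x) (g x) :=
  F.continuous_formCompl.comp (hf.prodMk hg)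

lemma formCompl_add_right (x y z : Completion F.Space) :
    F.formCompl x (y + z) = F.formCompl x y + F.formCompl x z := by
  refine Completion.induction_on₃ x y z (isClosed_eq ?_ (.add ?_ ?_)) fun a b c => ?_
  · exact F.continuous_formCompl_comp (by fun_prop) (by fun_prop)
  · exact F.continuous_formCompl_comp (by fun_prop) (by fun_prop)
  · exact F.continuous_formCompl_comp (by fun_prop) (by fun_prop)
  · rw [← Completion.coe_add, formCompl_coe, formCompl_coe, formCompl_coe]
    exact F.onSpace.form_add_right a b c

lemma formCompl_smul_right (c : ℂ) (x y : Completion F.Space) :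
    F.formCompl x (c • y) = c • F.formCompl x y := by
  have h1 : Continuous fun p : Completion F.Space × Completion F.Space =>
      F.formCompl p.1 (c • p.2) :=
    F.continuous_formCompl_comp continuous_fst (continuous_snd.const_smul c)
  have h2 : Continuous fun p : Completion F.Space × Completion F.Space =>
      c • F.formCompl p.1 p.2 := F.continuous_formCompl.const_smul c
  refine Completion.induction_on₂ x y (isClosed_eq h1 h2) fun a b => ?_
  have h3 : c • (b : Completion F.Space) = ((c • b : F.Space) : Completion F.Space) :=
    (Completion.coe_smul c b).symm
  rw [h3, formCompl_coe, formCompl_coe]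
  exact F.onSpace.form_smul_right c a b

lemma formCompl_act_right (x y : Completion F.Space) (a : A) :
    F.formCompl x (F.actCompl a y) = F.formCompl x y * a := by
  refine Completion.induction_on₂ x y (isClosed_eq ?_ (.mul ?_ continuous_const)) fun b c => ?_
  · exact F.continuous_formCompl_comp (by fun_prop) (by fun_prop)
  · exact F.continuous_formCompl_comp (by fun_prop) (by fun_prop)
  · rw [actCompl_coe, formCompl_coe, formCompl_coe]
    exact F.onSpace.form_act_right b c a

lemma star_formCompl (x y : Completion F.Space) : star (F.formCompl x y) = F.formCompl y x := by
  refine Completion.induction_on₂ x y (isClosed_eq (.star ?_) ?_) fun b c => ?_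
  · exact F.continuous_formCompl_comp (by fun_prop) (by fun_prop)
  · exact F.continuous_formCompl_comp (by fun_prop) (by fun_prop)
  · rw [formCompl_coe, formCompl_coe]
    exact F.onSpace.star_form b c

lemma formCompl_self_nonneg (x : Completion F.Space) : 0 ≤ F.formCompl x x := by
  refine Completion.induction_on x (isClosed_Ici.preimage ?_) fun b => ?_
  · exact F.continuous_formCompl_comp (by fun_prop) (by fun_prop)
  · rw [formCompl_coe]
    exact F.onSpace.form_self_nonneg b

lemma norm_sq_formCompl (x : Completion F.Space) : ‖x‖ ^ 2 = ‖F.formCompl x x‖ := by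
  refine Completion.induction_on x (isClosed_eq (by fun_prop) (.norm ?_)) fun b => ?_
  · exact F.continuous_formCompl_comp (by fun_prop) (by fun_prop)
  · rw [formCompl_coe, Completion.norm_coe, norm_sq]

/-- The Hilbert module obtained from a semi-inner-product module by dividing out the vectors of
length zero and completing. -/
def completion : HilbMod A where
  carrier := Completion F.Space
  toForm :=
    { act := fun a => F.actCompl a
      form := F.formCompl
      form_add_right := F.formCompl_add_right
      form_smul_right := F.formCompl_smul_right
      form_act_right := F.formCompl_act_right
      star_form := F.star_formCompl
      form_self_nonneg := F.formCompl_self_nonneg }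
  norm_sq' := F.norm_sq_formCompl

/-- The canonical map into the completion. -/
def toCompletion : E →ₗ[ℂ] F.completion :=
  (Completion.toComplₗᵢ (𝕜 := ℂ) (E := F.Space)).toLinearMap

lemma ip_toCompletion (x y : E) :
    F.completion.ip (F.toCompletion x) (F.toCompletion y) = F.form x y :=
  F.formCompl_coe x y

lemma denseRange_toCompletion : DenseRange F.toCompletion :=
  Completion.denseRange_coe (α := F.Space)

/-- The continuous extension of a bounded linear map to the completion. -/
def extend {G : Type*} [NormedAddCommGroup G] [NormedSpace ℂ G] [CompleteSpace G]
    (S : E →ₗ[ℂ] G) (C : ℝ) (hC : 0 ≤ C) (hS : ∀ u, ‖S u‖ ^ 2 ≤ C ^ 2 * ‖F.form u u‖) :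
    F.completion →L[ℂ] G :=
  (LinearMap.mkContinuous (E := F.Space) S C fun u => le_of_sq_le_sq
    (by rw [mul_pow, norm_sq]; exact hS u) (by positivity)).extend
      (Completion.toComplL (𝕜 := ℂ) (E := F.Space))

lemma extend_toCompletion {G : Type*} [NormedAddCommGroup G] [NormedSpace ℂ G] [CompleteSpace G]
    (S : E →ₗ[ℂ] G) (C : ℝ) (hC : 0 ≤ C) (hS : ∀ u, ‖S u‖ ^ 2 ≤ C ^ 2 * ‖F.form u u‖) (u : E) :
    F.extend S C hC hS (F.toCompletion u) = S u :=
  ContinuousLinearMap.extend_eq _ (e := Completion.toComplL (𝕜 := ℂ) (E := F.Space))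
    (Completion.denseRange_coe (α := F.Space)) (Completion.isUniformInducing_coe F.Space) u

end RightForm

namespace HilbMod

variable (Y : HilbMod A)

lemma norm_sq (x : Y) : ‖x‖ ^ 2 = ‖Y.ip x x‖ := Y.norm_sq' x

lemma norm_eq (x : Y) : ‖x‖ = √‖Y.ip x x‖ := by rw [← norm_sq, Real.sqrt_sq (norm_nonneg _)]

lemma norm_ip_le (x y : Y) : ‖Y.ip x y‖ ≤ ‖x‖ * ‖y‖ := by
  rw [norm_eq, norm_eq]; exact Y.toForm.norm_form_le x y

lemma star_ip (x y : Y) : star (Y.ip x y) = Y.ip y x := Y.toForm.star_form x y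
lemma ip_self_nonneg (x : Y) : 0 ≤ Y.ip x x := Y.toForm.form_self_nonneg x
lemma ip_add_right (x y z : Y) : Y.ip x (y + z) = Y.ip x y + Y.ip x z :=
  Y.toForm.form_add_right x y z
lemma ip_add_left (x y z : Y) : Y.ip (x + y) z = Y.ip x z + Y.ip y z := Y.toForm.form_add_left x y z
lemma ip_smul_right (c : ℂ) (x y : Y) : Y.ip x (c • y) = c • Y.ip x y :=
  Y.toForm.form_smul_right c x y
lemma ip_smul_left (c : ℂ) (x y : Y) : Y.ip (c • x) y = star c • Y.ip x y :=
  Y.toForm.form_smul_left c x y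
lemma ip_sub_right (x y z : Y) : Y.ip x (y - z) = Y.ip x y - Y.ip x z :=
  Y.toForm.form_sub_right x y z
lemma ip_sub_left (x y z : Y) : Y.ip (x - y) z = Y.ip x z - Y.ip y z := Y.toForm.form_sub_left x y z
lemma ip_zero_right (x : Y) : Y.ip x 0 = 0 := Y.toForm.form_zero_right x
lemma ip_zero_left (x : Y) : Y.ip 0 x = 0 := Y.toForm.form_zero_left x
lemma ip_act_right (x y : Y) (a : A) : Y.ip x (Y.act y a) = Y.ip x y * a :=
  Y.toForm.form_act_right x y a
lemma ip_act_left (x y : Y) (a : A) : Y.ip (Y.act x a) y = star a * Y.ip x y :=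
  Y.toForm.form_act_left x y a

lemma ip_self_eq_zero {x : Y} : Y.ip x x = 0 ↔ x = 0 := by
  rw [← norm_eq_zero, ← norm_sq, sq_eq_zero_iff, norm_eq_zero]

variable {Y} in
lemma ext_ip {x y : Y} (h : ∀ z, Y.ip z x = Y.ip z y) : x = y := by
  rw [← sub_eq_zero, ← Y.ip_self_eq_zero, Y.ip_sub_right, h, sub_self]

/-- The inner product as a continuous sesquilinear map. -/
def ipL : Y →L⋆[ℂ] Y →L[ℂ] A :=
  LinearMap.mkContinuous₂ Y.toForm.formₛₗ 1 fun x y => by simpa using! Y.norm_ip_le x y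

lemma ipL_apply (x y : Y) : Y.ipL x y = Y.ip x y := rfl

lemma continuous_ip : Continuous fun p : Y × Y => Y.ip p.1 p.2 := by
  simp_rw [← ipL_apply]; fun_prop

lemma act_add (x y : Y) (a : A) : Y.act (x + y) a = Y.act x a + Y.act y a :=
  (Y.toForm.act a).map_add x y
lemma act_smul (c : ℂ) (x : Y) (a : A) : Y.act (c • x) a = c • Y.act x a :=
  (Y.toForm.act a).map_smul c x

lemma norm_act_le (x : Y) (a : A) : ‖Y.act x a‖ ≤ ‖x‖ * ‖a‖ := by
  refine le_of_sq_le_sq ?_ (by positivity)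
  rw [mul_pow, norm_sq, norm_sq, ip_act_right, ip_act_left]
  calc ‖star a * Y.ip x x * a‖ ≤ ‖star a‖ * ‖Y.ip x x‖ * ‖a‖ := norm_mul₃_le
    _ = ‖Y.ip x x‖ * ‖a‖ ^ 2 := by rw [norm_star]; ring

/-- The bounded operator `a ↦ ξ a`. -/
def actL (x : Y) : A →L[ℂ] Y :=
  LinearMap.mkContinuous
    { toFun := fun a => Y.act x a
      map_add' := fun a b => ext_ip fun z => by
        rw [ip_act_right, ip_add_right, ip_act_right, ip_act_right, mul_add]
      map_smul' := fun c a => ext_ip fun z => by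
        rw [ip_act_right, RingHom.id_apply, ip_smul_right, ip_act_right, mul_smul_comm] } ‖x‖
    fun a => Y.norm_act_le x a

end HilbMod

/-- The algebra of adjointable operators on a Hilbert module, as a subalgebra of the bounded
operators. -/
def adjSub (Y : HilbMod A) : Subalgebra ℂ (Y →L[ℂ] Y) where
  carrier := {T | ∃ T' : Y →L[ℂ] Y, ∀ x y, Y.ip (T x) y = Y.ip x (T' y)}
  mul_mem' := by
    rintro S T ⟨S', hS⟩ ⟨T', hT⟩
    exact ⟨T' * S', fun x y => by simp [hS, hT]⟩
  add_mem' := by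
    rintro S T ⟨S', hS⟩ ⟨T', hT⟩
    exact ⟨S' + T', fun x y => by simp [hS, hT, Y.ip_add_left, Y.ip_add_right]⟩
  algebraMap_mem' c := ⟨star c • 1, fun x y => by
    simp [Algebra.algebraMap_eq_smul_one, Y.ip_smul_left, Y.ip_smul_right]⟩

/-- The `C*`-algebra `ℒ(Y)` of adjointable operators on a Hilbert module `Y`, with the operator
norm. -/
def Adj (Y : HilbMod A) : Type u := adjSub Y

namespace Adj

variable {Y : HilbMod A}

instance : NormedRing (Adj Y) := inferInstanceAs (NormedRing (adjSub Y))
instance : NormedAlgebra ℂ (Adj Y) := inferInstanceAs (NormedAlgebra ℂ (adjSub Y))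

/-- The adjointable operator `T` with adjoint `T'`. -/
def mk (T T' : Y →L[ℂ] Y) (h : ∀ x y, Y.ip (T x) y = Y.ip x (T' y)) : Adj Y :=
  show adjSub Y from ⟨T, T', h⟩

/-- The underlying bounded operator. -/
def toL (T : Adj Y) : Y →L[ℂ] Y := Subtype.val (p := fun T => T ∈ adjSub Y) T

lemma toL_injective : Function.Injective (toL : Adj Y → Y →L[ℂ] Y) := Subtype.val_injective

instance : FunLike (Adj Y) Y Y where
  coe T := T.toL
  coe_injective _ _ h := toL_injective (DFunLike.coe_injective h)

lemma exists_adjoint (T : Adj Y) : ∃ T' : Y →L[ℂ] Y, ∀ x y, Y.ip (T x) y = Y.ip x (T' y) :=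
  Subtype.property (p := fun T => T ∈ adjSub Y) T

lemma isometry_toL : Isometry (toL : Adj Y → Y →L[ℂ] Y) := isometry_subtype_coe

lemma coe_apply (T : Adj Y) (x : Y) : T.toL x = T x := rfl
@[ext] lemma ext {S T : Adj Y} (h : ∀ x, S x = T x) : S = T := DFunLike.ext _ _ h
@[simp] lemma mul_apply (S T : Adj Y) (x : Y) : (S * T) x = S (T x) := rfl
@[simp] lemma one_apply (x : Y) : (1 : Adj Y) x = x := rfl
@[simp] lemma add_apply (S T : Adj Y) (x : Y) : (S + T) x = S x + T x := rfl
@[simp] lemma sub_apply (S T : Adj Y) (x : Y) : (S - T) x = S x - T x := rfl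
@[simp] lemma neg_apply (S : Adj Y) (x : Y) : (-S) x = -S x := rfl
@[simp] lemma zero_apply (x : Y) : (0 : Adj Y) x = 0 := rfl
@[simp] lemma smul_apply (c : ℂ) (T : Adj Y) (x : Y) : (c • T) x = c • T x := rfl
@[simp] lemma map_add' (T : Adj Y) (x y : Y) : T (x + y) = T x + T y := T.toL.map_add x y
@[simp] lemma map_smul' (T : Adj Y) (c : ℂ) (x : Y) : T (c • x) = c • T x := T.toL.map_smul c x

lemma norm_apply_le (T : Adj Y) (x : Y) : ‖T x‖ ≤ ‖T‖ * ‖x‖ := T.toL.le_opNorm x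

lemma norm_le (T : Adj Y) {C : ℝ} (hC : 0 ≤ C) (h : ∀ x, ‖T x‖ ≤ C * ‖x‖) : ‖T‖ ≤ C :=
  T.toL.opNorm_le_bound hC h

/-- The adjoint. -/
instance : Star (Adj Y) where
  star T := mk T.exists_adjoint.choose T.toL fun x y => by
    rw [← Y.star_ip, coe_apply, ← T.exists_adjoint.choose_spec, Y.star_ip]

lemma ip_left (T : Adj Y) (x y : Y) : Y.ip (T x) y = Y.ip x (star T y) := T.exists_adjoint.choose_spec x y
lemma ip_right (T : Adj Y) (x y : Y) : Y.ip x (T y) = Y.ip (star T x) y := by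
  rw [← Y.star_ip (T y) x, ip_left T y x, Y.star_ip]

lemma eq_star {S T : Adj Y} (h : ∀ x y, Y.ip (T x) y = Y.ip x (S y)) : star T = S := by
  ext y
  exact HilbMod.ext_ip fun x => by rw [← ip_left, h]

instance : StarRing (Adj Y) where
  star_involutive T := eq_star fun x y => (ip_right T x y).symm
  star_mul S T := eq_star fun x y => by simp [ip_left]
  star_add S T := eq_star fun x y => by simp [ip_left, Y.ip_add_left, Y.ip_add_right]

instance : StarModule ℂ (Adj Y) where
  star_smul c T := eq_star fun x y => by simp [ip_left, Y.ip_smul_left, Y.ip_smul_right]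

instance : CStarRing (Adj Y) where
  norm_mul_self_le T := by
    have h : ‖T‖ ≤ √‖star T * T‖ := by
      refine norm_le _ (Real.sqrt_nonneg _) fun x => ?_
      refine le_of_sq_le_sq ?_ (by positivity)
      rw [mul_pow, Real.sq_sqrt (norm_nonneg (star T * T)), HilbMod.norm_sq]
      rw [ip_left, ← mul_apply]
      calc _ ≤ ‖x‖ * ‖(star T * T) x‖ := Y.norm_ip_le _ _
        _ ≤ ‖x‖ * (‖star T * T‖ * ‖x‖) := by gcongr; exact norm_apply_le _ _
        _ = _ := by ring
    rw [← pow_two]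
    exact (Real.le_sqrt (norm_nonneg _) (norm_nonneg _)).1 h

end Adj

namespace Adj

variable {Y : HilbMod A}

instance : CompleteSpace (Adj Y) := by
  refine Metric.complete_of_cauchySeq_tendsto fun s hs => ?_
  have h1 : CauchySeq fun n => (s n).toL := hs.map isometry_toL.uniformContinuous
  have h2 : CauchySeq fun n => (star (s n)).toL :=
    (hs.map (starₗᵢ ℂ (E := Adj Y)).isometry.uniformContinuous).map isometry_toL.uniformContinuous
  obtain ⟨T, hT⟩ := cauchySeq_tendsto_of_complete h1
  obtain ⟨T', hT'⟩ := cauchySeq_tendsto_of_complete h2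
  have hmem : ∀ x y, Y.ip (T x) y = Y.ip x (T' y) := fun x y => by
    have e1 : Filter.Tendsto (fun n => Y.ip ((s n).toL x) y) Filter.atTop (nhds (Y.ip (T x) y)) :=
      (Y.continuous_ip.tendsto (T x, y)).comp
        ((((ContinuousLinearMap.apply ℂ Y x).continuous.tendsto T).comp hT).prodMk_nhds
          tendsto_const_nhds)
    have e2 : Filter.Tendsto (fun n => Y.ip x ((star (s n)).toL y)) Filter.atTop
        (nhds (Y.ip x (T' y))) :=
      (Y.continuous_ip.tendsto (x, T' y)).comp
        (tendsto_const_nhds.prodMk_nhds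
          (((ContinuousLinearMap.apply ℂ Y y).continuous.tendsto T').comp hT'))
    refine tendsto_nhds_unique e1 (e2.congr fun n => ?_)
    exact (ip_left (s n) x y).symm
  exact ⟨mk T T' hmem, isometry_toL.isEmbedding.tendsto_nhds_iff.2 hT⟩

instance : CStarAlgebra (Adj Y) where

lemma exists_star_mul_self (T : Adj Y) :
    ∃ R : Adj Y, ((‖T‖ ^ 2 : ℝ) : ℂ) • (1 : Adj Y) - star T * T = star R * R := by
  let _ := CStarAlgebra.spectralOrder (Adj Y)
  have := CStarAlgebra.spectralOrderedRing (Adj Y)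
  have h : star T * T ≤ algebraMap ℝ (Adj Y) (‖T‖ ^ 2) := by
    rw [pow_two, ← CStarRing.norm_star_mul_self]
    exact (IsSelfAdjoint.star_mul_self T).le_algebraMap_norm_self
  obtain ⟨R, hR⟩ := CStarAlgebra.nonneg_iff_eq_star_mul_self.1 (sub_nonneg.2 h)
  refine ⟨R, ?_⟩
  rw [← hR, Algebra.algebraMap_eq_smul_one]
  rfl

/-- The rank-one operator `θ_{ξ,η} : ζ ↦ ξ ⟨η, ζ⟩`. -/
def theta (x y : Y) : Adj Y :=
  mk (Y.actL x ∘L Y.ipL y) (Y.actL y ∘L Y.ipL x) fun z w => by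
    change Y.ip (Y.act x (Y.ip y z)) w = Y.ip z (Y.act y (Y.ip x w))
    rw [Y.ip_act_left, Y.ip_act_right, Y.star_ip]

lemma theta_apply (x y z : Y) : theta x y z = Y.act x (Y.ip y z) := rfl

lemma star_theta (x y : Y) : star (theta x y) = theta y x := eq_star fun z w => by
  rw [theta_apply, theta_apply, Y.ip_act_left, Y.ip_act_right, Y.star_ip]

lemma map_act (T : Adj Y) (x : Y) (a : A) : T (Y.act x a) = Y.act (T x) a :=
  HilbMod.ext_ip fun z => by rw [ip_right, Y.ip_act_right, Y.ip_act_right, ip_right]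

lemma mul_theta (T : Adj Y) (x y : Y) : T * theta x y = theta (T x) y := by
  ext z
  rw [mul_apply, theta_apply, theta_apply, map_act]

lemma theta_mul (T : Adj Y) (x y : Y) : theta x y * T = theta x (star T y) := by
  ext z
  rw [mul_apply, theta_apply, theta_apply, ip_right]

variable (Y) in
/-- The linear span of the rank-one operators. -/
def finiteRank : Submodule ℂ (Adj Y) :=
  Submodule.span ℂ (Set.range fun p : Y × Y => theta p.1 p.2)

lemma mul_mem_finiteRank (T : Adj Y) {S : Adj Y} (hS : S ∈ finiteRank Y) :
    T * S ∈ finiteRank Y := by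
  induction hS using Submodule.span_induction with
  | mem S hS =>
    obtain ⟨p, rfl⟩ := hS
    rw [mul_theta]
    exact Submodule.subset_span ⟨(T p.1, p.2), rfl⟩
  | zero => rw [mul_zero]; exact Submodule.zero_mem _
  | add S S' _ _ h h' => rw [mul_add]; exact Submodule.add_mem _ h h'
  | smul c S _ h => rw [mul_smul_comm]; exact Submodule.smul_mem _ c h

lemma star_mem_finiteRank {S : Adj Y} (hS : S ∈ finiteRank Y) : star S ∈ finiteRank Y := by
  induction hS using Submodule.span_induction with
  | mem S hS =>
    obtain ⟨p, rfl⟩ := hS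
    rw [star_theta]
    exact Submodule.subset_span ⟨(p.2, p.1), rfl⟩
  | zero => rw [star_zero]; exact Submodule.zero_mem _
  | add S S' _ _ h h' => rw [star_add]; exact Submodule.add_mem _ h h'
  | smul c S _ h => rw [star_smul]; exact Submodule.smul_mem _ _ h

lemma mul_mem_closure (T : Adj Y) {S : Adj Y} (hS : S ∈ (finiteRank Y).topologicalClosure) :
    T * S ∈ (finiteRank Y).topologicalClosure :=
  map_mem_closure (f := fun S => T * S) (by fun_prop) hS fun _ h => mul_mem_finiteRank T h

lemma star_mem_closure {S : Adj Y} (hS : S ∈ (finiteRank Y).topologicalClosure) :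
    star S ∈ (finiteRank Y).topologicalClosure :=
  map_mem_closure (f := fun S : Adj Y => star S) (by fun_prop) hS fun _ h => star_mem_finiteRank h

variable (Y) in
/-- The `C*`-algebra `𝒦(Y)` of compact operators: the closed linear span of the rank-one
operators. -/
def compacts : NonUnitalStarSubalgebra ℂ (Adj Y) where
  toNonUnitalSubsemiring :=
    { carrier := (finiteRank Y).topologicalClosure
      add_mem' := Submodule.add_mem _
      zero_mem' := Submodule.zero_mem _
      mul_mem' := fun _ h => mul_mem_closure _ h }
  smul_mem' c _ h := Submodule.smul_mem _ c h
  star_mem' h := star_mem_closure h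

lemma mem_compacts {S : Adj Y} : S ∈ compacts Y ↔ S ∈ (finiteRank Y).topologicalClosure := Iff.rfl

lemma mul_mem_compacts (T : Adj Y) {S : Adj Y} (hS : S ∈ compacts Y) : T * S ∈ compacts Y :=
  mul_mem_closure T hS

lemma mul_mem_compacts' (T : Adj Y) {S : Adj Y} (hS : S ∈ compacts Y) : S * T ∈ compacts Y := by
  have := star_mem (mul_mem_compacts (star T) (star_mem hS))
  rwa [star_mul, star_star, star_star] at this

lemma theta_mem_compacts (x y : Y) : theta x y ∈ compacts Y :=
  Submodule.le_topologicalClosure _ (Submodule.subset_span ⟨(x, y), rfl⟩)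

instance : IsClosed (compacts Y : Set (Adj Y)) := Submodule.isClosed_topologicalClosure _

end Adj

/-- The type of compact operators on `Y`. -/
def Cpt (Y : HilbMod A) : Type u := Adj.compacts Y

namespace Cpt

variable {Y : HilbMod A}

instance : NonUnitalCStarAlgebra (Cpt Y) := inferInstanceAs (NonUnitalCStarAlgebra (Adj.compacts Y))

/-- A compact operator, given as an element of `𝒦(Y)`. -/
def mk (T : Adj Y) (hT : T ∈ Adj.compacts Y) : Cpt Y := show Adj.compacts Y from ⟨T, hT⟩

/-- The inclusion `𝒦(Y) → ℒ(Y)`. -/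
def incl : Cpt Y →⋆ₙₐ[ℂ] Adj Y := NonUnitalStarSubalgebraClass.subtype (Adj.compacts Y)

/-- The underlying adjointable operator. -/
def op (S : Cpt Y) : Adj Y := incl S

lemma op_mk (T : Adj Y) (hT : T ∈ Adj.compacts Y) : (mk T hT).op = T := rfl

lemma op_mem (S : Cpt Y) : S.op ∈ Adj.compacts Y := Subtype.property (p := (· ∈ Adj.compacts Y)) S

lemma op_injective : Function.Injective (op : Cpt Y → Adj Y) := Subtype.val_injective

lemma op_add (S T : Cpt Y) : (S + T).op = S.op + T.op := rfl
lemma op_mul (S T : Cpt Y) : (S * T).op = S.op * T.op := rfl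
lemma op_smul (c : ℂ) (S : Cpt Y) : (c • S).op = c • S.op := rfl
lemma op_star (S : Cpt Y) : (star S).op = star S.op := rfl
lemma op_zero : (0 : Cpt Y).op = 0 := rfl
lemma norm_op (S : Cpt Y) : ‖S.op‖ = ‖S‖ := rfl

/-- The rank-one operator `θ_{ξ,η}` as a compact operator. -/
def theta (x y : Y) : Cpt Y := mk (Adj.theta x y) (Adj.theta_mem_compacts x y)

end Cpt

namespace HilbMod

variable (A) in
/-- The algebra `A` as a Hilbert module over itself, with `⟨a, b⟩ = a* b`. -/
def self : HilbMod A where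
  carrier := A
  toForm :=
    { act := fun a => LinearMap.mulRight ℂ a
      form := fun a b => star a * b
      form_add_right := fun a b c => mul_add _ _ _
      form_smul_right := fun c a b => mul_smul_comm _ _ _
      form_act_right := fun a b c => (mul_assoc _ _ _).symm
      star_form := fun a b => by rw [star_mul, star_star]
      form_self_nonneg := star_mul_self_nonneg }
  norm_sq' a := by rw [CStarRing.norm_star_mul_self, pow_two]

/-- An element of `A` as a vector of the Hilbert module `A`. -/
def ofAlg (a : A) : self A := a
/-- A vector of the Hilbert module `A` as an element of `A`. -/
def toAlg (x : self A) : A := x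

lemma self_ip (x y : self A) : (self A).ip x y = star (toAlg x) * toAlg y := rfl

/-- Left multiplication `L_a : b ↦ a b` as an adjointable operator. -/
def leftMul : A →⋆ₙₐ[ℂ] Adj (self A) where
  toFun a := Adj.mk (ContinuousLinearMap.mul ℂ A a) (ContinuousLinearMap.mul ℂ A (star a))
    fun x y => by
      change star (a * toAlg x) * toAlg y = star (toAlg x) * (star a * toAlg y)
      rw [star_mul, mul_assoc]
  map_zero' := Adj.ext fun x => zero_mul (toAlg x)
  map_add' a b := Adj.ext fun x => add_mul a b (toAlg x)
  map_mul' a b := Adj.ext fun x => mul_assoc a b (toAlg x)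
  map_smul' c a := Adj.ext fun x => smul_mul_assoc c a (toAlg x)
  map_star' a := (Adj.eq_star fun x y => by
    change star (a * toAlg x) * toAlg y = star (toAlg x) * (star a * toAlg y)
    rw [star_mul, mul_assoc]).symm

lemma leftMul_apply (a : A) (x : self A) : leftMul a x = ofAlg (a * toAlg x) := rfl

lemma leftMul_injective : Function.Injective (leftMul : A → Adj (self A)) := by
  rw [injective_iff_map_eq_zero]
  intro a ha
  have h : a * star a = 0 := congrArg (fun T : Adj (self A) => T (ofAlg (star a))) ha
  exact CStarRing.mul_star_self_eq_zero_iff a |>.1 h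

lemma leftMul_mul_star (a b : A) : leftMul (a * star b) = Adj.theta (ofAlg a) (ofAlg b) :=
  Adj.ext fun x => mul_assoc a (star b) (toAlg x)

lemma leftMul_mem_compacts (a : A) : leftMul a ∈ Adj.compacts (self A) := by
  have h : a ∈ Submodule.span ℂ {a : A | 0 ≤ a} := by
    rw [CStarAlgebra.span_nonneg]; trivial
  induction h using Submodule.span_induction with
  | mem a ha =>
    obtain ⟨s, rfl⟩ := CStarAlgebra.nonneg_iff_eq_mul_star_self.1 ha
    rw [leftMul_mul_star]
    exact Adj.theta_mem_compacts _ _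
  | zero => rw [map_zero]; exact zero_mem _
  | add a b _ _ h h' => rw [map_add]; exact add_mem h h'
  | smul c a _ h => rw [map_smul]; exact SMulMemClass.smul_mem c h

lemma exists_leftMul_eq {S : Adj (self A)} (hS : S ∈ Adj.compacts (self A)) :
    ∃ a : A, leftMul a = S := by
  have hiso : Isometry (leftMul : A → Adj (self A)) :=
    NonUnitalStarAlgHom.isometry (leftMul : A →⋆ₙₐ[ℂ] Adj (self A)) leftMul_injective
  have hcl : IsClosed (Set.range (leftMul : A → Adj (self A))) :=
    hiso.isClosedEmbedding.isClosed_range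
  refine closure_minimal ?_ hcl hS
  intro T hT
  induction hT using Submodule.span_induction with
  | mem T hT =>
    obtain ⟨p, rfl⟩ := hT
    exact ⟨toAlg p.1 * star (toAlg p.2), leftMul_mul_star _ _⟩
  | zero => exact ⟨0, map_zero _⟩
  | add _ _ _ _ h h' =>
    obtain ⟨a, rfl⟩ := h
    obtain ⟨b, rfl⟩ := h'
    exact ⟨a + b, map_add _ _ _⟩
  | smul c _ _ h =>
    obtain ⟨a, rfl⟩ := h
    exact ⟨c • a, map_smul _ _ _⟩

lemma exists_leftMul_eq_op (S : Cpt (self A)) : ∃ a : A, leftMul a = S.op :=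
  exists_leftMul_eq S.op_mem

/-- The unique `a` with `S = L_a`, for a compact operator `S` on `A`. -/
def algOfCompact (S : Cpt (self A)) : A := (exists_leftMul_eq_op S).choose

lemma leftMul_algOfCompact (S : Cpt (self A)) : leftMul (algOfCompact S) = S.op :=
  (exists_leftMul_eq_op S).choose_spec

/-- The identification `𝒦(A) = A`: a compact operator `S` on `A` is sent to the unique `a`
with `S = L_a`. -/
def compactsToAlg : Cpt (self A) →⋆ₙₐ[ℂ] A where
  toFun := algOfCompact
  map_zero' := leftMul_injective <| by rw [leftMul_algOfCompact, map_zero]; rfl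
  map_add' S T := leftMul_injective <| by
    rw [leftMul_algOfCompact, map_add, leftMul_algOfCompact, leftMul_algOfCompact]; rfl
  map_mul' S T := leftMul_injective <| by
    rw [leftMul_algOfCompact, map_mul, leftMul_algOfCompact, leftMul_algOfCompact]; rfl
  map_smul' c S := leftMul_injective <| by
    rw [leftMul_algOfCompact, map_smul, leftMul_algOfCompact]; rfl
  map_star' S := leftMul_injective <| by
    rw [leftMul_algOfCompact, map_star, leftMul_algOfCompact]; rfl

lemma leftMul_compactsToAlg (S : Cpt (self A)) : leftMul (compactsToAlg S) = S.op :=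
  leftMul_algOfCompact S

end HilbMod

/-- A Hilbert `A`-bimodule: a right Hilbert `A`-module `X` with a `*`-homomorphism
`φ : A → ℒ(X)`, the left action. -/
structure HilbBimod (A : Type u) [NonUnitalCStarAlgebra A] [PartialOrder A] [StarOrderedRing A] where
  /-- the underlying right Hilbert module -/
  toHilbMod : HilbMod A
  /-- the left action -/
  φ : A →⋆ₙₐ[ℂ] Adj toHilbMod

instance : CoeSort (HilbBimod A) (Type u) := ⟨fun X => X.toHilbMod⟩

/-- The negative part `N` of a self-adjoint element `M`, by its algebraic properties. -/
lemma exists_negPart {𝔐 : Type*} [NonUnitalCStarAlgebra 𝔐] (M : 𝔐) (hM : IsSelfAdjoint M) :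
    ∃ N R : 𝔐, star N = N ∧ star N * M * N = -(star R * R) ∧ N * N * N = star R * R ∧
      (N = 0 → ∃ B, M = star B * B) := by
  let _ := CStarAlgebra.spectralOrder 𝔐
  have := CStarAlgebra.spectralOrderedRing 𝔐
  have hN0 : 0 ≤ M⁻ := CFC.negPart_nonneg M
  have hNs : star M⁻ = M⁻ := (IsSelfAdjoint.of_nonneg hN0).star_eq
  have hP : 0 ≤ M⁻ * M⁻ * M⁻ := by
    have := star_left_conjugate_nonneg hN0 M⁻
    rwa [hNs] at this
  obtain ⟨R, hR⟩ := CStarAlgebra.nonneg_iff_eq_star_mul_self.1 hP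
  refine ⟨M⁻, R, hNs, ?_, hR, fun h => ?_⟩
  · rw [← hR, hNs]
    conv_lhs => rw [← CFC.posPart_sub_negPart M hM]
    rw [CFC.posPart_sub_negPart M hM]
    have : M * M⁻ = -(M⁻ * M⁻) := by
      conv_lhs => enter [1]; rw [← CFC.posPart_sub_negPart M hM]
      rw [sub_mul, CFC.posPart_mul_negPart, zero_sub]
    rw [mul_assoc, this, mul_neg, mul_assoc]
  · exact CStarAlgebra.nonneg_iff_eq_star_mul_self.1 ((CFC.negPart_eq_zero_iff M hM).1 h)

/-- A self-adjoint matrix over a `C*`-algebra whose quadratic form is positive is positive. -/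
lemma exists_star_mul_self_of_form_nonneg {ι : Type*} [Fintype ι] (M : CStarMatrix ι ι A)
    (hM : IsSelfAdjoint M) (h : ∀ c : ι → A, 0 ≤ ∑ i, ∑ j, star (c i) * M i j * c j) :
    ∃ B : CStarMatrix ι ι A, M = star B * B := by
  obtain ⟨N, R, hNs, h1, hR, hB⟩ := exists_negPart M hM
  refine hB ?_
  have hR0 : R = 0 := by
    ext k j
    have hd : 0 ≤ (star N * M * N) j j := by
      have := h fun i => N i j
      simp only [CStarMatrix.mul_apply, CStarMatrix.star_apply, Finset.sum_mul]
      rw [Finset.sum_comm]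
      exact this
    rw [h1] at hd
    have hd' : ∑ i, star (R i j) * R i j ≤ 0 := by
      have : (star R * R) j j ≤ 0 := by
        have h3 : (-(star R * R)) j j = -((star R * R) j j) := rfl
        rw [h3] at hd
        exact neg_nonneg.1 hd
      simpa only [CStarMatrix.mul_apply, CStarMatrix.star_apply] using this
    have h4 : star (R k j) * R k j ≤ 0 :=
      (Finset.single_le_sum (f := fun i => star (R i j) * R i j)
        (fun i _ => star_mul_self_nonneg _) (Finset.mem_univ k)).trans hd'
    exact (CStarRing.star_mul_self_eq_zero_iff _).1 (le_antisymm h4 (star_mul_self_nonneg _))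
  rw [hR0, mul_zero] at hR
  have h5 : N * N = 0 := by
    rw [← CStarRing.star_mul_self_eq_zero_iff, star_mul, hNs, ← mul_assoc, hR, zero_mul]
  rw [← CStarRing.star_mul_self_eq_zero_iff, hNs, h5]

/-- A sum of adjointable operators, applied to a vector. -/
lemma Adj.sum_apply {Y : HilbMod A} {ι : Type*} (s : Finset ι) (T : ι → Adj Y) (x : Y) :
    (∑ i ∈ s, T i) x = ∑ i ∈ s, T i x := by
  classical
  induction s using Finset.induction_on with
  | empty => simp
  | insert a s ha ih => rw [Finset.sum_insert ha, Finset.sum_insert ha, Adj.add_apply, ih]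

lemma HilbMod.ip_sum_sum (Y : HilbMod A) {ι : Type*} [Fintype ι] (x y : ι → Y) :
    Y.ip (∑ i, x i) (∑ j, y j) = ∑ i, ∑ j, Y.ip (x i) (y j) := by
  simp only [HilbMod.ip, RightForm.form_sum_left, RightForm.form_sum_right]
  exact Finset.sum_comm

section Tensor

variable (Y : HilbMod A) (X : HilbBimod A)

local notation "Xm" => HilbBimod.toHilbMod X

/-- The sesquilinear form `⟨ξ ⊗ η, ξ' ⊗ η'⟩ = ⟨η, φ(⟨ξ, ξ'⟩) η'⟩` on the algebraic tensor product. -/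
def tensorFormₛₗ : (Y ⊗[ℂ] Xm) →ₗ⋆[ℂ] (Y ⊗[ℂ] Xm) →ₗ[ℂ] A :=
  TensorProduct.lift <| LinearMap.mk₂'ₛₗ (starRingEnd ℂ) (starRingEnd ℂ)
    (fun (y : Y) (x : Xm) => TensorProduct.lift <| LinearMap.mk₂ ℂ
      (fun (y' : Y) (x' : Xm) => (Xm).ip x (X.φ (Y.ip y y') x'))
      (fun y₁ y₂ x' => by
        rw [Y.ip_add_right, map_add, Adj.add_apply, HilbMod.ip_add_right])
      (fun c y₁ x' => by
        rw [Y.ip_smul_right, map_smul, Adj.smul_apply, HilbMod.ip_smul_right])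
      (fun y₁ x₁ x₂ => by rw [Adj.map_add', HilbMod.ip_add_right])
      (fun c y₁ x₁ => by rw [Adj.map_smul', HilbMod.ip_smul_right]))
    (fun y₁ y₂ x => TensorProduct.ext' fun y' x' => by
      simp [Y.ip_add_left, HilbMod.ip_add_right])
    (fun c y₁ x => TensorProduct.ext' fun y' x' => by
      simp [Y.ip_smul_left, HilbMod.ip_smul_right])
    (fun y x₁ x₂ => TensorProduct.ext' fun y' x' => by
      simp [HilbMod.ip_add_left])
    (fun c y x => TensorProduct.ext' fun y' x' => by
      simp [HilbMod.ip_smul_left])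

lemma tensorFormₛₗ_tmul (y y' : Y) (x x' : Xm) :
    tensorFormₛₗ Y X (y ⊗ₜ x) (y' ⊗ₜ x') = (Xm).ip x (X.φ (Y.ip y y') x') := rfl

variable {Y X} in
lemma tensor_exists_sum (u : Y ⊗[ℂ] Xm) :
    ∃ (ι : Type u) (_ : Fintype ι) (y : ι → Y) (x : ι → Xm), u = ∑ i, y i ⊗ₜ[ℂ] x i := by
  obtain ⟨S, hS⟩ := TensorProduct.exists_finsupp_left u
  refine ⟨S.support, inferInstance, fun i => i.1, fun i => S i.1, ?_⟩
  rw [hS, Finsupp.sum]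
  exact (Finset.sum_coe_sort S.support fun i => i ⊗ₜ[ℂ] S i).symm

lemma star_tensorFormₛₗ (u v : Y ⊗[ℂ] Xm) :
    star (tensorFormₛₗ Y X u v) = tensorFormₛₗ Y X v u := by
  induction u with
  | zero => simp
  | add a b ha hb => simp [ha, hb]
  | tmul y x =>
    induction v with
    | zero => simp
    | add a b ha hb => simp [ha, hb]
    | tmul y' x' =>
      rw [tensorFormₛₗ_tmul, tensorFormₛₗ_tmul, HilbMod.star_ip, Adj.ip_left, ← map_star,
        HilbMod.star_ip]

lemma tensorFormₛₗ_self_nonneg (u : Y ⊗[ℂ] Xm) : 0 ≤ tensorFormₛₗ Y X u u := by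
  obtain ⟨ι, _, y, x, rfl⟩ := tensor_exists_sum u
  obtain ⟨B, hB⟩ := exists_star_mul_self_of_form_nonneg
    (CStarMatrix.ofMatrix (Matrix.of fun i j => Y.ip (y i) (y j))) (by
      ext i j
      rw [CStarMatrix.star_apply]
      exact Y.star_ip _ _) (fun c => by
      have h := Y.ip_self_nonneg (∑ i, Y.act (y i) (c i))
      have e : Y.ip (∑ i, Y.act (y i) (c i)) (∑ i, Y.act (y i) (c i)) =
          ∑ i, ∑ j, star (c i) * Y.ip (y i) (y j) * c j := by
        simp only [HilbMod.ip_sum_sum, Y.ip_act_left, Y.ip_act_right, mul_assoc]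
      rw [e] at h
      exact h)
  have hB' : ∀ i j, Y.ip (y i) (y j) = ∑ k, star (B k i) * B k j := fun i j => by
    have := congrArg (fun M : CStarMatrix ι ι A => M i j) hB
    simp only [CStarMatrix.mul_apply, CStarMatrix.star_apply] at this
    exact this
  have e : tensorFormₛₗ Y X (∑ i, y i ⊗ₜ[ℂ] x i) (∑ i, y i ⊗ₜ[ℂ] x i) =
      ∑ k, (Xm).ip (∑ i, X.φ (B k i) (x i)) (∑ j, X.φ (B k j) (x j)) := by
    have e1 : ∀ k, (Xm).ip (∑ i, X.φ (B k i) (x i)) (∑ j, X.φ (B k j) (x j)) =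
        ∑ i, ∑ j, (Xm).ip (x i) (X.φ (star (B k i) * B k j) (x j)) := fun k => by
      rw [HilbMod.ip_sum_sum]
      refine Finset.sum_congr rfl fun i _ => Finset.sum_congr rfl fun j _ => ?_
      rw [Adj.ip_left, map_mul, map_star, Adj.mul_apply]
    have e2 : ∀ i j, (Xm).ip (x i) (X.φ (Y.ip (y i) (y j)) (x j)) =
        ∑ k, (Xm).ip (x i) (X.φ (star (B k i) * B k j) (x j)) := fun i j => by
      rw [hB', map_sum, Adj.sum_apply]
      exact RightForm.form_sum_right _ _ _ _
    have e3 : tensorFormₛₗ Y X (∑ i, y i ⊗ₜ[ℂ] x i) (∑ i, y i ⊗ₜ[ℂ] x i) =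
        ∑ i, ∑ j, (Xm).ip (x i) (X.φ (Y.ip (y i) (y j)) (x j)) := by
      simp only [map_sum, LinearMap.sum_apply, tensorFormₛₗ_tmul]
      exact Finset.sum_comm
    rw [e3]
    simp only [e1, e2]
    rw [Finset.sum_congr rfl fun i _ => Finset.sum_comm]
    exact Finset.sum_comm
  rw [e]
  exact Finset.sum_nonneg fun k _ => HilbMod.ip_self_nonneg _ _

/-- The algebraic tensor product `Y ⊗ X` as a semi-inner-product right `A`-module. The vectors
`ξ a ⊗ η - ξ ⊗ φ(a) η` have length zero. -/
def tensorForm : RightForm A (Y ⊗[ℂ] Xm) where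
  act a := LinearMap.lTensor Y ((Xm).toForm.act a)
  form u v := tensorFormₛₗ Y X u v
  form_add_right u v w := map_add _ _ _
  form_smul_right c u v := map_smul _ _ _
  form_act_right u v a := by
    induction v with
    | zero => simp
    | add v w hv hw => simp only [map_add, add_mul, hv, hw]
    | tmul y' x' =>
      induction u with
      | zero => simp
      | add v w hv hw => simp only [map_add, LinearMap.add_apply, add_mul, hv, hw]
      | tmul y x =>
        rw [LinearMap.lTensor_tmul, tensorFormₛₗ_tmul, tensorFormₛₗ_tmul]
        change (Xm).ip x (X.φ (Y.ip y y') ((Xm).act x' a)) = _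
        rw [Adj.map_act, HilbMod.ip_act_right]
  star_form := star_tensorFormₛₗ Y X
  form_self_nonneg := tensorFormₛₗ_self_nonneg Y X

/-- The balanced (interior) tensor product `Y ⊗_φ X`. -/
def HilbMod.tensor : HilbMod A := (tensorForm Y X).completion

/-- The canonical map of the algebraic tensor product into `Y ⊗_φ X`. -/
def tensorι : Y ⊗[ℂ] Xm →ₗ[ℂ] HilbMod.tensor Y X := (tensorForm Y X).toCompletion

variable {Y X} in
/-- The elementary tensor `ξ ⊗ η` in `Y ⊗_φ X`. -/
def HilbMod.tmul (y : Y) (x : Xm) : HilbMod.tensor Y X := tensorι Y X (y ⊗ₜ x)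

lemma ip_tensorι (u v : Y ⊗[ℂ] Xm) :
    (HilbMod.tensor Y X).ip (tensorι Y X u) (tensorι Y X v) = tensorFormₛₗ Y X u v :=
  (tensorForm Y X).ip_toCompletion u v

lemma denseRange_tensorι : DenseRange (tensorι Y X) :=
  (tensorForm Y X).denseRange_toCompletion

lemma ip_tmul (y y' : Y) (x x' : Xm) : (HilbMod.tensor Y X).ip (HilbMod.tmul y x)
    (HilbMod.tmul y' x') = (Xm).ip x (X.φ (Y.ip y y') x') :=
  ip_tensorι Y X _ _

lemma form_rTensor (T : Adj Y) (u v : Y ⊗[ℂ] Xm) :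
    tensorFormₛₗ Y X (LinearMap.rTensor Xm T.toL.toLinearMap u) v =
      tensorFormₛₗ Y X u (LinearMap.rTensor Xm (star T).toL.toLinearMap v) := by
  induction v with
  | zero => simp
  | add v w hv hw => simp only [map_add, hv, hw]
  | tmul y' x' =>
    induction u with
    | zero => simp
    | add v w hv hw => simp only [map_add, LinearMap.add_apply, hv, hw]
    | tmul y x =>
      rw [LinearMap.rTensor_tmul, LinearMap.rTensor_tmul, tensorFormₛₗ_tmul, tensorFormₛₗ_tmul]
      have : Y.ip (T y) y' = Y.ip y (star T y') := Adj.ip_left T y y'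
      change (Xm).ip x (X.φ (Y.ip (T y) y') x') = (Xm).ip x (X.φ (Y.ip y (star T y')) x')
      rw [this]

lemma norm_rTensor_le (T : Adj Y) (w : Y ⊗[ℂ] Xm) :
    ‖tensorFormₛₗ Y X (LinearMap.rTensor Xm T.toL.toLinearMap w)
      (LinearMap.rTensor Xm T.toL.toLinearMap w)‖ ≤ ‖T‖ ^ 2 * ‖tensorFormₛₗ Y X w w‖ := by
  obtain ⟨R, hR⟩ := Adj.exists_star_mul_self T
  have hcomp : ∀ S : Adj Y, tensorFormₛₗ Y X (LinearMap.rTensor Xm S.toL.toLinearMap w)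
      (LinearMap.rTensor Xm S.toL.toLinearMap w) =
      tensorFormₛₗ Y X w (LinearMap.rTensor Xm (star S * S).toL.toLinearMap w) := fun S => by
    rw [form_rTensor]
    exact congrArg (tensorFormₛₗ Y X w) (LinearMap.congr_fun
      (LinearMap.rTensor_comp Xm (star S).toL.toLinearMap S.toL.toLinearMap) w).symm
  have h1 : ((‖T‖ ^ 2 : ℝ) : ℂ) • tensorFormₛₗ Y X w w
      - tensorFormₛₗ Y X (LinearMap.rTensor Xm T.toL.toLinearMap w)
        (LinearMap.rTensor Xm T.toL.toLinearMap w) =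
      tensorFormₛₗ Y X (LinearMap.rTensor Xm R.toL.toLinearMap w)
        (LinearMap.rTensor Xm R.toL.toLinearMap w) := by
    rw [hcomp, hcomp, ← hR, ← map_smul, ← map_sub]
    congr 1
    have : ((((‖T‖ ^ 2 : ℝ) : ℂ) • (1 : Adj Y) - star T * T).toL.toLinearMap : Y →ₗ[ℂ] Y) =
      ((‖T‖ ^ 2 : ℝ) : ℂ) • LinearMap.id - (star T * T).toL.toLinearMap := rfl
    rw [this, LinearMap.rTensor_sub, LinearMap.rTensor_smul, LinearMap.rTensor_id]
    rfl
  have h2 := tensorFormₛₗ_self_nonneg Y X (LinearMap.rTensor Xm R.toL.toLinearMap w)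
  rw [← h1, sub_nonneg] at h2
  refine (CStarAlgebra.norm_le_norm_of_nonneg_of_le (tensorFormₛₗ_self_nonneg Y X _) h2).trans ?_
  rw [norm_smul, Complex.norm_real, Real.norm_of_nonneg (by positivity)]

/-- The bounded operator `T ⊗ 1` on `Y ⊗_φ X`. -/
def ampL (T : Adj Y) : HilbMod.tensor Y X →L[ℂ] HilbMod.tensor Y X :=
  (tensorForm Y X).extend (tensorι Y X ∘ₗ LinearMap.rTensor Xm T.toL.toLinearMap) ‖T‖ (norm_nonneg _)
    fun u => by
      rw [HilbMod.norm_sq, LinearMap.comp_apply]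
      exact (congrArg norm (ip_tensorι Y X _ _)).le.trans (norm_rTensor_le Y X T u)

lemma ampL_tensorι (T : Adj Y) (u : Y ⊗[ℂ] Xm) :
    ampL Y X T (tensorι Y X u) = tensorι Y X (LinearMap.rTensor Xm T.toL.toLinearMap u) :=
  RightForm.extend_toCompletion _ _ _ _ _ u

lemma ip_ampL (T : Adj Y) (u v : HilbMod.tensor Y X) :
    (HilbMod.tensor Y X).ip (ampL Y X T u) v = (HilbMod.tensor Y X).ip u (ampL Y X (star T) v) := by
  have hc := (HilbMod.tensor Y X).continuous_ip
  refine (denseRange_tensorι Y X).induction_on₂ (p := fun u v =>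
    (HilbMod.tensor Y X).ip (ampL Y X T u) v = (HilbMod.tensor Y X).ip u (ampL Y X (star T) v))
    (isClosed_eq ?_ ?_) (fun a b => ?_) u v
  · exact hc.comp (((ampL Y X T).continuous.comp continuous_fst).prodMk continuous_snd)
  · exact hc.comp (continuous_fst.prodMk ((ampL Y X (star T)).continuous.comp continuous_snd))
  · rw [ampL_tensorι, ampL_tensorι, ip_tensorι, ip_tensorι, form_rTensor]

variable {Y X} in
lemma Adj.ext_tmul {Z : HilbMod A} {S T : HilbMod.tensor Y X →L[ℂ] Z}
    (h : ∀ y x, S (HilbMod.tmul y x) = T (HilbMod.tmul y x)) : S = T := by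
  refine ContinuousLinearMap.ext fun u => ?_
  refine (denseRange_tensorι Y X).induction_on (p := fun u => S u = T u) u
    (isClosed_eq S.continuous T.continuous) fun a => ?_
  induction a with
  | zero => simp
  | add v w hv hw => simp only [map_add, hv, hw]
  | tmul y x => exact h y x

lemma ampL_tmul (T : Adj Y) (y : Y) (x : Xm) :
    ampL Y X T (HilbMod.tmul y x) = HilbMod.tmul (T y) x :=
  ampL_tensorι Y X T _

/-- The adjointable operator `T ⊗ 1` on `Y ⊗_φ X`. -/
def ampA (T : Adj Y) : Adj (HilbMod.tensor Y X) :=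
  Adj.mk (ampL Y X T) (ampL Y X (star T)) (ip_ampL Y X T)

lemma star_ampA (T : Adj Y) : star (ampA Y X T) = ampA Y X (star T) :=
  Adj.eq_star (T := ampA Y X T) (S := ampA Y X (star T)) fun u v => ip_ampL Y X T u v

/-- The `*`-homomorphism `T ↦ T ⊗ 1_X` from `ℒ(Y)` to `ℒ(Y ⊗_φ X)`, with
`(T ⊗ 1)(ξ ⊗ η) = T ξ ⊗ η`. -/
def tensorOne : Adj Y →⋆ₐ[ℂ] Adj (HilbMod.tensor Y X) where
  toFun := ampA Y X
  map_one' := Adj.toL_injective <| Adj.ext_tmul fun y x => ampL_tmul Y X 1 y x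
  map_mul' S T := Adj.toL_injective <| Adj.ext_tmul fun y x => by
    change ampL Y X (S * T) _ = ampL Y X S (ampL Y X T _)
    rw [ampL_tmul, ampL_tmul, ampL_tmul]; rfl
  map_zero' := Adj.toL_injective <| Adj.ext_tmul fun y x => by
    change ampL Y X 0 _ = 0
    rw [ampL_tmul]
    change tensorι Y X ((0 : Y) ⊗ₜ x) = 0
    rw [TensorProduct.zero_tmul, map_zero]
  map_add' S T := Adj.toL_injective <| Adj.ext_tmul fun y x => by
    change ampL Y X (S + T) _ = ampL Y X S _ + ampL Y X T _
    rw [ampL_tmul, ampL_tmul, ampL_tmul]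
    change tensorι Y X ((S y + T y) ⊗ₜ x) = tensorι Y X (S y ⊗ₜ x) + tensorι Y X (T y ⊗ₜ x)
    rw [TensorProduct.add_tmul, map_add]
  commutes' c := Adj.toL_injective <| Adj.ext_tmul fun y x => by
    change ampL Y X (algebraMap ℂ (Adj Y) c) _ = c • HilbMod.tmul y x
    rw [ampL_tmul]
    change tensorι Y X ((c • y) ⊗ₜ x) = c • tensorι Y X (y ⊗ₜ x)
    rw [← map_smul]; rfl
  map_star' T := (star_ampA Y X T).symm

lemma tensorOne_tmul (T : Adj Y) (y : Y) (x : Xm) :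
    tensorOne Y X T (HilbMod.tmul y x) = HilbMod.tmul (T y) x :=
  ampL_tmul Y X T y x

end Tensor

namespace HilbBimod

variable (X : HilbBimod A)

/-- The tensor powers `X^{⊗0} = A`, `X^{⊗1} = X`, `X^{⊗(n+1)} = X^{⊗n} ⊗_A X`. -/
def pow : ℕ → HilbMod A
  | 0 => HilbMod.self A
  | 1 => X.toHilbMod
  | n + 2 => HilbMod.tensor (pow (n + 1)) X

/-- The left action `φ_n : A → ℒ(X^{⊗n})`: `φ_0(a) = L_a`, `φ_1 = φ`, `φ_{n+1}(a) = φ_n(a) ⊗ 1`. -/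
def leftAct : ∀ n, A →⋆ₙₐ[ℂ] Adj (X.pow n)
  | 0 => HilbMod.leftMul
  | 1 => X.φ
  | n + 2 => (tensorOne (X.pow (n + 1)) X).toNonUnitalStarAlgHom.comp (leftAct (n + 1))

/-- For `1 ≤ p + 1 ≤ q + 1`, the map `S ↦ S ⊗ 1_{q-p}` from `ℒ(X^{⊗(p+1)})` to
`ℒ(X^{⊗(q+1)})`. -/
def amp {p q : ℕ} (h : p ≤ q) : Adj (X.pow (p + 1)) →⋆ₐ[ℂ] Adj (X.pow (q + 1)) :=
  Nat.leRecOn (C := fun k => Adj (X.pow (p + 1)) →⋆ₐ[ℂ] Adj (X.pow (k + 1))) h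
    (fun {k} f => (tensorOne (X.pow (k + 1)) X).comp f) (StarAlgHom.id ℂ _)

lemma amp_self (p : ℕ) : X.amp (le_refl p) = StarAlgHom.id ℂ _ :=
  Nat.leRecOn_self (C := fun k => Adj (X.pow (p + 1)) →⋆ₐ[ℂ] Adj (X.pow (k + 1))) _

lemma amp_succ {p q : ℕ} (h : p ≤ q) :
    X.amp (Nat.le_succ_of_le h) = (tensorOne (X.pow (q + 1)) X).comp (X.amp h) :=
  Nat.leRecOn_succ (C := fun k => Adj (X.pow (p + 1)) →⋆ₐ[ℂ] Adj (X.pow (k + 1))) h _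

/-- The `*`-homomorphism `ι_p^q : 𝒦(X^{⊗p}) → ℒ(X^{⊗q})` for `p ≤ q`, which is `S ↦ S ⊗ 1_{q-p}`
if `p ≥ 1` and `L_a ↦ φ_q(a)` if `p = 0`. -/
def iota : ∀ {p q : ℕ}, p ≤ q → Cpt (X.pow p) →⋆ₙₐ[ℂ] Adj (X.pow q)
  | 0, q, _ => (X.leftAct q).comp HilbMod.compactsToAlg
  | _ + 1, _ + 1, h => (X.amp (Nat.le_of_succ_le_succ h)).toNonUnitalStarAlgHom.comp Cpt.incl
  | _ + 1, 0, h => absurd h (Nat.not_succ_le_zero _)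

lemma iota_self (p : ℕ) (S : Cpt (X.pow p)) : X.iota (le_refl p) S = S.op := by
  cases p with
  | zero => exact HilbMod.leftMul_compactsToAlg S
  | succ p =>
    change X.amp (le_refl p) S.op = S.op
    rw [amp_self]; rfl

lemma iota_succ {p q : ℕ} (h : p ≤ q + 1) (S : Cpt (X.pow p)) :
    X.iota (Nat.le_succ_of_le h) S = tensorOne (X.pow (q + 1)) X (X.iota h S) := by
  cases p with
  | zero => rfl
  | succ p =>
    change X.amp (Nat.le_succ_of_le (Nat.le_of_succ_le_succ h)) S.op = _
    rw [amp_succ]; rfl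

lemma amp_iota {p r q : ℕ} (h : p ≤ r + 1) (h' : r ≤ q) (S : Cpt (X.pow p)) :
    X.amp h' (X.iota h S) = X.iota (h.trans (Nat.succ_le_succ h')) S := by
  induction q, h' using Nat.le_induction with
  | base => rw [amp_self]; rfl
  | succ q hq ih =>
    rw [amp_succ X hq]
    change tensorOne (X.pow (q + 1)) X (X.amp hq (X.iota h S)) = _
    rw [ih, ← iota_succ]

lemma iota_map_mul {p q : ℕ} (h : p ≤ q) (S T : Cpt (X.pow p)) :
    X.iota h (S * T) = X.iota h S * X.iota h T := map_mul (X.iota h) S T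

lemma iota_mul {p r q : ℕ} (h : p ≤ r) (h' : r ≤ q) (S : Cpt (X.pow p))
    (T : Cpt (X.pow r)) :
    X.iota h' (Cpt.mk (X.iota h S * T.op) (Adj.mul_mem_compacts _ T.op_mem)) =
      X.iota (h.trans h') S * X.iota h' T := by
  obtain rfl | hpr := h.eq_or_lt
  · have e : Cpt.mk (X.iota h S * T.op) (Adj.mul_mem_compacts _ T.op_mem) = S * T :=
      Cpt.op_injective (congrArg (· * T.op) (X.iota_self p S))
    rw [e]
    exact X.iota_map_mul h' S T
  cases r with
  | zero => exact absurd hpr (Nat.not_lt_zero _)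
  | succ r =>
    cases q with
    | zero => exact absurd h' (Nat.not_succ_le_zero _)
    | succ q =>
      change X.amp _ (X.iota h S * T.op) = _ * X.amp _ T.op
      rw [map_mul, amp_iota]

/-- The ideal `I_k = ⋂_{0 < m ≤ k} ker φ_m` of `A`, with `I_0 = A`. -/
def idealI (k : ℕ) : Set A := {a | ∀ m, 0 < m → m ≤ k → X.leftAct m a = 0}

lemma idealI_anti {k l : ℕ} (h : k ≤ l) : X.idealI l ⊆ X.idealI k :=
  fun _ ha m hm hmk => ha m hm (hmk.trans h)

end HilbBimod

lemma map_ip_eq_zero {Y Z : HilbMod A} (ψ : A →⋆ₙₐ[ℂ] Adj Z) {x : Y} (hx : ψ (Y.ip x x) = 0)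
    (y : Y) : ψ (Y.ip y x) = 0 := by
  have h := Y.toForm.cauchy_schwarz_order y x (k := ‖Y.ip y y‖ + 1) (by positivity)
    (le_add_of_nonneg_right zero_le_one)
  rw [← sub_nonneg] at h
  obtain ⟨d, hd⟩ := CStarAlgebra.nonneg_iff_eq_star_mul_self.1 h
  change (‖Y.ip y y‖ + 1) • Y.ip x x - Y.ip x y * Y.ip y x = star d * d at hd
  have hd' : ((‖Y.ip y y‖ + 1 : ℝ) : ℂ) • Y.ip x x - star (Y.ip y x) * Y.ip y x = star d * d := by
    rw [Y.star_ip]; exact hd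
  have h2 := congrArg ψ hd'
  rw [map_sub, map_smul, hx, smul_zero, zero_sub, map_mul, map_mul, map_star, map_star] at h2
  refine Adj.ext fun z => ?_
  have h3 : -(Z.ip (ψ (Y.ip y x) z) (ψ (Y.ip y x) z)) = Z.ip (ψ d z) (ψ d z) := by
    have h4 := congrArg (fun T : Adj Z => Z.ip z (T z)) h2
    simp only [Adj.neg_apply, Adj.mul_apply] at h4
    rw [Adj.ip_left, Adj.ip_left, ← h4]
    exact (map_neg (Z.ipL z) _).symm
  have h5 : Z.ip (ψ (Y.ip y x) z) (ψ (Y.ip y x) z) = 0 :=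
    le_antisymm (neg_nonneg.1 (h3 ▸ Z.ip_self_nonneg _)) (Z.ip_self_nonneg _)
  exact Z.ip_self_eq_zero.1 h5

namespace HilbBimod

variable (X : HilbBimod A) (Y : HilbMod A) (k : ℕ)

lemma ip_self_mem_idealI_iff (x : Y) :
    Y.ip x x ∈ X.idealI k ↔ ∀ y, ∀ m, 0 < m → m ≤ k → X.leftAct m (Y.ip y x) = 0 :=
  ⟨fun h y m hm hk => map_ip_eq_zero _ (h m hm hk) y, fun h => h x⟩

/-- The closed submodule `Y I_k = {ξ ∈ Y | ⟨ξ, ξ⟩ ∈ I_k}` of a Hilbert module `Y`. -/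
def submI : Submodule ℂ Y where
  carrier := {x | Y.ip x x ∈ X.idealI k}
  add_mem' {x x'} hx hx' := (X.ip_self_mem_idealI_iff Y k _).2 fun y m hm hk => by
    rw [Y.ip_add_right, map_add, (X.ip_self_mem_idealI_iff Y k _).1 hx y m hm hk,
      (X.ip_self_mem_idealI_iff Y k _).1 hx' y m hm hk, add_zero]
  zero_mem' := (X.ip_self_mem_idealI_iff Y k _).2 fun y m hm hk => by
    rw [Y.ip_zero_right, map_zero]
  smul_mem' c x hx := (X.ip_self_mem_idealI_iff Y k _).2 fun y m hm hk => by
    rw [Y.ip_smul_right, map_smul, (X.ip_self_mem_idealI_iff Y k _).1 hx y m hm hk, smul_zero]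

lemma mem_submI_iff {x : Y} :
    x ∈ X.submI Y k ↔ ∀ y, ∀ m, 0 < m → m ≤ k → X.leftAct m (Y.ip y x) = 0 :=
  X.ip_self_mem_idealI_iff Y k x

lemma mem_submI_zero (x : Y) : x ∈ X.submI Y 0 :=
  fun _ hm hk => absurd hm (Nat.not_lt.2 hk)

lemma submI_anti {k l : ℕ} (h : k ≤ l) : X.submI Y l ≤ X.submI Y k :=
  fun _ hx => X.idealI_anti h hx

lemma act_mem_submI {x : Y} (hx : x ∈ X.submI Y k) (a : A) : Y.act x a ∈ X.submI Y k :=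
  (X.mem_submI_iff Y k).2 fun y m hm hk => by
    rw [Y.ip_act_right, map_mul, (X.mem_submI_iff Y k).1 hx y m hm hk, zero_mul]

lemma apply_mem_submI {x : Y} (hx : x ∈ X.submI Y k) (T : Adj Y) : T x ∈ X.submI Y k :=
  (X.mem_submI_iff Y k).2 fun y m hm hk => by
    rw [Adj.ip_right, (X.mem_submI_iff Y k).1 hx _ m hm hk]

lemma isClosed_submI : IsClosed (X.submI Y k : Set Y) := by
  have : (X.submI Y k : Set Y) =
      ⋂ (y : Y) (m : ℕ) (_ : 0 < m) (_ : m ≤ k), {x | X.leftAct m (Y.ip y x) = 0} := by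
    ext x
    simp only [Set.mem_iInter, Set.mem_ofPred_eq]
    exact X.mem_submI_iff Y k
  rw [this]
  refine isClosed_iInter fun y => isClosed_iInter fun m => isClosed_iInter fun _ =>
    isClosed_iInter fun _ => isClosed_eq ?_ continuous_const
  have hc : Continuous (X.leftAct m) :=
    AddMonoidHomClass.continuous_of_bound (X.leftAct m) 1 fun a => by
      rw [one_mul]; exact NonUnitalStarAlgHom.norm_apply_le (X.leftAct m) a
  exact hc.comp (Y.ipL y).continuous

instance : CompleteSpace (X.submI Y k) := (X.isClosed_submI Y k).completeSpace_coe

/-- `Y I_k` as a Hilbert module. -/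
def subI : HilbMod A where
  carrier := X.submI Y k
  toForm :=
    { act := fun a => (Y.toForm.act a).restrict fun _ hx => X.act_mem_submI Y k hx a
      form := fun x y => Y.ip x.1 y.1
      form_add_right := fun _ _ _ => Y.ip_add_right _ _ _
      form_smul_right := fun _ _ _ => Y.ip_smul_right _ _ _
      form_act_right := fun _ _ _ => Y.ip_act_right _ _ _
      star_form := fun _ _ => Y.star_ip _ _
      form_self_nonneg := fun _ => Y.ip_self_nonneg _ }
  norm_sq' x := Y.norm_sq x.1

/-- A vector of `Y I_k`, as a vector of `Y`. -/
def subIval (x : X.subI Y k) : Y := x.1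

/-- A vector `x ∈ Y I_k`, as an element of the Hilbert module `Y I_k`. -/
def subImk (x : Y) (hx : x ∈ X.submI Y k) : X.subI Y k := ⟨x, hx⟩

/-- The restriction `T|_{Y I_k}` as a bounded operator. -/
def restrictL (T : Adj Y) : X.subI Y k →L[ℂ] X.subI Y k :=
  ContinuousLinearMap.restrict T.toL fun _ hx => X.apply_mem_submI Y k hx T

/-- The restriction `T|_{Y I_k}` as an adjointable operator. -/
def restrictA (T : Adj Y) : Adj (X.subI Y k) :=
  Adj.mk (X.restrictL Y k T) (X.restrictL Y k (star T))
    fun x y => Adj.ip_left T (X.subIval Y k x) (X.subIval Y k y)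

/-- The restriction `T ↦ T|_{Y I_k}`, as a `*`-homomorphism `ℒ(Y) → ℒ(Y I_k)`. -/
def restrictI : Adj Y →⋆ₐ[ℂ] Adj (X.subI Y k) where
  toFun T := X.restrictA Y k T
  map_one' := rfl
  map_mul' _ _ := rfl
  map_zero' := rfl
  map_add' _ _ := rfl
  commutes' _ := rfl
  map_star' T := (Adj.eq_star (T := X.restrictA Y k T) (S := X.restrictA Y k (star T)) fun x y =>
    Adj.ip_left T (X.subIval Y k x) (X.subIval Y k y)).symm

lemma restrictI_apply (T : Adj Y) (x : X.subI Y k) :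
    X.subIval Y k (X.restrictI Y k T x) = T (X.subIval Y k x) := rfl

lemma norm_subIval (x : X.subI Y k) : ‖X.subIval Y k x‖ = ‖x‖ := rfl

end HilbBimod

namespace HilbBimod

variable (X : HilbBimod A)

/-- The `C*`-algebra `⨁_{0 ≤ q ≤ n} ℒ(X^{⊗q} I_{n-q})`. -/
def D (n : ℕ) : Type u := ∀ q : Fin (n + 1), Adj (X.subI (X.pow q) (n - q))

instance (n : ℕ) : CStarAlgebra (X.D n) :=
  inferInstanceAs (CStarAlgebra (∀ q : Fin (n + 1), Adj (X.subI (X.pow q) (n - q))))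

/-- The component in `ℒ(X^{⊗q} I_k)` of `ι̃_p^{q+k}`: it is `S ↦ ι_p^q(S)|_{X^{⊗q} I_k}` if `p ≤ q`,
and `0` if `q < p`. -/
def itildeComp (p q k : ℕ) : Cpt (X.pow p) →⋆ₙₐ[ℂ] Adj (X.subI (X.pow q) k) :=
  if h : p ≤ q then (X.restrictI (X.pow q) k).toNonUnitalStarAlgHom.comp (X.iota h) else 0

/-- The `*`-homomorphism `ι̃_p^n : 𝒦(X^{⊗p}) → ⨁_{0 ≤ q ≤ n} ℒ(X^{⊗q} I_{n-q})`. -/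
def itilde (n p : ℕ) : Cpt (X.pow p) →⋆ₙₐ[ℂ] X.D n where
  toFun S q := X.itildeComp p q (n - q) S
  map_smul' c S := funext fun q => map_smul (X.itildeComp p q (n - q)) c S
  map_zero' := funext fun q => map_zero (X.itildeComp p q (n - q))
  map_add' S T := funext fun q => map_add (X.itildeComp p q (n - q)) S T
  map_mul' S T := funext fun q => map_mul (X.itildeComp p q (n - q)) S T
  map_star' S := funext fun q => map_star (X.itildeComp p q (n - q)) S

/-- The sum `∑_{p ≤ n} ι̃_p^m(S_p)`. -/
def sumC (n m : ℕ) (S : ∀ p, Cpt (X.pow p)) : X.D m := ∑ p ∈ Finset.range (n + 1), X.itilde m p (S p)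

lemma itilde_mul {p r : ℕ} (h : p ≤ r) (m : ℕ) (S : Cpt (X.pow p)) (T : Cpt (X.pow r)) :
    X.itilde m p S * X.itilde m r T =
      X.itilde m r (Cpt.mk (X.iota h S * T.op) (Adj.mul_mem_compacts _ T.op_mem)) := by
  funext q
  change X.itildeComp p q (m - q) S * X.itildeComp r q (m - q) T = X.itildeComp r q (m - q) _
  unfold itildeComp
  by_cases hq : r ≤ q
  · rw [dif_pos hq, dif_pos (h.trans hq)]
    change X.restrictI _ _ (X.iota _ S) * X.restrictI _ _ (X.iota hq T) =
      X.restrictI _ _ (X.iota hq _)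
    rw [iota_mul, map_mul]
  · rw [dif_neg hq]
    exact mul_zero _

/-- The families `m ↦ ∑_{p ≤ n} ι̃_p^m(S_p)`. -/
def tails (n : ℕ) : Submodule ℂ (∀ m, X.D m) where
  carrier := {x | ∃ S, ∀ m, x m = X.sumC n m S}
  zero_mem' := ⟨fun _ => 0, fun m => by simp [sumC]⟩
  add_mem' := by
    rintro x y ⟨S, hS⟩ ⟨T, hT⟩
    exact ⟨fun p => S p + T p, fun m => by
      simp only [Pi.add_apply, hS, hT, sumC, map_add, Finset.sum_add_distrib]⟩
  smul_mem' := by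
    rintro c x ⟨S, hS⟩
    exact ⟨fun p => c • S p, fun m => by
      simp only [Pi.smul_apply, hS, sumC, map_smul, Finset.smul_sum]⟩

lemma itilde_mem_tails {n p : ℕ} (h : p ≤ n) (S : Cpt (X.pow p)) :
    (fun m => X.itilde m p S) ∈ X.tails n := by
  classical
  refine ⟨Pi.single p S, fun m => ?_⟩
  rw [sumC, Finset.sum_eq_single_of_mem p (Finset.mem_range_succ_iff.2 h), Pi.single_eq_same]
  intro r _ hr
  rw [Pi.single_eq_of_ne hr, map_zero]

lemma itilde_mul_mem_tails {n p r : ℕ} (hp : p ≤ n) (hr : r ≤ n) (S : Cpt (X.pow p))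
    (T : Cpt (X.pow r)) : (fun m => X.itilde m p S * X.itilde m r T) ∈ X.tails n := by
  rcases le_total p r with h | h
  · simp_rw [X.itilde_mul h]
    exact X.itilde_mem_tails hr _
  · have : ∀ m, X.itilde m p S * X.itilde m r T =
        X.itilde m p (star (Cpt.mk (X.iota h (star T) * (star S).op)
          (Adj.mul_mem_compacts _ (star S).op_mem))) := fun m => by
      rw [map_star, ← X.itilde_mul h, star_mul, ← map_star, ← map_star, star_star, star_star]
    simp_rw [this]
    exact X.itilde_mem_tails hp _

lemma exists_sumC_mul (n : ℕ) (S T : ∀ p, Cpt (X.pow p)) :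
    ∃ R, ∀ m, X.sumC n m S * X.sumC n m T = X.sumC n m R := by
  have : (fun m => X.sumC n m S * X.sumC n m T) ∈ X.tails n := by
    have e : (fun m => X.sumC n m S * X.sumC n m T) =
        ∑ p ∈ Finset.range (n + 1), ∑ r ∈ Finset.range (n + 1),
          fun m => X.itilde m p (S p) * X.itilde m r (T r) := by
      funext m
      simp only [sumC, Finset.sum_apply, Finset.sum_mul_sum]
    rw [e]
    exact Submodule.sum_mem _ fun p hp => Submodule.sum_mem _ fun r hr =>
      X.itilde_mul_mem_tails (Finset.mem_range_succ_iff.1 hp) (Finset.mem_range_succ_iff.1 hr) _ _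
  exact this

lemma sumC_zero (n m : ℕ) : X.sumC n m (fun _ => 0) = 0 := by simp [sumC]

lemma sumC_add (n m : ℕ) (S T : ∀ p, Cpt (X.pow p)) :
    X.sumC n m (fun p => S p + T p) = X.sumC n m S + X.sumC n m T := by
  simp only [sumC, map_add, Finset.sum_add_distrib]

lemma sumC_sub (n m : ℕ) (S T : ∀ p, Cpt (X.pow p)) :
    X.sumC n m (fun p => S p - T p) = X.sumC n m S - X.sumC n m T := by
  simp only [sumC, map_sub, Finset.sum_sub_distrib]

lemma sumC_smul (n m : ℕ) (c : ℂ) (S : ∀ p, Cpt (X.pow p)) :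
    X.sumC n m (fun p => c • S p) = c • X.sumC n m S := by
  simp only [sumC, map_smul, Finset.smul_sum]

lemma sumC_star (n m : ℕ) (S : ∀ p, Cpt (X.pow p)) :
    X.sumC n m (fun p => star (S p)) = star (X.sumC n m S) := by
  simp only [sumC, map_star, star_sum]

lemma exists_sumC_eq {n m : ℕ} (h : n ≤ m) (S : ∀ p, Cpt (X.pow p)) :
    ∃ T, ∀ k, X.sumC n k S = X.sumC m k T := by
  have hmem : (fun k => X.sumC n k S) ∈ X.tails m := by
    have e : (fun k => X.sumC n k S) =
        ∑ p ∈ Finset.range (n + 1), fun k => X.itilde k p (S p) := by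
      funext k
      simp only [sumC, Finset.sum_apply]
    rw [e]
    exact Submodule.sum_mem _ fun p hp =>
      X.itilde_mem_tails ((Finset.mem_range_succ_iff.1 hp).trans h) _
  exact hmem

/-- The operator `∑_{p ≤ min(n, q)} ι_p^q(S_p)` on `X^{⊗q}`. -/
def tot (n q : ℕ) (S : ∀ p, Cpt (X.pow p)) : Adj (X.pow q) :=
  ∑ p ∈ Finset.range (n + 1), if h : p ≤ q then X.iota h (S p) else 0

lemma sumC_apply (n m : ℕ) (S : ∀ p, Cpt (X.pow p)) (q : Fin (m + 1)) :
    X.sumC n m S q = X.restrictI (X.pow q) (m - q) (X.tot n q S) := by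
  have h1 : X.sumC n m S q = ∑ p ∈ Finset.range (n + 1), X.itildeComp p q (m - q) (S p) :=
    Finset.sum_apply q (Finset.range (n + 1)) fun p => X.itilde m p (S p)
  rw [h1, tot, map_sum]
  refine Finset.sum_congr rfl fun p _ => ?_
  unfold itildeComp
  split_ifs with h
  · rfl
  · rw [map_zero]; rfl

lemma tot_succ {n q : ℕ} (h : n ≤ q + 1) (S : ∀ p, Cpt (X.pow p)) :
    X.tot n (q + 2) S = tensorOne (X.pow (q + 1)) X (X.tot n (q + 1) S) := by
  rw [tot, tot, map_sum]
  refine Finset.sum_congr rfl fun p hp => ?_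
  have hp' : p ≤ q + 1 := (Finset.mem_range_succ_iff.1 hp).trans h
  rw [dif_pos hp', dif_pos (Nat.le_succ_of_le hp')]
  exact X.iota_succ hp' (S p)

lemma norm_tot_le_succ {n q : ℕ} (h : n ≤ q) (S : ∀ p, Cpt (X.pow p)) :
    ‖X.tot n (q + 1) S‖ ≤ ‖X.tot n q S‖ := by
  cases q with
  | zero =>
    obtain rfl : n = 0 := Nat.le_zero.1 h
    simp only [tot, zero_add, Finset.range_one, Finset.sum_singleton, zero_le, dif_pos]
    have h0 : X.iota (le_refl 0) (S 0) = (S 0).op := X.iota_self 0 (S 0)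
    have h1 := NonUnitalStarAlgHom.norm_apply_le (X.iota (Nat.zero_le 1)) (S 0)
    rw [← Cpt.norm_op, ← h0] at h1
    exact h1
  | succ q =>
    rw [X.tot_succ h]
    exact NonUnitalStarAlgHom.norm_apply_le (tensorOne (X.pow (q + 1)) X) _

lemma norm_tot_le {n q : ℕ} (h : n ≤ q) (S : ∀ p, Cpt (X.pow p)) :
    ‖X.tot n q S‖ ≤ ‖X.tot n n S‖ := by
  induction q, h using Nat.le_induction with
  | base => exact le_rfl
  | succ q hq ih => exact (X.norm_tot_le_succ hq S).trans ih

lemma norm_restrictI_anti (Y : HilbMod A) {k l : ℕ} (h : k ≤ l) (T : Adj Y) :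
    ‖X.restrictI Y l T‖ ≤ ‖X.restrictI Y k T‖ := by
  refine Adj.norm_le _ (norm_nonneg _) fun x => ?_
  exact Adj.norm_apply_le (X.restrictI Y k T)
    (X.subImk Y k (X.subIval Y l x) (X.submI_anti Y h x.2))

lemma norm_le_norm_restrictI_zero (Y : HilbMod A) (T : Adj Y) : ‖T‖ ≤ ‖X.restrictI Y 0 T‖ := by
  refine Adj.norm_le _ (norm_nonneg _) fun x => ?_
  exact Adj.norm_apply_le (X.restrictI Y 0 T) (X.subImk Y 0 x (X.mem_submI_zero Y x))

lemma norm_restrictI_le (Y : HilbMod A) (k : ℕ) (T : Adj Y) : ‖X.restrictI Y k T‖ ≤ ‖T‖ :=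
  NonUnitalStarAlgHom.norm_apply_le (X.restrictI Y k) T

lemma norm_apply_le_D {n : ℕ} (x : X.D n) (q : Fin (n + 1)) : ‖x q‖ ≤ ‖x‖ :=
  norm_le_pi_norm (G := fun q : Fin (n + 1) => Adj (X.subI (X.pow q) (n - q))) x q

lemma norm_sumC_le {n m : ℕ} (h : n ≤ m) (S : ∀ p, Cpt (X.pow p)) :
    ‖X.sumC n m S‖ ≤ ‖X.sumC n n S‖ := by
  refine (pi_norm_le_iff_of_nonneg
    (G := fun q : Fin (m + 1) => Adj (X.subI (X.pow q) (m - q))) (norm_nonneg _)).2 fun q => ?_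
  change ‖X.sumC n m S q‖ ≤ _
  rw [sumC_apply]
  rcases le_total (q : ℕ) n with hq | hq
  · refine le_trans ?_ (X.norm_apply_le_D _ ⟨q, Nat.lt_succ_of_le hq⟩)
    rw [sumC_apply]
    exact X.norm_restrictI_anti _ (Nat.sub_le_sub_right h _) _
  · refine le_trans ?_ (X.norm_apply_le_D _ (Fin.last n))
    rw [sumC_apply]
    refine (X.norm_restrictI_le _ _ _).trans ((X.norm_tot_le hq S).trans ?_)
    refine (X.norm_le_norm_restrictI_zero _ _).trans_eq ?_
    have : ∀ k, k = 0 → ‖X.restrictI (X.pow n) 0 (X.tot n n S)‖ =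
        ‖X.restrictI (X.pow n) k (X.tot n n S)‖ := by rintro k rfl; rfl
    exact this (n - n) (Nat.sub_self n)

lemma sumC_congr {n m : ℕ} (h : n ≤ m) {S T : ∀ p, Cpt (X.pow p)}
    (e : X.sumC n n S = X.sumC n n T) : X.sumC n m S = X.sumC n m T := by
  rw [← sub_eq_zero, ← sumC_sub, ← norm_le_zero_iff]
  refine (X.norm_sumC_le h _).trans_eq ?_
  rw [sumC_sub, e, sub_self, norm_zero]

/-- The algebra `C_n` of the sums `∑_{p ≤ n} ι̃_p^n(S_p)`, inside `⨁_{0 ≤ q ≤ n} ℒ(X^{⊗q} I_{n-q})`. -/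
def cSub (n : ℕ) : NonUnitalStarSubalgebra ℂ (X.D n) where
  carrier := {x | ∃ S : ∀ p, Cpt (X.pow p), x = ∑ p ∈ Finset.range (n + 1), X.itilde n p (S p)}
  zero_mem' := ⟨_, (X.sumC_zero n n).symm⟩
  add_mem' := by
    rintro _ _ ⟨S, rfl⟩ ⟨T, rfl⟩
    exact ⟨_, (X.sumC_add n n S T).symm⟩
  mul_mem' := by
    rintro _ _ ⟨S, rfl⟩ ⟨T, rfl⟩
    obtain ⟨R, hR⟩ := X.exists_sumC_mul n S T
    exact ⟨R, hR n⟩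
  smul_mem' := by
    rintro c _ ⟨S, rfl⟩
    exact ⟨_, (X.sumC_smul n n c S).symm⟩
  star_mem' := by
    rintro _ ⟨S, rfl⟩
    exact ⟨_, (X.sumC_star n n S).symm⟩

/-- The algebra `C_n`, as a type. -/
def C (n : ℕ) : Type u := X.cSub n

instance (n : ℕ) : NonUnitalNormedRing (X.C n) := inferInstanceAs (NonUnitalNormedRing (X.cSub n))
instance (n : ℕ) : StarRing (X.C n) := inferInstanceAs (StarRing (X.cSub n))
instance (n : ℕ) : CStarRing (X.C n) :=
  ⟨fun x => CStarRing.norm_mul_self_le (x : X.cSub n).1⟩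
instance (n : ℕ) : NormedSpace ℂ (X.C n) := inferInstanceAs (NormedSpace ℂ (X.cSub n))
instance (n : ℕ) : IsScalarTower ℂ (X.C n) (X.C n) :=
  inferInstanceAs (IsScalarTower ℂ (X.cSub n) (X.cSub n))
instance (n : ℕ) : SMulCommClass ℂ (X.C n) (X.C n) :=
  inferInstanceAs (SMulCommClass ℂ (X.cSub n) (X.cSub n))
instance (n : ℕ) : StarModule ℂ (X.C n) := inferInstanceAs (StarModule ℂ (X.cSub n))

variable {X}

namespace C

/-- The inclusion of `C_n` in `⨁_{0 ≤ q ≤ n} ℒ(X^{⊗q} I_{n-q})`. -/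
def val {n : ℕ} (x : X.C n) : X.D n := Subtype.val (p := (· ∈ X.cSub n)) x

lemma val_injective {n : ℕ} : Function.Injective (val : X.C n → X.D n) := Subtype.val_injective

/-- The element `∑_{p ≤ n} ι̃_p^n(S_p)` of `C_n`. -/
def mk (n : ℕ) (S : ∀ p, Cpt (X.pow p)) : X.C n :=
  show X.cSub n from ⟨∑ p ∈ Finset.range (n + 1), X.itilde n p (S p), S, rfl⟩

lemma val_mk (n : ℕ) (S : ∀ p, Cpt (X.pow p)) :
    (mk n S).val = ∑ p ∈ Finset.range (n + 1), X.itilde n p (S p) := rfl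

lemma val_mk' (n : ℕ) (S : ∀ p, Cpt (X.pow p)) : (mk n S).val = X.sumC n n S := rfl

lemma exists_eq_mk {n : ℕ} (x : X.C n) : ∃ S, x = mk n S := by
  obtain ⟨S, hS⟩ := Subtype.property (p := (· ∈ X.cSub n)) x
  exact ⟨S, val_injective hS⟩

lemma norm_mk (n : ℕ) (S : ∀ p, Cpt (X.pow p)) : ‖mk n S‖ = ‖X.sumC n n S‖ := rfl

lemma mk_zero (n : ℕ) : mk (X := X) n (fun _ => 0) = 0 := val_injective (X.sumC_zero n n)
lemma mk_add (n : ℕ) (S T : ∀ p, Cpt (X.pow p)) : mk n (fun p => S p + T p) = mk n S + mk n T :=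
  val_injective (X.sumC_add n n S T)
lemma mk_smul (n : ℕ) (c : ℂ) (S : ∀ p, Cpt (X.pow p)) : mk n (fun p => c • S p) = c • mk n S :=
  val_injective (X.sumC_smul n n c S)
lemma mk_star (n : ℕ) (S : ∀ p, Cpt (X.pow p)) : mk n (fun p => star (S p)) = star (mk n S) :=
  val_injective (X.sumC_star n n S)

/-- An element of `C_m` of the form `∑_{p ≤ n} ι̃_p^m(S_p)`, where `n ≤ m`. -/
def mkLE {n m : ℕ} (h : n ≤ m) (S : ∀ p, Cpt (X.pow p)) : X.C m :=
  show X.cSub m from ⟨∑ p ∈ Finset.range (n + 1), X.itilde m p (S p),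
    (X.exists_sumC_eq h S).choose, (X.exists_sumC_eq h S).choose_spec m⟩

lemma val_mkLE {n m : ℕ} (h : n ≤ m) (S : ∀ p, Cpt (X.pow p)) :
    (mkLE h S).val = X.sumC n m S := rfl

lemma mkLE_congr {n m : ℕ} (h : n ≤ m) {S T : ∀ p, Cpt (X.pow p)} (e : mk n S = mk n T) :
    mkLE h S = mkLE h T := val_injective (X.sumC_congr h (congrArg val e))

/-- The map underlying `j_{m,n}`. -/
def mapFun {n m : ℕ} (h : n ≤ m) (x : X.C n) : X.C m := mkLE h (exists_eq_mk x).choose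

lemma mapFun_mk {n m : ℕ} (h : n ≤ m) (S : ∀ p, Cpt (X.pow p)) :
    mapFun h (mk n S) = mkLE h S :=
  mkLE_congr h (exists_eq_mk (mk n S)).choose_spec.symm

/-- The connecting map `j_{m,n} : C_n → C_m`,
`∑_{p ≤ n} ι̃_p^n(S_p) ↦ ∑_{p ≤ n} ι̃_p^m(S_p)`. -/
def map {n m : ℕ} (h : n ≤ m) : X.C n →⋆ₙₐ[ℂ] X.C m where
  toFun := mapFun h
  map_zero' := by
    rw [← mk_zero, mapFun_mk]
    exact val_injective (X.sumC_zero n m)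
  map_add' x y := by
    obtain ⟨S, rfl⟩ := exists_eq_mk x
    obtain ⟨T, rfl⟩ := exists_eq_mk y
    rw [← mk_add, mapFun_mk, mapFun_mk, mapFun_mk]
    exact val_injective (X.sumC_add n m S T)
  map_mul' x y := by
    obtain ⟨S, rfl⟩ := exists_eq_mk x
    obtain ⟨T, rfl⟩ := exists_eq_mk y
    obtain ⟨R, hR⟩ := X.exists_sumC_mul n S T
    have e : mk n S * mk n T = mk n R := val_injective (hR n)
    rw [e, mapFun_mk, mapFun_mk, mapFun_mk]
    exact val_injective (hR m).symm
  map_smul' c x := by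
    obtain ⟨S, rfl⟩ := exists_eq_mk x
    rw [← mk_smul, mapFun_mk, mapFun_mk]
    exact val_injective (X.sumC_smul n m c S)
  map_star' x := by
    obtain ⟨S, rfl⟩ := exists_eq_mk x
    rw [← mk_star, mapFun_mk, mapFun_mk]
    exact val_injective (X.sumC_star n m S)

lemma val_map_mk {n m : ℕ} (h : n ≤ m) (S : ∀ p, Cpt (X.pow p)) :
    (map h (mk n S)).val = ∑ p ∈ Finset.range (n + 1), X.itilde m p (S p) :=
  congrArg val (mapFun_mk h S)

lemma norm_map_le {n m : ℕ} (h : n ≤ m) (x : X.C n) : ‖map h x‖ ≤ ‖x‖ := by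
  obtain ⟨S, rfl⟩ := exists_eq_mk x
  change ‖(map h (mk n S)).val‖ ≤ _
  rw [val_map_mk]
  exact X.norm_sumC_le h S

lemma map_refl (n : ℕ) (x : X.C n) : map (le_refl n) x = x := by
  obtain ⟨S, rfl⟩ := exists_eq_mk x
  exact val_injective (val_map_mk _ S)

lemma map_map {n m k : ℕ} (h : n ≤ m) (h' : m ≤ k) (x : X.C n) :
    map h' (map h x) = map (h.trans h') x := by
  obtain ⟨S, rfl⟩ := exists_eq_mk x
  obtain ⟨T, hT⟩ := X.exists_sumC_eq h S
  have e : map h (mk n S) = mk m T := val_injective ((val_map_mk h S).trans (hT m))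
  rw [e]
  exact val_injective ((val_map_mk h' T).trans ((hT k).symm.trans (val_map_mk _ S).symm))

end C

end HilbBimod

namespace HilbBimod

variable (X : HilbBimod A)

instance : DirectedSystem X.C (fun n m (h : n ≤ m) => (C.map h : X.C n → X.C m)) where
  map_self n x := C.map_refl n x
  map_map _ _ _ h h' x := C.map_map h h' x

/-- The algebraic inductive limit of the algebras `C_n` along the maps `j_{m,n}`. -/
def AlgLim : Type u := DirectLimit X.C (fun n m (h : n ≤ m) => (C.map h : X.C n →⋆ₙₐ[ℂ] X.C m))

namespace AlgLim

instance : NonUnitalRing X.AlgLim := inferInstanceAs (NonUnitalRing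
  (DirectLimit X.C (fun n m (h : n ≤ m) => (C.map h : X.C n →⋆ₙₐ[ℂ] X.C m))))
instance : Module ℂ X.AlgLim := inferInstanceAs (Module ℂ
  (DirectLimit X.C (fun n m (h : n ≤ m) => (C.map h : X.C n →⋆ₙₐ[ℂ] X.C m))))
instance : IsScalarTower ℂ X.AlgLim X.AlgLim := inferInstanceAs (IsScalarTower ℂ
  (DirectLimit X.C (fun n m (h : n ≤ m) => (C.map h : X.C n →⋆ₙₐ[ℂ] X.C m)))
  (DirectLimit X.C (fun n m (h : n ≤ m) => (C.map h : X.C n →⋆ₙₐ[ℂ] X.C m))))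
instance : SMulCommClass ℂ X.AlgLim X.AlgLim := inferInstanceAs (SMulCommClass ℂ
  (DirectLimit X.C (fun n m (h : n ≤ m) => (C.map h : X.C n →⋆ₙₐ[ℂ] X.C m)))
  (DirectLimit X.C (fun n m (h : n ≤ m) => (C.map h : X.C n →⋆ₙₐ[ℂ] X.C m))))
instance : InvolutiveStar X.AlgLim := inferInstanceAs (InvolutiveStar
  (DirectLimit X.C (fun n m (h : n ≤ m) => (C.map h : X.C n →⋆ₙₐ[ℂ] X.C m))))

variable {X}

/-- The canonical map of `C_n` into the algebraic inductive limit. -/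
def of (n : ℕ) (x : X.C n) : X.AlgLim :=
  Quotient.mk (DirectLimit.setoid fun n m (h : n ≤ m) => (C.map h : X.C n →⋆ₙₐ[ℂ] X.C m)) ⟨n, x⟩

lemma exists_of (z : X.AlgLim) : ∃ n x, z = of n x := DirectLimit.exists_eq_mk _ z

lemma of_map {n m : ℕ} (h : n ≤ m) (x : X.C n) : of m (C.map h x) = of n x :=
  DirectLimit.mk_apply (f := fun n m (h : n ≤ m) => (C.map h : X.C n →⋆ₙₐ[ℂ] X.C m)) n m x h

lemma of_eq_of {n m : ℕ} {x : X.C n} {y : X.C m} (h : of n x = of m y) :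
    ∃ (k : ℕ) (hn : n ≤ k) (hm : m ≤ k), C.map hn x = C.map hm y := Quotient.exact h

lemma of_zero (n : ℕ) : of n (0 : X.C n) = 0 := (DirectLimit.zero_def n).symm
lemma of_add (n : ℕ) (x y : X.C n) : of n (x + y) = of n x + of n y :=
  (DirectLimit.add_def n x y).symm
lemma of_mul (n : ℕ) (x y : X.C n) : of n (x * y) = of n x * of n y :=
  (DirectLimit.mul_def n x y).symm
lemma of_neg (n : ℕ) (x : X.C n) : of n (-x) = -of n x := (DirectLimit.neg_def n x).symm
lemma of_smul (n : ℕ) (c : ℂ) (x : X.C n) : of n (c • x) = c • of n x := rfl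
lemma of_star (n : ℕ) (x : X.C n) : of n (star x) = star (of n x) := rfl

instance : StarRing X.AlgLim where
  star_mul z w := by
    obtain ⟨n, x, y, rfl, rfl⟩ := DirectLimit.exists_eq_mk₂ _ z w
    change star (of n x * of n y) = star (of n y) * star (of n x)
    rw [← of_mul, ← of_star, ← of_star, ← of_star, ← of_mul, star_mul]
  star_add z w := by
    obtain ⟨n, x, y, rfl, rfl⟩ := DirectLimit.exists_eq_mk₂ _ z w
    change star (of n x + of n y) = star (of n x) + star (of n y)
    rw [← of_add, ← of_star, ← of_star, ← of_star, ← of_add, star_add]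

instance : StarModule ℂ X.AlgLim where
  star_smul c z := by
    obtain ⟨n, x, rfl⟩ := exists_of z
    rw [← of_smul, ← of_star, ← of_star, ← of_smul, star_smul]

/-- The seminorm on the algebraic inductive limit: the infimum of the norms of the
representatives, which for the class of `x ∈ C_n` is `lim_m ‖j_{m,n}(x)‖`. -/
instance : Norm X.AlgLim := ⟨fun z => sInf {r : ℝ | ∃ n, ∃ x : X.C n, z = of n x ∧ r = ‖x‖}⟩

lemma bddBelow_reps (z : X.AlgLim) :
    BddBelow {r : ℝ | ∃ n, ∃ x : X.C n, z = of n x ∧ r = ‖x‖} :=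
  ⟨0, by rintro _ ⟨n, x, -, rfl⟩; exact norm_nonneg x⟩

lemma nonneg_norm (z : X.AlgLim) : 0 ≤ ‖z‖ :=
  Real.sInf_nonneg (by rintro _ ⟨n, x, -, rfl⟩; exact norm_nonneg x)

lemma norm_of_le (n : ℕ) (x : X.C n) : ‖of n x‖ ≤ ‖x‖ :=
  csInf_le (bddBelow_reps _) ⟨n, x, rfl, rfl⟩

lemma exists_norm_lt (z : X.AlgLim) {r : ℝ} (h : ‖z‖ < r) :
    ∃ n, ∀ m, n ≤ m → ∃ x : X.C m, z = of m x ∧ ‖x‖ < r := by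
  obtain ⟨n₀, x₀, h₀⟩ := exists_of z
  obtain ⟨_, ⟨n, x, rfl, rfl⟩, hx⟩ := exists_lt_of_csInf_lt
    (s := {r : ℝ | ∃ n, ∃ x : X.C n, z = of n x ∧ r = ‖x‖}) ⟨_, n₀, x₀, h₀, rfl⟩ h
  exact ⟨n, fun m hm => ⟨C.map hm x, (of_map hm x).symm, (C.norm_map_le hm x).trans_lt hx⟩⟩

lemma exists_norm_lt₂ (z w : X.AlgLim) {r s : ℝ} (hr : ‖z‖ < r) (hs : ‖w‖ < s) :
    ∃ n, ∃ x y : X.C n, z = of n x ∧ w = of n y ∧ ‖x‖ < r ∧ ‖y‖ < s := by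
  obtain ⟨n, hn⟩ := exists_norm_lt z hr
  obtain ⟨m, hm⟩ := exists_norm_lt w hs
  obtain ⟨x, hx, hx'⟩ := hn (max n m) (le_max_left _ _)
  obtain ⟨y, hy, hy'⟩ := hm (max n m) (le_max_right _ _)
  exact ⟨_, x, y, hx, hy, hx', hy'⟩

lemma norm_add_le_lim (z w : X.AlgLim) : ‖z + w‖ ≤ ‖z‖ + ‖w‖ := by
  refine le_of_forall_pos_le_add fun ε hε => ?_
  obtain ⟨n, x, y, hx, hy, hx', hy'⟩ := exists_norm_lt₂ z w (r := ‖z‖ + ε / 2) (s := ‖w‖ + ε / 2)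
    (by linarith) (by linarith)
  have h1 : ‖z + w‖ ≤ ‖x + y‖ := by rw [hx, hy, ← of_add]; exact norm_of_le _ _
  linarith [norm_add_le x y]

lemma norm_mul_le_lim (z w : X.AlgLim) : ‖z * w‖ ≤ ‖z‖ * ‖w‖ := by
  have key : ∀ ε > 0, ‖z * w‖ ≤ (‖z‖ + ε) * (‖w‖ + ε) := fun ε hε => by
    obtain ⟨n, x, y, hx, hy, hx', hy'⟩ := exists_norm_lt₂ z w (r := ‖z‖ + ε) (s := ‖w‖ + ε)
      (by linarith) (by linarith)
    have h1 : ‖z * w‖ ≤ ‖x * y‖ := by rw [hx, hy, ← of_mul]; exact norm_of_le _ _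
    refine h1.trans ((norm_mul_le x y).trans ?_)
    exact mul_le_mul hx'.le hy'.le (norm_nonneg _) ((norm_nonneg x).trans hx'.le)
  have ht : Filter.Tendsto (fun ε : ℝ => (‖z‖ + ε) * (‖w‖ + ε)) (nhdsWithin 0 (Set.Ioi 0))
      (nhds (‖z‖ * ‖w‖)) := by
    have h := Continuous.tendsto (f := fun ε : ℝ => (‖z‖ + ε) * (‖w‖ + ε)) (by fun_prop) 0
    simp only [add_zero] at h
    exact h.mono_left nhdsWithin_le_nhds
  exact ge_of_tendsto ht (Filter.eventually_of_mem self_mem_nhdsWithin key)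

lemma norm_smul_le_lim (c : ℂ) (z : X.AlgLim) : ‖c • z‖ ≤ ‖c‖ * ‖z‖ := by
  have key : ∀ ε > 0, ‖c • z‖ ≤ ‖c‖ * (‖z‖ + ε) := fun ε hε => by
    obtain ⟨n, x, _, hx, _, hx', _⟩ := exists_norm_lt₂ z z (r := ‖z‖ + ε) (s := ‖z‖ + ε)
      (by linarith) (by linarith)
    have h1 : ‖c • z‖ ≤ ‖c • x‖ := by rw [hx, ← of_smul]; exact norm_of_le _ _
    rw [norm_smul c x] at h1
    exact h1.trans (mul_le_mul_of_nonneg_left hx'.le (norm_nonneg _))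
  have ht : Filter.Tendsto (fun ε : ℝ => ‖c‖ * (‖z‖ + ε)) (nhdsWithin 0 (Set.Ioi 0))
      (nhds (‖c‖ * ‖z‖)) := by
    have h := Continuous.tendsto (f := fun ε : ℝ => ‖c‖ * (‖z‖ + ε)) (by fun_prop) 0
    simp only [add_zero] at h
    exact h.mono_left nhdsWithin_le_nhds
  exact ge_of_tendsto ht (Filter.eventually_of_mem self_mem_nhdsWithin key)

lemma norm_neg_lim (z : X.AlgLim) : ‖-z‖ = ‖z‖ := by
  have h : ∀ z : X.AlgLim, ‖-z‖ ≤ ‖z‖ := fun z => by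
    have := norm_smul_le_lim (-1) z
    rwa [norm_neg, norm_one, one_mul, neg_one_smul] at this
  exact le_antisymm (h z) (by simpa using! h (-z))

lemma norm_zero_lim : ‖(0 : X.AlgLim)‖ = 0 := by
  refine le_antisymm ?_ (nonneg_norm _)
  have h := norm_of_le 0 (0 : X.C 0)
  rwa [of_zero, norm_zero] at h

lemma norm_star_lim (z : X.AlgLim) : ‖star z‖ = ‖z‖ := by
  have h : ∀ z : X.AlgLim, ‖star z‖ ≤ ‖z‖ := fun z => by
    refine le_of_forall_pos_le_add fun ε hε => ?_
    obtain ⟨n, x, _, hx, _, hx', _⟩ := exists_norm_lt₂ z z (r := ‖z‖ + ε) (s := ‖z‖ + ε)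
      (by linarith) (by linarith)
    have h1 : ‖star z‖ ≤ ‖star x‖ := by rw [hx, ← of_star]; exact norm_of_le _ _
    rw [norm_star] at h1
    exact h1.trans hx'.le
  refine le_antisymm (h z) ?_
  have := h (star z)
  rwa [star_star] at this

lemma norm_mul_self_le_lim (z : X.AlgLim) : ‖z‖ * ‖z‖ ≤ ‖star z * z‖ := by
  refine le_of_forall_pos_le_add fun ε hε => ?_
  obtain ⟨n, x, rfl⟩ := exists_of z
  obtain ⟨m, hm⟩ := exists_norm_lt (star (of n x) * of n x)
    (r := ‖star (of n x) * of n x‖ + ε) (by linarith)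
  obtain ⟨y, hy, hy'⟩ := hm m le_rfl
  have h1 : of n (star x * x) = of m y := by rw [of_mul, of_star]; exact hy
  obtain ⟨k, hn, hm, e⟩ := of_eq_of h1
  have h2 : ‖of n x‖ ≤ ‖C.map hn x‖ := by rw [← of_map hn]; exact norm_of_le _ _
  have h3 : ‖C.map hn x‖ * ‖C.map hn x‖ ≤ ‖star (C.map hn x) * C.map hn x‖ :=
    CStarRing.norm_mul_self_le _
  rw [← map_star, ← map_mul, e] at h3
  have h4 := C.norm_map_le hm y
  have h5 : ‖of n x‖ * ‖of n x‖ ≤ ‖C.map hn x‖ * ‖C.map hn x‖ :=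
    mul_self_le_mul_self (nonneg_norm _) h2
  linarith

instance : SeminormedAddCommGroup X.AlgLim where
  dist z w := ‖-z + w‖
  dist_self z := by rw [neg_add_cancel]; exact norm_zero_lim
  dist_comm z w := by rw [← norm_neg_lim]; congr 1; abel
  dist_triangle z w v := by
    have h := norm_add_le_lim (-z + w) (-w + v)
    have e : -z + w + (-w + v) = -z + v := by abel
    rwa [e] at h
  dist_eq _ _ := rfl

instance : NonUnitalSeminormedRing X.AlgLim :=
  { (inferInstance : NonUnitalRing X.AlgLim), (inferInstance : SeminormedAddCommGroup X.AlgLim) with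
    norm_mul_le := norm_mul_le_lim }

instance : NormedSpace ℂ X.AlgLim where
  norm_smul_le := norm_smul_le_lim

end AlgLim

open UniformSpace

/-- The inductive limit of the `C*`-algebras `C_n` along the maps `j_{m,n}`: the completion of the
algebraic inductive limit. -/
def Lim : Type u := Completion X.AlgLim

namespace Lim

instance : NormedAddCommGroup X.Lim := inferInstanceAs (NormedAddCommGroup (Completion X.AlgLim))
instance : NormedSpace ℂ X.Lim := inferInstanceAs (NormedSpace ℂ (Completion X.AlgLim))
instance : CompleteSpace X.Lim := inferInstanceAs (CompleteSpace (Completion X.AlgLim))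

variable {X}

/-- The canonical map of the algebraic inductive limit into its completion. -/
def coe : X.AlgLim →L[ℂ] X.Lim := Completion.toComplL

lemma isDenseInducing_coe : IsDenseInducing (coe : X.AlgLim → X.Lim) :=
  Completion.isDenseInducing_coe

lemma denseRange_coe : DenseRange (coe : X.AlgLim → X.Lim) := isDenseInducing_coe.dense

lemma norm_coe (z : X.AlgLim) : ‖coe z‖ = ‖z‖ := Completion.norm_coe z

/-- The continuous extension of the multiplication to the completion. -/
instance : Mul X.Lim := ⟨fun z w => (isDenseInducing_coe.prodMap isDenseInducing_coe).extend
  (fun p : X.AlgLim × X.AlgLim => coe (p.1 * p.2)) (z, w)⟩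

lemma coe_mul (z w : X.AlgLim) : coe (z * w) = coe z * coe w :=
  ((isDenseInducing_coe.prodMap isDenseInducing_coe).extend_eq
    (f := fun p : X.AlgLim × X.AlgLim => coe (p.1 * p.2))
      (coe.continuous.comp continuous_mul) (z, w)).symm

instance : ContinuousMul X.Lim where
  continuous_mul := by
    let m := (AddMonoidHom.mul : X.AlgLim →+ X.AlgLim →+ X.AlgLim).compr₂
      (coe : X.AlgLim →L[ℂ] X.Lim).toLinearMap.toAddMonoidHom
    have h : Continuous fun p : X.AlgLim × X.AlgLim => m p.1 p.2 :=
      coe.continuous.comp continuous_mul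
    have di : IsDenseInducing
      ((coe : X.AlgLim →L[ℂ] X.Lim).toLinearMap.toAddMonoidHom : X.AlgLim → X.Lim) :=
        isDenseInducing_coe
    exact (di.extend_Z_bilin di h :)

/-- The continuous extension of the involution to the completion. -/
instance : Star X.Lim := ⟨isDenseInducing_coe.extend fun z : X.AlgLim => coe (star z)⟩

lemma isometry_star_algLim : Isometry (star : X.AlgLim → X.AlgLim) :=
  AddMonoidHomClass.isometry_of_norm (starAddEquiv : X.AlgLim ≃+ X.AlgLim) AlgLim.norm_star_lim

lemma coe_star (z : X.AlgLim) : coe (star z) = star (coe z) :=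
  (isDenseInducing_coe.extend_eq (f := fun z : X.AlgLim => coe (star z))
    (coe.continuous.comp isometry_star_algLim.continuous) z).symm

lemma continuous_star_lim : Continuous (star : X.Lim → X.Lim) := by
  have h : UniformContinuous fun z : X.AlgLim => coe (star z) :=
    coe.uniformContinuous.comp isometry_star_algLim.uniformContinuous
  exact (uniformContinuous_uniformly_extend (Completion.isUniformInducing_coe X.AlgLim)
    (denseRange_coe (X := X)) h).continuous

instance : ContinuousStar X.Lim := ⟨continuous_star_lim⟩

@[elab_as_elim]
lemma induction_on {p : X.Lim → Prop} (z : X.Lim) (hp : IsClosed {z | p z})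
    (ih : ∀ z : X.AlgLim, p (coe z)) : p z := denseRange_coe.induction_on z hp ih

@[elab_as_elim]
lemma induction_on₂ {p : X.Lim → X.Lim → Prop} (z w : X.Lim)
    (hp : IsClosed {q : X.Lim × X.Lim | p q.1 q.2}) (ih : ∀ z w : X.AlgLim, p (coe z) (coe w)) :
    p z w := denseRange_coe.induction_on₂ hp ih z w

@[elab_as_elim]
lemma induction_on₃ {p : X.Lim → X.Lim → X.Lim → Prop} (z w v : X.Lim)
    (hp : IsClosed {q : X.Lim × X.Lim × X.Lim | p q.1 q.2.1 q.2.2})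
    (ih : ∀ z w v : X.AlgLim, p (coe z) (coe w) (coe v)) : p z w v :=
  denseRange_coe.induction_on₃ hp ih z w v

lemma zero_mul_lim (z : X.Lim) : 0 * z = 0 := by
  refine induction_on z (isClosed_eq (by fun_prop) continuous_const) fun a => ?_
  rw [← map_zero coe, ← coe_mul, zero_mul]

lemma mul_zero_lim (z : X.Lim) : z * 0 = 0 := by
  refine induction_on z (isClosed_eq (by fun_prop) continuous_const) fun a => ?_
  rw [← map_zero coe, ← coe_mul, mul_zero]

lemma mul_assoc_lim (x y z : X.Lim) : x * y * z = x * (y * z) := by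
  refine induction_on₃ x y z (isClosed_eq (by fun_prop) (by fun_prop)) fun a b c => ?_
  rw [← coe_mul, ← coe_mul, ← coe_mul, ← coe_mul, mul_assoc]

lemma mul_add_lim (x y z : X.Lim) : x * (y + z) = x * y + x * z := by
  refine induction_on₃ x y z (isClosed_eq (by fun_prop) (by fun_prop)) fun a b c => ?_
  rw [← map_add, ← coe_mul, ← coe_mul, ← coe_mul, ← map_add, mul_add]

lemma add_mul_lim (x y z : X.Lim) : (x + y) * z = x * z + y * z := by
  refine induction_on₃ x y z (isClosed_eq (by fun_prop) (by fun_prop)) fun a b c => ?_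
  rw [← map_add, ← coe_mul, ← coe_mul, ← coe_mul, ← map_add, add_mul]

instance : NonUnitalRing X.Lim :=
  { (inferInstance : AddCommGroup X.Lim), (inferInstance : Mul X.Lim) with
    zero_mul := zero_mul_lim
    mul_zero := mul_zero_lim
    mul_assoc := mul_assoc_lim
    left_distrib := mul_add_lim
    right_distrib := add_mul_lim }

instance : NonUnitalNormedRing X.Lim :=
  { (inferInstance : NonUnitalRing X.Lim), (inferInstance : NormedAddCommGroup X.Lim) with
    norm_mul_le z w := induction_on₂ z w (isClosed_le (by fun_prop) (by fun_prop)) fun a b => by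
      rw [← coe_mul, norm_coe, norm_coe, norm_coe]
      exact norm_mul_le a b }

instance : StarRing X.Lim where
  star_involutive z := induction_on z (isClosed_eq (by fun_prop) (by fun_prop)) fun a => by
    rw [← coe_star, ← coe_star, star_star]
  star_mul z w := induction_on₂ z w (isClosed_eq (by fun_prop) (by fun_prop)) fun a b => by
    rw [← coe_mul, ← coe_star, ← coe_star, ← coe_star, ← coe_mul, star_mul]
  star_add z w := induction_on₂ z w (isClosed_eq (by fun_prop) (by fun_prop)) fun a b => by
    rw [← map_add, ← coe_star, ← coe_star, ← coe_star, ← map_add, star_add]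

instance : CStarRing X.Lim where
  norm_mul_self_le z := induction_on z (isClosed_le (by fun_prop) (by fun_prop)) fun a => by
    rw [← coe_star, ← coe_mul, norm_coe, norm_coe]
    exact AlgLim.norm_mul_self_le_lim a

lemma continuous_smul_lim (c : ℂ) : Continuous fun z : X.Lim => c • z := continuous_const_smul c

lemma smul_mul_lim (c : ℂ) (z w : X.Lim) : (c • z) * w = c • (z * w) := by
  refine induction_on₂ z w (isClosed_eq
    (((continuous_smul_lim c).comp continuous_fst).mul continuous_snd)
    ((continuous_smul_lim c).comp (continuous_fst.mul continuous_snd))) fun a b => ?_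
  rw [← map_smul, ← coe_mul, ← coe_mul, ← map_smul, smul_mul_assoc]

lemma mul_smul_lim (c : ℂ) (z w : X.Lim) : z * (c • w) = c • (z * w) := by
  refine induction_on₂ z w (isClosed_eq
    (continuous_fst.mul ((continuous_smul_lim c).comp continuous_snd))
    ((continuous_smul_lim c).comp (continuous_fst.mul continuous_snd))) fun a b => ?_
  rw [← map_smul, ← coe_mul, ← coe_mul, ← map_smul, mul_smul_comm]

lemma star_smul_lim (c : ℂ) (z : X.Lim) : star (c • z) = star c • star z := by
  refine induction_on z (isClosed_eq (continuous_star_lim.comp (continuous_smul_lim c))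
    ((continuous_smul_lim (star c)).comp continuous_star_lim)) fun a => ?_
  rw [← map_smul, ← coe_star, ← coe_star, ← map_smul, star_smul]

instance : IsScalarTower ℂ X.Lim X.Lim := ⟨smul_mul_lim⟩
instance : SMulCommClass ℂ X.Lim X.Lim := ⟨fun c z w => (mul_smul_lim c z w).symm⟩
instance : StarModule ℂ X.Lim := ⟨star_smul_lim⟩

instance : NonUnitalCStarAlgebra X.Lim where

/-- The canonical `*`-homomorphism of `C_n` into the inductive limit. -/
def of (n : ℕ) : X.C n →⋆ₙₐ[ℂ] X.Lim where
  toFun x := coe (AlgLim.of n x)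
  map_smul' c x := by rw [AlgLim.of_smul, map_smul]; rfl
  map_zero' := by rw [AlgLim.of_zero, map_zero]
  map_add' x y := by rw [AlgLim.of_add, map_add]
  map_mul' x y := by rw [AlgLim.of_mul, coe_mul]
  map_star' x := by rw [AlgLim.of_star, coe_star]

lemma of_map {n m : ℕ} (h : n ≤ m) (x : X.C n) : of m (C.map h x) = of n x :=
  congrArg coe (AlgLim.of_map h x)

end Lim

end HilbBimod

variable {B : Type v} [NonUnitalCStarAlgebra B]

section Covariance

variable {Y : HilbMod A} (π : A →⋆ₙₐ[ℂ] B) (s : Y →L[ℂ] B)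

/-- The linear span of the pairs `(θ_{ξ,η}, s(ξ) s(η)*)`: the graph of the map
`θ_{ξ,η} ↦ s(ξ) s(η)*` on finite-rank operators. -/
def covGraph : Submodule ℂ (Adj Y × B) :=
  Submodule.span ℂ (Set.range fun p : Y × Y => (Adj.theta p.1 p.2, s p.1 * star (s p.2)))

lemma theta_mem_covGraph (x y : Y) : (Adj.theta x y, s x * star (s y)) ∈ covGraph s :=
  Submodule.subset_span ⟨(x, y), rfl⟩

lemma star_mem_covGraph {z : Adj Y × B} (hz : z ∈ covGraph s) : star z ∈ covGraph s := by
  induction hz using Submodule.span_induction with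
  | mem z hz =>
    obtain ⟨p, rfl⟩ := hz
    have : star (Adj.theta p.1 p.2, s p.1 * star (s p.2)) =
        (Adj.theta p.2 p.1, s p.2 * star (s p.1)) :=
      Prod.ext (Adj.star_theta _ _) (by simp)
    rw [this]
    exact theta_mem_covGraph s _ _
  | zero => rw [star_zero]; exact Submodule.zero_mem _
  | add z w _ _ h h' => rw [star_add]; exact Submodule.add_mem _ h h'
  | smul c z _ h => rw [star_smul]; exact Submodule.smul_mem _ _ h

lemma map_act_of (hs : ∀ x y, star (s x) * s y = π (Y.ip x y))
    (x : Y) (a : A) : s (Y.act x a) = s x * π a := by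
  rw [← sub_eq_zero, ← CStarRing.star_mul_self_eq_zero_iff, star_sub, star_mul]
  simp only [sub_mul, mul_sub]
  have e1 : star (s (Y.act x a)) * (s x * π a) = π (star a * Y.ip x x * a) := by
    rw [← mul_assoc, hs, Y.ip_act_left, ← map_mul]
  have e2 : star (π a) * star (s x) * s (Y.act x a) = π (star a * Y.ip x x * a) := by
    rw [mul_assoc, hs, Y.ip_act_right, ← map_star, ← map_mul, mul_assoc]
  have e3 : star (π a) * star (s x) * (s x * π a) = π (star a * Y.ip x x * a) := by
    rw [mul_assoc, ← mul_assoc (star (s x)), hs, ← map_star, ← map_mul, ← map_mul, mul_assoc]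
  have e4 : star (s (Y.act x a)) * s (Y.act x a) = π (star a * Y.ip x x * a) := by
    rw [hs, Y.ip_act_left, Y.ip_act_right, mul_assoc]
  rw [e1, e2, e3, e4, sub_self]

lemma covGraph_mul_apply (hs : ∀ x y, star (s x) * s y = π (Y.ip x y))
    {z : Adj Y × B} (hz : z ∈ covGraph s) (x : Y) :
    z.2 * s x = s (z.1 x) := by
  induction hz using Submodule.span_induction with
  | mem z hz =>
    obtain ⟨p, rfl⟩ := hz
    change s p.1 * star (s p.2) * s x = s (Y.act p.1 (Y.ip p.2 x))
    rw [map_act_of π s hs, mul_assoc, hs]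
  | zero => simp
  | add z w _ _ h h' =>
    change (z.2 + w.2) * s x = s (z.1 x + w.1 x)
    rw [add_mul, h, h', map_add]
  | smul c z _ h =>
    change (c • z.2) * s x = s (c • z.1 x)
    rw [smul_mul_assoc, h, map_smul]

lemma mul_mem_covGraph_of {z : Adj Y × B} (hz : ∀ x, z.2 * s x = s (z.1 x)) {w : Adj Y × B}
    (hw : w ∈ covGraph s) : z * w ∈ covGraph s := by
  induction hw using Submodule.span_induction with
  | mem w hw =>
    obtain ⟨p, rfl⟩ := hw
    have : z * (Adj.theta p.1 p.2, s p.1 * star (s p.2)) =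
        (Adj.theta (z.1 p.1) p.2, s (z.1 p.1) * star (s p.2)) :=
      Prod.ext (Adj.mul_theta _ _ _) (by
        change z.2 * (s p.1 * star (s p.2)) = _
        rw [← mul_assoc, hz])
    rw [this]
    exact theta_mem_covGraph s _ _
  | zero => rw [mul_zero]; exact Submodule.zero_mem _
  | add w w' _ _ h h' => rw [mul_add]; exact Submodule.add_mem _ h h'
  | smul c w _ h => rw [mul_smul_comm]; exact Submodule.smul_mem _ _ h

/-- A bound for `b c` in terms of `T`, where `b s(ξ) = s(T ξ)` for all `ξ`. -/
lemma exists_bound {w : Adj Y × B} (hw : w ∈ covGraph s) :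
    ∃ M : ℝ, ∀ z : Adj Y × B, (∀ x, z.2 * s x = s (z.1 x)) → ‖z.2 * w.2‖ ≤ M * ‖z.1‖ := by
  induction hw using Submodule.span_induction with
  | mem w hw =>
    obtain ⟨p, rfl⟩ := hw
    refine ⟨‖s‖ * ‖p.1‖ * ‖s p.2‖, fun z hz => ?_⟩
    change ‖z.2 * (s p.1 * star (s p.2))‖ ≤ _
    rw [← mul_assoc, hz]
    calc ‖s (z.1 p.1) * star (s p.2)‖ ≤ ‖s (z.1 p.1)‖ * ‖star (s p.2)‖ := norm_mul_le _ _
      _ ≤ (‖s‖ * (‖z.1‖ * ‖p.1‖)) * ‖s p.2‖ := by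
        rw [norm_star]
        gcongr
        exact (s.le_opNorm _).trans (by gcongr; exact Adj.norm_apply_le _ _)
      _ = _ := by ring
  | zero => exact ⟨0, fun z _ => by simp⟩
  | add w w' _ _ h h' =>
    obtain ⟨M, hM⟩ := h
    obtain ⟨M', hM'⟩ := h'
    refine ⟨M + M', fun z hz => ?_⟩
    change ‖z.2 * (w.2 + w'.2)‖ ≤ _
    rw [mul_add, add_mul]
    exact (norm_add_le _ _).trans (add_le_add (hM z hz) (hM' z hz))
  | smul c w _ h =>
    obtain ⟨M, hM⟩ := h
    refine ⟨‖c‖ * M, fun z hz => ?_⟩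
    change ‖z.2 * (c • w.2)‖ ≤ _
    rw [mul_smul_comm, norm_smul, mul_assoc]
    exact mul_le_mul_of_nonneg_left (hM z hz) (norm_nonneg _)

/-- Iterated squares. -/
def sqIter {R : Type*} [Mul R] (x : R) : ℕ → R
  | 0 => x
  | k + 1 => sqIter x k * sqIter x k

lemma norm_le_of_selfAdjoint {T : Adj Y} {b : B} (hb : star b = b)
    (h : ∀ x, b * s x = s (T x)) {M : ℝ}
    (hM : ∀ z : Adj Y × B, (∀ x, z.2 * s x = s (z.1 x)) → ‖z.2 * b‖ ≤ M * ‖z.1‖) :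
    ‖b‖ ≤ ‖T‖ := by
  have h1 : ∀ k x, sqIter b k * s x = s (sqIter T k x) := fun k => by
    induction k with
    | zero => exact h
    | succ k ih => intro x; change sqIter b k * sqIter b k * s x = s (sqIter T k (sqIter T k x))
                   rw [mul_assoc, ih, ih]
  have h2 : ∀ k, star (sqIter b k) = sqIter b k := fun k => by
    induction k with
    | zero => exact hb
    | succ k ih => change star (sqIter b k * sqIter b k) = _; rw [star_mul, ih]; rfl
  have h3 : ∀ k, ‖sqIter b k‖ = ‖b‖ ^ 2 ^ k := fun k => by
    induction k with
    | zero => simp [sqIter]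
    | succ k ih =>
      change ‖sqIter b k * sqIter b k‖ = _
      conv_lhs => enter [1, 1]; rw [← h2 k]
      rw [CStarRing.norm_star_mul_self, ih, ← pow_add, pow_succ, mul_two]
  have h4 : ∀ k, ‖sqIter T k‖ ≤ ‖T‖ ^ 2 ^ k := fun k => by
    induction k with
    | zero => simp [sqIter]
    | succ k ih =>
      refine (norm_mul_le _ _).trans ?_
      rw [pow_succ, mul_two, pow_add]
      exact mul_le_mul ih ih (norm_nonneg _) (by positivity)
  have h5 : ∀ k, ∀ z : Adj Y × B, (∀ x, z.2 * s x = s (z.1 x)) →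
      ‖z.2 * sqIter b k‖ ≤ |M| * ‖z.1‖ * ‖T‖ ^ (2 ^ k - 1) := fun k => by
    induction k with
    | zero =>
      intro z hz
      rw [pow_zero, Nat.sub_self, pow_zero, mul_one]
      exact (hM z hz).trans (mul_le_mul_of_nonneg_right (le_abs_self M) (norm_nonneg _))
    | succ k ih =>
      intro z hz
      have hk : 1 ≤ 2 ^ k := Nat.one_le_two_pow
      have e : 2 ^ (k + 1) - 1 = 2 ^ k + (2 ^ k - 1) := by rw [pow_succ]; omega
      have h6 := ih (z.1 * sqIter T k, z.2 * sqIter b k) fun x => by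
        change z.2 * sqIter b k * s x = s (z.1 (sqIter T k x))
        rw [mul_assoc, h1, hz]
      change ‖z.2 * (sqIter b k * sqIter b k)‖ ≤ _
      rw [← mul_assoc, e, pow_add]
      refine h6.trans ?_
      calc |M| * ‖z.1 * sqIter T k‖ * ‖T‖ ^ (2 ^ k - 1)
          ≤ |M| * (‖z.1‖ * ‖T‖ ^ 2 ^ k) * ‖T‖ ^ (2 ^ k - 1) := by
            gcongr
            exact (norm_mul_le _ _).trans (by gcongr; exact h4 k)
        _ = _ := by ring
  have h6 : ∀ k, ‖b‖ ^ 2 ^ (k + 1) ≤ |M| * ‖T‖ ^ (2 ^ (k + 1) - 1) := fun k => by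
    have hk : 1 ≤ 2 ^ k := Nat.one_le_two_pow
    have e : 2 ^ (k + 1) - 1 = 2 ^ k + (2 ^ k - 1) := by rw [pow_succ]; omega
    rw [← h3 (k + 1), e, pow_add, ← mul_assoc]
    refine (h5 k (sqIter T k, sqIter b k) (h1 k)).trans ?_
    gcongr
    exact h4 k
  rcases (norm_nonneg T).eq_or_lt with hT | hT
  · have := h6 0
    rw [← hT] at this
    norm_num at this
    rw [this, norm_zero]; exact norm_nonneg _
  · by_contra! hlt
    have hr : 1 < ‖b‖ / ‖T‖ := (one_lt_div hT).2 hlt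
    obtain ⟨N, hN⟩ := pow_unbounded_of_one_lt (|M| / ‖T‖) hr
    have h7 : (‖b‖ / ‖T‖) ^ N ≤ (‖b‖ / ‖T‖) ^ 2 ^ (N + 1) :=
      pow_le_pow_right₀ hr.le ((Nat.le_succ N).trans Nat.lt_two_pow_self.le)
    have h8 : (‖b‖ / ‖T‖) ^ 2 ^ (N + 1) ≤ |M| / ‖T‖ := by
      rw [div_pow, div_le_div_iff₀ (by positivity) hT]
      calc ‖b‖ ^ 2 ^ (N + 1) * ‖T‖ ≤ |M| * ‖T‖ ^ (2 ^ (N + 1) - 1) * ‖T‖ := by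
            gcongr; exact h6 N
        _ = _ := by
          rw [mul_assoc, ← pow_succ, Nat.sub_add_cancel Nat.one_le_two_pow]
    linarith

lemma covGraph_norm_le (hs : ∀ x y, star (s x) * s y = π (Y.ip x y))
    {z : Adj Y × B} (hz : z ∈ covGraph s) : ‖z.2‖ ≤ ‖z.1‖ := by
  have hz' := star_mem_covGraph s hz
  have hm : star z * z ∈ covGraph s :=
    mul_mem_covGraph_of s (covGraph_mul_apply π s hs hz') hz
  obtain ⟨M, hM⟩ := exists_bound s hm
  have h := norm_le_of_selfAdjoint (T := (star z * z).1) (b := (star z * z).2) s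
    (by rw [← Prod.snd_star, star_mul, star_star]) (covGraph_mul_apply π s hs hm) hM
  change ‖star z.2 * z.2‖ ≤ ‖star z.1 * z.1‖ at h
  rw [CStarRing.norm_star_mul_self, CStarRing.norm_star_mul_self] at h
  exact abs_le_of_sq_le_sq' (by rwa [pow_two, pow_two]) (norm_nonneg _) |>.2

/-- The closure of the graph. -/
def covClosure : Submodule ℂ (Adj Y × B) := (covGraph s).topologicalClosure

lemma covClosure_norm_le (hs : ∀ x y, star (s x) * s y = π (Y.ip x y))
    {z : Adj Y × B} (hz : z ∈ covClosure s) : ‖z.2‖ ≤ ‖z.1‖ :=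
  closure_minimal (s := (covGraph s : Set (Adj Y × B))) (t := {z | ‖z.2‖ ≤ ‖z.1‖})
    (fun _ h => covGraph_norm_le π s hs h)
    (isClosed_le (by fun_prop) (by fun_prop)) hz

lemma star_mem_covClosure {z : Adj Y × B} (hz : z ∈ covClosure s) : star z ∈ covClosure s :=
  map_mem_closure (f := fun z : Adj Y × B => star z) (by fun_prop) hz
    fun _ h => star_mem_covGraph s h

lemma mul_mem_covClosure (hs : ∀ x y, star (s x) * s y = π (Y.ip x y))
    {z w : Adj Y × B} (hz : z ∈ covClosure s) (hw : w ∈ covClosure s) :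
    z * w ∈ covClosure s :=
  map_mem_closure₂ (f := fun z w : Adj Y × B => z * w) (by fun_prop) hz hw
    fun _ h _ h' => mul_mem_covGraph_of s (covGraph_mul_apply π s hs h) h'

lemma exists_mem_covClosure (hs : ∀ x y, star (s x) * s y = π (Y.ip x y))
    {T : Adj Y} (hT : T ∈ Adj.compacts Y) :
    ∃ b, (T, b) ∈ covClosure s := by
  have hcomplete : IsComplete (covClosure s : Set (Adj Y × B)) :=
    (Submodule.isClosed_topologicalClosure _).isComplete
  have hiso : Isometry fun z : covClosure s => z.1.1 := by
    refine AddMonoidHomClass.isometry_of_norm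
      ((LinearMap.fst ℂ (Adj Y) B).comp (covClosure s).subtype) fun z => ?_
    change ‖z.1.1‖ = max ‖z.1.1‖ ‖z.1.2‖
    exact (max_eq_left (covClosure_norm_le π s hs z.2)).symm
  have : CompleteSpace (covClosure s) := hcomplete.completeSpace_coe
  have hcl : IsClosed (Set.range fun z : covClosure s => z.1.1) :=
    hiso.isClosedEmbedding.isClosed_range
  have h : T ∈ Set.range fun z : covClosure s => z.1.1 := by
    refine closure_minimal ?_ hcl hT
    intro T hT
    induction hT using Submodule.span_induction with
    | mem T hT =>
      obtain ⟨p, rfl⟩ := hT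
      exact ⟨⟨_, Submodule.le_topologicalClosure _ (theta_mem_covGraph s p.1 p.2)⟩, rfl⟩
    | zero => exact ⟨0, rfl⟩
    | add _ _ _ _ h h' =>
      obtain ⟨a, rfl⟩ := h
      obtain ⟨b, rfl⟩ := h'
      exact ⟨a + b, rfl⟩
    | smul c _ _ h =>
      obtain ⟨a, rfl⟩ := h
      exact ⟨c • a, rfl⟩
  obtain ⟨z, rfl⟩ := h
  exact ⟨z.1.2, z.2⟩

lemma eq_of_mem_covClosure (hs : ∀ x y, star (s x) * s y = π (Y.ip x y))
    {T : Adj Y} {b b' : B} (h : (T, b) ∈ covClosure s)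
    (h' : (T, b') ∈ covClosure s) : b = b' := by
  have := covClosure_norm_le π s hs (Submodule.sub_mem _ h h')
  change ‖b - b'‖ ≤ ‖T - T‖ at this
  rw [sub_self, norm_zero, norm_le_zero_iff, sub_eq_zero] at this
  exact this

/-- The value at a compact operator `S` of the extension of `θ_{ξ,η} ↦ s(ξ) s(η)*`: the unique `b`
such that `(S, b)` lies in the closure of the graph. -/
def covFun (hs : ∀ x y, star (s x) * s y = π (Y.ip x y)) (S : Cpt Y) : B :=
  (exists_mem_covClosure π s hs S.op_mem).choose

lemma mem_covClosure_covFun (hs : ∀ x y, star (s x) * s y = π (Y.ip x y))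
    (S : Cpt Y) : (S.op, covFun π s hs S) ∈ covClosure s :=
  (exists_mem_covClosure π s hs S.op_mem).choose_spec

lemma covFun_eq (hs : ∀ x y, star (s x) * s y = π (Y.ip x y)) {S : Cpt Y} {b : B}
    (h : (S.op, b) ∈ covClosure s) : covFun π s hs S = b :=
  eq_of_mem_covClosure π s hs (mem_covClosure_covFun π s hs S) h

/-- The `*`-homomorphism `𝒦(Y) → B` with `θ_{ξ,η} ↦ s(ξ) s(η)*`, for a linear map `s : Y → B` with
`s(ξ)* s(η) = π(⟨ξ, η⟩)`. -/
def covHom (hs : ∀ x y, star (s x) * s y = π (Y.ip x y)) : Cpt Y →⋆ₙₐ[ℂ] B where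
  toFun := covFun π s hs
  map_zero' := covFun_eq π s hs (Submodule.zero_mem _)
  map_add' S T := covFun_eq π s hs (Submodule.add_mem _
    (mem_covClosure_covFun π s hs S) (mem_covClosure_covFun π s hs T))
  map_mul' S T := covFun_eq π s hs (mul_mem_covClosure π s hs
    (mem_covClosure_covFun π s hs S) (mem_covClosure_covFun π s hs T))
  map_smul' c S := covFun_eq π s hs (Submodule.smul_mem _ c (mem_covClosure_covFun π s hs S))
  map_star' S := covFun_eq π s hs (star_mem_covClosure s (mem_covClosure_covFun π s hs S))

lemma covHom_theta (hs : ∀ x y, star (s x) * s y = π (Y.ip x y)) (x y : Y) :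
    covHom π s hs (Cpt.theta x y) = s x * star (s y) :=
  covFun_eq π s hs (Submodule.le_topologicalClosure _ (theta_mem_covGraph s x y))

end Covariance

/-- A representation `(π, t)` of a Hilbert `A`-bimodule `X` on a `C*`-algebra `B`. -/
structure Representation (X : HilbBimod A) (B : Type v) [NonUnitalCStarAlgebra B] where
  /-- the `*`-homomorphism `π : A → B` -/
  π : A →⋆ₙₐ[ℂ] B
  /-- the linear map `t : X → B` -/
  t : X →ₗ[ℂ] B
  star_t_mul_t : ∀ ξ η : X, star (t ξ) * t η = π (X.toHilbMod.ip ξ η)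
  π_mul_t : ∀ (a : A) (ξ : X), π a * t ξ = t (X.φ a ξ)

namespace Representation

variable {X : HilbBimod A} (ρ : Representation X B)

lemma norm_t_le (x : X) : ‖ρ.t x‖ ≤ 1 * ‖x‖ := by
  rw [one_mul]
  refine le_of_sq_le_sq ?_ (norm_nonneg _)
  rw [HilbMod.norm_sq, pow_two, ← CStarRing.norm_star_mul_self, ρ.star_t_mul_t]
  exact NonUnitalStarAlgHom.norm_apply_le ρ.π _

section Step

variable {Y : HilbMod A} (s : Y →L[ℂ] B)

/-- The map `ξ ⊗ η ↦ s(ξ) t(η)` on the algebraic tensor product. -/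
def stepAlg : Y ⊗[ℂ] X.toHilbMod →ₗ[ℂ] B :=
  TensorProduct.lift ((LinearMap.mul ℂ B).compl₁₂ s.toLinearMap ρ.t)

lemma stepAlg_tmul (y : Y) (x : X) : ρ.stepAlg s (y ⊗ₜ x) = s y * ρ.t x := rfl

lemma star_stepAlg_mul (hs : ∀ x y, star (s x) * s y = ρ.π (Y.ip x y))
    (u v : Y ⊗[ℂ] X.toHilbMod) :
    star (ρ.stepAlg s u) * ρ.stepAlg s v = ρ.π (tensorFormₛₗ Y X u v) := by
  induction v with
  | zero => simp
  | add v w hv hw => simp only [map_add, mul_add, hv, hw]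
  | tmul y' x' =>
    induction u with
    | zero => simp
    | add v w hv hw => simp only [map_add, star_add, add_mul, LinearMap.add_apply, hv, hw]
    | tmul y x =>
      rw [stepAlg_tmul, stepAlg_tmul, tensorFormₛₗ_tmul, ← ρ.star_t_mul_t, ← ρ.π_mul_t, ← hs,
        star_mul]
      simp only [mul_assoc]

/-- The map `ξ ⊗ η ↦ s(ξ) t(η)` on `Y ⊗_φ X`. -/
def step (hs : ∀ x y, star (s x) * s y = ρ.π (Y.ip x y))
    : HilbMod.tensor Y X →L[ℂ] B :=
  (tensorForm Y X).extend (ρ.stepAlg s) 1 zero_le_one fun u => by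
    rw [one_pow, one_mul, pow_two, ← CStarRing.norm_star_mul_self, ρ.star_stepAlg_mul s hs]
    exact NonUnitalStarAlgHom.norm_apply_le ρ.π _

lemma step_tensorι (hs : ∀ x y, star (s x) * s y = ρ.π (Y.ip x y))
    (u : Y ⊗[ℂ] X.toHilbMod) :
    ρ.step s hs (tensorι Y X u) = ρ.stepAlg s u :=
  RightForm.extend_toCompletion _ _ _ _ _ u

lemma step_tmul (hs : ∀ x y, star (s x) * s y = ρ.π (Y.ip x y))
    (y : Y) (x : X) : ρ.step s hs (HilbMod.tmul y x) = s y * ρ.t x :=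
  ρ.step_tensorι s hs _

lemma continuous_π : Continuous ρ.π :=
  AddMonoidHomClass.continuous_of_bound ρ.π 1 fun a => by
    rw [one_mul]; exact NonUnitalStarAlgHom.norm_apply_le ρ.π a

lemma star_step_mul (hs : ∀ x y, star (s x) * s y = ρ.π (Y.ip x y))
    (u v : HilbMod.tensor Y X) :
    star (ρ.step s hs u) * ρ.step s hs v = ρ.π ((HilbMod.tensor Y X).ip u v) := by
  have hc := (HilbMod.tensor Y X).continuous_ip
  have hS := (ρ.step s hs).continuous
  refine (denseRange_tensorι Y X).induction_on₂ (p := fun u v =>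
    star (ρ.step s hs u) * ρ.step s hs v = ρ.π ((HilbMod.tensor Y X).ip u v))
    (isClosed_eq ?_ ?_) (fun a b => ?_) u v
  · exact (hS.comp continuous_fst).star.mul (hS.comp continuous_snd)
  · exact ρ.continuous_π.comp hc
  · rw [step_tensorι, step_tensorι, ip_tensorι, ρ.star_stepAlg_mul s hs]

end Step

/-- The map `π`, as a bounded linear map. -/
def πL : HilbMod.self A →L[ℂ] B where
  toFun x := ρ.π (HilbMod.toAlg x)
  map_add' x y := map_add ρ.π (HilbMod.toAlg x) (HilbMod.toAlg y)
  map_smul' c x := map_smul ρ.π c (HilbMod.toAlg x)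
  cont := ρ.continuous_π

/-- The maps `t_n : X^{⊗n} → B`, with `t_0 = π`, `t_1 = t` and `t_{n+1}(ξ ⊗ η) = t_n(ξ) t(η)`,
bundled with the identity `t_n(ξ)* t_n(η) = π(⟨ξ, η⟩)` which their construction uses. -/
def tPowAux : ∀ n, {s : X.pow n →L[ℂ] B // ∀ x y, star (s x) * s y = ρ.π ((X.pow n).ip x y)}
  | 0 => ⟨ρ.πL, fun x y => by
      change star (ρ.π (HilbMod.toAlg x)) * ρ.π (HilbMod.toAlg y) = _
      rw [← map_star, ← map_mul]; rfl⟩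
  | 1 => ⟨ρ.t.mkContinuous 1 ρ.norm_t_le, ρ.star_t_mul_t⟩
  | n + 2 => ⟨ρ.step (tPowAux (n + 1)).1 (tPowAux (n + 1)).2,
      ρ.star_step_mul (tPowAux (n + 1)).1 (tPowAux (n + 1)).2⟩

/-- The maps `t_n : X^{⊗n} → B`. -/
def tPow (n : ℕ) : X.pow n →L[ℂ] B := (ρ.tPowAux n).1

lemma tPow_zero (a : A) : ρ.tPow 0 (HilbMod.ofAlg a) = ρ.π a := rfl
lemma tPow_one (x : X) : ρ.tPow 1 x = ρ.t x := rfl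
lemma tPow_succ (n : ℕ) (y : X.pow (n + 1)) (x : X) :
    ρ.tPow (n + 2) (HilbMod.tmul y x) = ρ.tPow (n + 1) y * ρ.t x :=
  ρ.step_tmul (ρ.tPowAux (n + 1)).1 (ρ.tPowAux (n + 1)).2 y x

lemma star_tPow_mul (n : ℕ) (x y : X.pow n) :
    star (ρ.tPow n x) * ρ.tPow n y = ρ.π ((X.pow n).ip x y) := (ρ.tPowAux n).2 x y

/-- The `*`-homomorphism `t^{(n)} : 𝒦(X^{⊗n}) → B` with `t^{(n)}(θ_{ξ,η}) = t_n(ξ) t_n(η)*`. -/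
def tCpt (n : ℕ) : Cpt (X.pow n) →⋆ₙₐ[ℂ] B := covHom ρ.π (ρ.tPow n) (ρ.star_tPow_mul n)

lemma tCpt_theta (n : ℕ) (x y : X.pow n) :
    ρ.tCpt n (Cpt.theta x y) = ρ.tPow n x * star (ρ.tPow n y) := covHom_theta _ _ _ x y

/-- Cuntz–Pimsner covariance: `π(a) = t^{(1)}(φ(a))` for all `a` in the ideal
`J_X = {a | φ(a) ∈ 𝒦(X) and a b = 0 for all b ∈ ker φ}`. -/
def IsCuntzPimsner : Prop :=
  ∀ (a : A) (h : X.φ a ∈ Adj.compacts X.toHilbMod), (∀ b, X.φ b = 0 → a * b = 0) →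
    ρ.π a = ρ.tCpt 1 (Cpt.mk (X.φ a) h)

/-- The core `C*(π,t)^core`: the closed linear span of the elements `t_n(ξ) t_n(η)*`, where
`n ≥ 0` and `ξ, η ∈ X^{⊗n}`. -/
def core : Submodule ℂ B :=
  (Submodule.span ℂ {b | ∃ n, ∃ ξ η : X.pow n, b = ρ.tPow n ξ * star (ρ.tPow n η)}).topologicalClosure

end Representation

end CuntzPimsner

end

/-! Given a family `S_p`, write `T_q = ∑_{p ≤ q} ι_p^q(S_p)`, an operator on `X^{⊗q}`. Then `T_{q+1}
= T_q ⊗ 1 + S_{q+1}`, where for `q = 0` the operator `L_a ⊗ 1` is to be read as `φ(a)`. Since `ker φ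
⊆ ker φ_m` for all `m > 0`, every `I_k` with `k ≥ 1` equals `ker φ`. Hence `∑_{p ≤ n} ι̃_p^n(S_p) =
0` means that `T_q` vanishes on `X^{⊗q} ker φ` for `q < n` and that `T_n = 0`
(`sumC_self_eq_zero_iff`).

Well-definedness of `κ_n` rests on one fact about a Hilbert module `Y`: if `T` vanishes on `Y ker φ`
and `T ⊗ 1` is compact, then `T` is compact and `T`, `T ⊗ 1` have the same image in `B`.
Compactness: `T ↦ (T|_{Y ker φ}, T ⊗ 1)` is injective, hence isometric, so `u T → T` for an
approximate unit `u` of `𝒦(Y)`, because this holds after tensoring with `1`. Equality of images: the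
coefficients `⟨ξ, T η⟩` lie in `J_X`, so covariance gives the claim for `θ_{x,y} T θ_{x',y'}`, and
an approximate unit recovers `T` (`covHom_eq_covHom_step`). If now `T_n = 0`, then `T_{n-1} ⊗ 1 =
-S_n` is compact, so `T_{n-1}` is compact with the same image. Descending in this way gives `∑
t^{(p)}(S_p) = t^{(n)}(T_n) = 0` (`tCpt_tot`).

For injectivity, `t^{(p)}(S) t_q(η)` is `t_q(ι_p^q(S) η)` if `p ≤ q`, and `0` if `p > q` and `η ∈
X^{⊗q} ker φ`. When `π` is injective each `t_q` is isometric, so `∑ t^{(p)}(S_p) = 0` forces exactly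
the vanishing conditions on the `T_q` above.

Norm statements need `C_n` to be complete. By induction, `C_{n+1}` is the sum of the isometric image
of `C_n` and of the closed subalgebra `ι̃(𝒦(X^{⊗(n+1)}))`, which absorbs products with the former;
such a sum is closed (`isClosed_add_ideal`). Then `κ_n` is contractive, and isometric if injective,
so it extends to the limit. The range is closed and contains the generators of the core. -/

noncomputable section

/-! ### Closedness of the sum of a `C*`-subalgebra and an ideal -/

/-- The pairs `(r, d)` with `r ∈ R` and `r - d ∈ I`, where `R I ⊆ I`. -/
def congruentPairs {D : Type*} [NonUnitalCStarAlgebra D] (R I : NonUnitalStarSubalgebra ℂ D)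
    (hRI : ∀ r ∈ R, ∀ i ∈ I, r * i ∈ I) : NonUnitalStarSubalgebra ℂ (D × D) where
  carrier := {z | z.1 ∈ R ∧ z.1 - z.2 ∈ I}
  add_mem' {z w} hz hw := ⟨add_mem hz.1 hw.1, by
    have := add_mem hz.2 hw.2
    rwa [sub_add_sub_comm] at this⟩
  zero_mem' := ⟨zero_mem _, by simp⟩
  mul_mem' {z w} hz hw := ⟨mul_mem hz.1 hw.1, by
    have h1 : (z.1 - z.2) * w.1 ∈ I := by
      have := star_mem (hRI _ (star_mem hw.1) _ (star_mem hz.2))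
      rwa [star_mul, star_star, star_star] at this
    have := sub_mem (add_mem h1 (hRI _ hz.1 _ hw.2)) (mul_mem hz.2 hw.2)
    -- The second components need not lie in `R`, so the difference of products is written using
    -- only first components and differences.
    have e : (z.1 - z.2) * w.1 + z.1 * (w.1 - w.2) - (z.1 - z.2) * (w.1 - w.2) =
        (z * w).1 - (z * w).2 := by
      simp only [Prod.fst_mul, Prod.snd_mul]
      noncomm_ring
    rwa [e] at this⟩
  smul_mem' c z hz := ⟨SMulMemClass.smul_mem c hz.1, by
    have := SMulMemClass.smul_mem c hz.2
    rwa [smul_sub] at this⟩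
  star_mem' {z} hz := ⟨star_mem hz.1, by
    have := star_mem hz.2
    rwa [star_sub] at this⟩

/-- If `R I ⊆ I`, then a self-adjoint `r ∈ R` is as close to some element of `R ∩ I` as it is to a
given self-adjoint element of `I`. -/
lemma exists_mem_norm_sub_le_of_isSelfAdjoint {D : Type*} [NonUnitalCStarAlgebra D]
    (R : NonUnitalStarSubalgebra ℂ D) (hR : IsClosed (R : Set D))
    (I : NonUnitalStarSubalgebra ℂ D) (hI : IsClosed (I : Set D))
    (hRI : ∀ r ∈ R, ∀ i ∈ I, r * i ∈ I)
    {r i : D} (hr : r ∈ R) (hi : i ∈ I) (hrs : IsSelfAdjoint r) (his : IsSelfAdjoint i) :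
    ∃ c ∈ R, c ∈ I ∧ ‖r - c‖ ≤ ‖r + i‖ := by
  set ρ := ‖r + i‖ with hρ
  have hρ0 : 0 ≤ ρ := norm_nonneg _
  -- `f` subtracts from `t` its truncation to `[-ρ, ρ]`. It vanishes on the spectrum of `r + i`, and
  -- `t - f t` is bounded by `ρ`; the element sought is `c = f(r)`.
  let f : ℝ → ℝ := fun t => t - max (-ρ) (min t ρ)
  have hf : Continuous f := by fun_prop
  have hf0 : f 0 = 0 := by simp [f, hρ0]
  have hbs : IsSelfAdjoint (r + i) := hrs.add his
  have hfb : cfcₙ f (r + i) = 0 := by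
    rw [← cfcₙ_zero (R := ℝ) (r + i)]
    refine cfcₙ_congr fun x hx => ?_
    have h1 := norm_apply_le_norm_cfcₙ (fun x : ℝ => x) (r + i) hx
    rw [cfcₙ_id' ℝ (r + i), ← hρ, Real.norm_eq_abs, abs_le] at h1
    simp [f, h1.1, h1.2]
  have hcl : IsClosed (congruentPairs R I hRI : Set (D × D)) :=
    (hR.preimage continuous_fst).inter (hI.preimage (continuous_fst.sub continuous_snd))
  have hmem : (r, r + i) ∈ congruentPairs R I hRI :=
    ⟨hr, by simpa using hi⟩
  have hpair : IsSelfAdjoint (r, r + i) := Prod.ext hrs.star_eq hbs.star_eq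
  -- Functional calculus preserves the closed `*`-subalgebra of pairs and acts componentwise, so
  -- `f(r) ∈ R` and `f(r) - f(r + i) = f(r) ∈ I`.
  have h2 : cfcₙ f (r, r + i) ∈ congruentPairs R I hRI :=
    cfcₙ_mem (hs := hcl) (𝕜' := ℂ) f hmem
  rw [cfcₙ_map_prod (S := ℂ) f r (r + i) hf.continuousOn hpair hrs hbs, hfb] at h2
  refine ⟨cfcₙ f r, h2.1, by simpa using h2.2, ?_⟩
  have h3 : r - cfcₙ f r = cfcₙ (fun t => max (-ρ) (min t ρ)) r := by
    conv_lhs => enter [1]; rw [← cfcₙ_id' ℝ r]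
    rw [← cfcₙ_sub (fun x : ℝ => x) f r (by fun_prop) rfl hf.continuousOn hf0]
    simp [f]
  rw [h3]
  refine norm_cfcₙ_le fun x _ => ?_
  rw [Real.norm_eq_abs, abs_le]
  exact ⟨le_max_left _ _, max_le (by linarith) (min_le_right _ _)⟩

/-- The self-adjoint case is applied to the real and imaginary parts of `r`, the latter being the
real part of `-I • r`. Adding the two estimates costs the factor `2`. -/
lemma exists_mem_norm_sub_le {D : Type*} [NonUnitalCStarAlgebra D]
    (R : NonUnitalStarSubalgebra ℂ D) (hR : IsClosed (R : Set D))
    (I : NonUnitalStarSubalgebra ℂ D) (hI : IsClosed (I : Set D))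
    (hRI : ∀ r ∈ R, ∀ i ∈ I, r * i ∈ I)
    {r i : D} (hr : r ∈ R) (hi : i ∈ I) :
    ∃ c ∈ R, c ∈ I ∧ ‖r - c‖ ≤ 2 * ‖r + i‖ := by
  have key : ∀ r i : D, r ∈ R → i ∈ I →
      ∃ c ∈ R, c ∈ I ∧ ‖(realPart r : D) - c‖ ≤ ‖r + i‖ := fun r i hr hi => by
    obtain ⟨c, h1, h2, h3⟩ := exists_mem_norm_sub_le_of_isSelfAdjoint R hR I hI hRI
      (r := realPart r) (i := realPart i)
      (by rw [realPart_apply_coe, ← Complex.coe_smul]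
          exact SMulMemClass.smul_mem _ (add_mem hr (star_mem hr)))
      (by rw [realPart_apply_coe, ← Complex.coe_smul]
          exact SMulMemClass.smul_mem _ (add_mem hi (star_mem hi)))
      (realPart r).2 (realPart i).2
    refine ⟨c, h1, h2, h3.trans ?_⟩
    have : ((realPart r : D) + realPart i) = realPart (r + i) := by rw [map_add]; rfl
    rw [this]
    exact realPart.norm_le (r + i)
  obtain ⟨c, h1, h2, h3⟩ := key r i hr hi
  obtain ⟨c', h1', h2', h3'⟩ := key (-Complex.I • r) (-Complex.I • i)
    (SMulMemClass.smul_mem _ hr) (SMulMemClass.smul_mem _ hi)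
  have e : (realPart (-Complex.I • r) : D) = imaginaryPart r := by
    rw [neg_smul, map_neg, realPart_I_smul, neg_neg]
  rw [e, ← smul_add, norm_smul, norm_neg, Complex.norm_I, one_mul] at h3'
  refine ⟨c + Complex.I • c', add_mem h1 (SMulMemClass.smul_mem _ h1'),
    add_mem h2 (SMulMemClass.smul_mem _ h2'), ?_⟩
  have e2 : r - (c + Complex.I • c') =
      ((realPart r : D) - c) + Complex.I • ((imaginaryPart r : D) - c') := by
    conv_lhs => rw [← realPart_add_I_smul_imaginaryPart r]
    rw [smul_sub]; abel
  rw [e2]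
  refine (norm_add_le _ _).trans ?_
  rw [norm_smul, Complex.norm_I, one_mul]
  linarith

/-- The sum of closed `*`-subalgebras `R` and `I` with `R I ⊆ I` is closed. -/
lemma isClosed_add_ideal {D : Type*} [NonUnitalCStarAlgebra D]
    (R : NonUnitalStarSubalgebra ℂ D) (hR : IsClosed (R : Set D))
    (I : NonUnitalStarSubalgebra ℂ D) (hI : IsClosed (I : Set D))
    (hRI : ∀ r ∈ R, ∀ i ∈ I, r * i ∈ I) :
    IsClosed {x : D | ∃ r ∈ R, ∃ i ∈ I, x = r + i} := by
  have : CompleteSpace R := hR.completeSpace_coe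
  have : CompleteSpace I := hI.completeSpace_coe
  let f : NormedAddGroupHom (R × I) D :=
    AddMonoidHom.mkNormedAddGroupHom
      (AddMonoidHom.mk' (fun z : R × I => (z.1 : D) + z.2) fun z w => by
        change (z.1 : D) + w.1 + ((z.2 : D) + w.2) = _
        abel) 2 fun z => by
        refine (norm_add_le _ _).trans ?_
        rw [two_mul]
        exact add_le_add (norm_fst_le z) (norm_snd_le z)
  let K : AddSubgroup D := f.range
  -- Moving `c ∈ R ∩ I` between the summands, `r + i = (r - c) + (i + c)`, bounds them by `2` and `1
  -- + 2 = 3` times `‖r + i‖`. Preimages of controlled norm in a complete space make the range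
  -- closed.
  have hK : f.SurjectiveOnWith K 3 := by
    rintro _ ⟨⟨⟨r, hr⟩, ⟨i, hi⟩⟩, rfl⟩
    obtain ⟨c, hc, hc', hle⟩ := exists_mem_norm_sub_le R hR I hI hRI hr hi
    refine ⟨(⟨r - c, sub_mem hr hc⟩, ⟨i + c, add_mem hi hc'⟩), ?_, ?_⟩
    · change r - c + (i + c) = r + i
      abel
    · change max ‖r - c‖ ‖i + c‖ ≤ 3 * ‖r + i‖
      have h1 : ‖i + c‖ ≤ ‖r + i‖ + ‖r - c‖ := by
        have : i + c = (r + i) - (r - c) := by abel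
        rw [this]
        exact norm_sub_le _ _
      refine max_le ?_ ?_ <;> linarith [norm_nonneg (r + i)]
  have h4 := controlled_closure_of_complete (by norm_num) one_pos hK
  have e : {x : D | ∃ r ∈ R, ∃ i ∈ I, x = r + i} = (K : Set D) := by
    ext x
    constructor
    · rintro ⟨r, hr, i, hi, rfl⟩
      exact ⟨(⟨r, hr⟩, ⟨i, hi⟩), rfl⟩
    · rintro ⟨⟨⟨r, hr⟩, ⟨i, hi⟩⟩, rfl⟩
      exact ⟨r, hr, i, hi, rfl⟩
  rw [e]
  refine isClosed_of_closure_subset fun x hx => ?_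
  obtain ⟨z, rfl, -⟩ := h4 x hx
  exact ⟨z, rfl⟩

/-! ### Approximate units of compact operators and the operators `T ⊗ 1` -/

namespace CuntzPimsner

variable {A : Type u} [NonUnitalCStarAlgebra A] [PartialOrder A] [StarOrderedRing A]

open Filter Topology

/-- The compact operators have an approximate unit, consisting eventually of contractions. -/
lemma Cpt.exists_approximateUnit (Y : HilbMod A) :
    ∃ l : Filter (Cpt Y), l.NeBot ∧ (∀ S : Cpt Y, Tendsto (fun u => u * S) l (𝓝 S)) ∧
      (∀ S : Cpt Y, Tendsto (fun u => S * u) l (𝓝 S)) ∧ ∀ᶠ u in l, ‖u‖ ≤ 1 := by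
  let _ := CStarAlgebra.spectralOrder (Cpt Y)
  have := CStarAlgebra.spectralOrderedRing (Cpt Y)
  have h := CStarAlgebra.increasingApproximateUnit (Cpt Y)
  exact ⟨_, inferInstance, h.tendsto_mul_right, h.tendsto_mul_left, h.eventually_norm⟩

/-- The element `⟨x, θ_{x,x} x⟩ = ⟨x, x⟩²` has norm `‖x‖⁴`, while Cauchy–Schwarz bounds it by
`‖θ_{x,x}‖ ‖x‖²`. This converts norm convergence in `𝒦(Y)` into convergence of vectors. -/
lemma HilbMod.norm_le_norm_theta (Y : HilbMod A) (x : Y) : ‖x‖ ^ 2 ≤ ‖Adj.theta x x‖ := by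
  rcases eq_or_ne x 0 with rfl | hx
  · rw [norm_zero]; simp
  have hx' : 0 < ‖x‖ := norm_pos_iff.2 hx
  have h1 := Y.norm_ip_le x (Adj.theta x x x)
  have h2 := Adj.norm_apply_le (Adj.theta x x) x
  rw [Adj.theta_apply, Y.ip_act_right] at h1
  have h3 : ‖Y.ip x x * Y.ip x x‖ = ‖x‖ ^ 2 * ‖x‖ ^ 2 := by
    conv_lhs => enter [1, 1]; rw [← Y.star_ip]
    rw [CStarRing.norm_star_mul_self, ← Y.norm_sq]
  rw [h3, ← Adj.theta_apply] at h1
  have h4 : ‖x‖ ^ 2 * ‖x‖ ^ 2 ≤ ‖x‖ ^ 2 * ‖Adj.theta x x‖ := by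
    calc _ ≤ ‖x‖ * ‖Adj.theta x x x‖ := h1
      _ ≤ ‖x‖ * (‖Adj.theta x x‖ * ‖x‖) := by gcongr
      _ = _ := by ring
  exact le_of_mul_le_mul_left h4 (by positivity)

/-- With `d = u x - x` and `θ = θ_{x,x}` one has `θ_{d,d} = (u θ - θ)(u - 1)*`, hence `‖d‖² ≤ 2 ‖u θ
- θ‖`. -/
lemma Cpt.tendsto_apply {Y : HilbMod A} {l : Filter (Cpt Y)}
    (hl : ∀ S : Cpt Y, Tendsto (fun u => u * S) l (𝓝 S)) (hb : ∀ᶠ u in l, ‖u‖ ≤ 1) (x : Y) :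
    Tendsto (fun u : Cpt Y => u.op x) l (𝓝 x) := by
  rw [tendsto_iff_norm_sub_tendsto_zero]
  have h1 : Tendsto (fun u : Cpt Y => √(2 * ‖u * Cpt.theta x x - Cpt.theta x x‖)) l (𝓝 0) := by
    have h2 := (tendsto_iff_norm_sub_tendsto_zero.1 (hl (Cpt.theta x x))).const_mul 2
    have h3 := (Real.continuous_sqrt.tendsto _).comp h2
    simpa only [Function.comp_def, mul_zero, Real.sqrt_zero] using h3
  refine squeeze_zero' (Eventually.of_forall fun u => norm_nonneg _) ?_ h1
  filter_upwards [hb] with u hu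
  refine Real.le_sqrt_of_sq_le ((Y.norm_le_norm_theta _).trans ?_)
  have e : Adj.theta (u.op x - x) (u.op x - x) =
      (u * Cpt.theta x x - Cpt.theta x x).op * star (u.op - 1) := by
    have e1 : (u * Cpt.theta x x - Cpt.theta x x).op = (u.op - 1) * Adj.theta x x := by
      rw [sub_mul, one_mul]; rfl
    rw [e1, mul_assoc, Adj.theta_mul, Adj.mul_theta, star_star]
    rfl
  rw [e]
  refine (norm_mul_le _ _).trans ?_
  rw [Cpt.norm_op, norm_star, mul_comm]
  gcongr
  -- Only an inequality, because `Y` may be the zero module.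
  have h4 : ‖(1 : Adj Y)‖ ≤ 1 := Adj.norm_le _ zero_le_one fun x => by simp
  refine (norm_sub_le _ _).trans ?_
  rw [Cpt.norm_op]
  linarith

section Tensor

variable {Y : HilbMod A} {X : HilbBimod A}

lemma HilbMod.tmul_sub_left (y y' : Y) (x : X.toHilbMod) :
    HilbMod.tmul (y - y') x = HilbMod.tmul y x - HilbMod.tmul y' x := by
  unfold HilbMod.tmul
  rw [TensorProduct.sub_tmul, map_sub]

lemma HilbMod.norm_tmul_le (y : Y) (x : X.toHilbMod) : ‖HilbMod.tmul y x‖ ≤ ‖y‖ * ‖x‖ := by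
  refine le_of_sq_le_sq ?_ (by positivity)
  rw [HilbMod.norm_sq, ip_tmul, mul_pow, Y.norm_sq]
  refine (X.toHilbMod.norm_ip_le _ _).trans ?_
  have h1 := Adj.norm_apply_le (X.φ (Y.ip y y)) x
  have h2 := NonUnitalStarAlgHom.norm_apply_le X.φ (Y.ip y y)
  calc ‖x‖ * ‖X.φ (Y.ip y y) x‖ ≤ ‖x‖ * (‖X.φ (Y.ip y y)‖ * ‖x‖) := by gcongr
    _ ≤ ‖x‖ * (‖Y.ip y y‖ * ‖x‖) := by gcongr
    _ = _ := by ring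

lemma HilbMod.continuous_tmul_left (x : X.toHilbMod) :
    Continuous fun y : Y => HilbMod.tmul y x := by
  refine continuous_iff_continuousAt.2 fun y => ?_
  refine tendsto_iff_norm_sub_tendsto_zero.2 ?_
  have h : Tendsto (fun y' : Y => ‖y' - y‖ * ‖x‖) (𝓝 y) (𝓝 0) := by
    have : Continuous fun y' : Y => ‖y' - y‖ * ‖x‖ := by fun_prop
    simpa using this.tendsto y
  refine squeeze_zero (fun _ => norm_nonneg _) (fun y' => ?_) h
  rw [← HilbMod.tmul_sub_left]
  exact HilbMod.norm_tmul_le _ _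

/-- On elementary tensors this is the convergence `u y → y`; the bound `‖u ⊗ 1‖ ≤ 1` carries it to
the closure. The operators `u ⊗ 1` need not be compact, but strong convergence suffices below. -/
lemma tendsto_tensorOne_apply {l : Filter (Cpt Y)}
    (hl : ∀ S : Cpt Y, Tendsto (fun u => u * S) l (𝓝 S)) (hb : ∀ᶠ u in l, ‖u‖ ≤ 1)
    (z : HilbMod.tensor Y X) :
    Tendsto (fun u : Cpt Y => tensorOne Y X u.op z) l (𝓝 z) := by
  have halg : ∀ w : Y ⊗[ℂ] X.toHilbMod,
      Tendsto (fun u : Cpt Y => tensorOne Y X u.op (tensorι Y X w)) l (𝓝 (tensorι Y X w)) := by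
    intro w
    induction w with
    | zero =>
      have : ∀ T : Adj (HilbMod.tensor Y X), T (tensorι Y X 0) = tensorι Y X 0 := fun T => by
        rw [map_zero]; exact T.toL.map_zero
      simp only [this]
      exact tendsto_const_nhds
    | add v w hv hw =>
      simp only [map_add, Adj.map_add']
      exact hv.add hw
    | tmul y x =>
      have h : ∀ u : Cpt Y, tensorOne Y X u.op (tensorι Y X (y ⊗ₜ x)) =
        HilbMod.tmul (u.op y) x := fun u => tensorOne_tmul Y X u.op y x
      simp only [h]
      exact ((HilbMod.continuous_tmul_left x).tendsto y).comp (Cpt.tendsto_apply hl hb y)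
  rw [Metric.tendsto_nhds]
  intro ε hε
  obtain ⟨w, hw⟩ := (denseRange_tensorι Y X).exists_dist_lt z (show 0 < ε / 3 by positivity)
  filter_upwards [hb, (Metric.tendsto_nhds.1 (halg w)) (ε / 3) (by positivity)] with u hu h1
  have h2 : dist (tensorOne Y X u.op z) (tensorOne Y X u.op (tensorι Y X w)) ≤
      dist z (tensorι Y X w) := by
    have e : tensorOne Y X u.op z - tensorOne Y X u.op (tensorι Y X w) =
        tensorOne Y X u.op (z - tensorι Y X w) :=
      ((tensorOne Y X u.op).toL.map_sub _ _).symm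
    rw [dist_eq_norm, dist_eq_norm, e]
    have h3 : ‖tensorOne Y X u.op‖ ≤ 1 :=
      (NonUnitalStarAlgHom.norm_apply_le (tensorOne Y X) u.op).trans hu
    refine (Adj.norm_apply_le _ _).trans ?_
    exact mul_le_of_le_one_left (norm_nonneg _) h3
  have h4 := dist_triangle4 (tensorOne Y X u.op z) (tensorOne Y X u.op (tensorι Y X w))
    (tensorι Y X w) z
  rw [dist_comm (tensorι Y X w) z] at h4
  linarith

/-- Operators which converge strongly to the identity and are bounded act as an approximate unit on
compact operators. -/
lemma tendsto_mul_of_mem_compacts {ι : Type*} {Z : HilbMod A} {l : Filter ι} {f : ι → Adj Z}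
    (hf : ∀ z, Tendsto (fun u => f u z) l (𝓝 z)) (hb : ∀ᶠ u in l, ‖f u‖ ≤ 1) {K : Adj Z}
    (hK : K ∈ Adj.compacts Z) : Tendsto (fun u => f u * K) l (𝓝 K) := by
  have hfin : ∀ K ∈ Adj.finiteRank Z, Tendsto (fun u => f u * K) l (𝓝 K) := by
    intro K hK
    induction hK using Submodule.span_induction with
    | mem K hK =>
      obtain ⟨p, rfl⟩ := hK
      simp only [Adj.mul_theta]
      refine tendsto_iff_norm_sub_tendsto_zero.2 ?_
      have h : Tendsto (fun u => ‖f u p.1 - p.1‖ * ‖p.2‖) l (𝓝 0) := by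
        simpa using (tendsto_iff_norm_sub_tendsto_zero.1 (hf p.1)).mul_const ‖p.2‖
      refine squeeze_zero (fun _ => norm_nonneg _) (fun u => ?_) h
      refine Adj.norm_le _ (by positivity) fun z => ?_
      have e : (Adj.theta (f u p.1) p.2 - Adj.theta p.1 p.2) z =
          Z.act (f u p.1 - p.1) (Z.ip p.2 z) := by
        rw [Adj.sub_apply, Adj.theta_apply, Adj.theta_apply]
        exact (map_sub (Z.toForm.act (Z.ip p.2 z)) _ _).symm
      rw [e]
      refine (Z.norm_act_le _ _).trans ?_
      rw [mul_assoc]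
      gcongr
      exact Z.norm_ip_le _ _
    | zero => simpa using tendsto_const_nhds
    | add S S' _ _ h h' => simpa only [mul_add] using h.add h'
    | smul c S _ h => simpa only [mul_smul_comm] using h.const_smul c
  rw [Metric.tendsto_nhds]
  intro ε hε
  obtain ⟨w, hw, hw'⟩ := Metric.mem_closure_iff.1 (show K ∈ closure (Adj.finiteRank Z : Set _)
    from hK) (ε / 3) (by positivity)
  filter_upwards [hb, (Metric.tendsto_nhds.1 (hfin w hw)) (ε / 3) (by positivity)] with u hu h1
  have h2 : dist (f u * K) (f u * w) ≤ dist K w := by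
    rw [dist_eq_norm, dist_eq_norm, ← mul_sub]
    refine (norm_mul_le _ _).trans ?_
    exact mul_le_of_le_one_left (norm_nonneg _) hu
  have h4 := dist_triangle4 (f u * K) (f u * w) w K
  rw [dist_comm w K] at h4
  linarith

variable (X) in
/-- The pair of `T|_{Y ker φ}` and `T ⊗ 1`. -/
def restrictTensor (Y : HilbMod A) : Adj Y →⋆ₙₐ[ℂ] Adj (X.subI Y 1) × Adj (HilbMod.tensor Y X) :=
  (X.restrictI Y 1).toNonUnitalStarAlgHom.prod (tensorOne Y X).toNonUnitalStarAlgHom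

/-- An operator on `Y` whose values lie in `Y ker φ` and which vanishes there is zero. -/
lemma Adj.eq_zero_of_restrictI {T : Adj Y} (h1 : X.restrictI Y 1 T = 0)
    (h2 : ∀ x y, X.φ (Y.ip x (T y)) = 0) : T = 0 := by
  have h3 : X.restrictI Y 1 (star T) = 0 := by rw [map_star, h1, star_zero]
  ext y
  have hmem : T y ∈ X.submI Y 1 := by
    refine (X.mem_submI_iff Y 1).2 fun x m hm hk => ?_
    obtain rfl : m = 1 := le_antisymm hk hm
    exact h2 x y
  -- `T y` lies in `Y ker φ` by `h2`, and `T*` vanishes there together with `T`; so `⟨T y, T y⟩ =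
  -- ⟨y, T* T y⟩ = 0`.
  have h4 : star T (T y) = 0 := by
    have := congrArg (fun S : Adj (X.subI Y 1) => X.subIval Y 1 (S (X.subImk Y 1 (T y) hmem))) h3
    exact this
  rw [Adj.zero_apply, ← Y.ip_self_eq_zero, Adj.ip_left, h4, Y.ip_zero_right]

/-- The matrix coefficients of `T ⊗ 1` are `⟨x ⊗ w, (T ⊗ 1)(y ⊗ z)⟩ = ⟨w, φ(⟨x, T y⟩) z⟩`. -/
lemma φ_ip_eq_zero_of_tensorOne {T : Adj Y} (h : tensorOne Y X T = 0) (x y : Y) :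
    X.φ (Y.ip x (T y)) = 0 := by
  ext z
  refine HilbMod.ext_ip fun w => ?_
  rw [← ip_tmul, ← tensorOne_tmul, h, Adj.zero_apply, Adj.zero_apply, HilbMod.ip_zero_right,
    HilbMod.ip_zero_right]

/-- The kernel of `T ↦ T ⊗ 1` consists of operators with range in `Y ker φ`, and such an operator is
zero once it vanishes on `Y ker φ`. Injectivity makes the pair isometric, so norms of operators on
`Y` can be computed from the two components. -/
lemma restrictTensor_injective : Function.Injective (restrictTensor X Y) := by
  rw [injective_iff_map_eq_zero]
  intro T hT
  exact Adj.eq_zero_of_restrictI (congrArg Prod.fst hT)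
    (φ_ip_eq_zero_of_tensorOne (congrArg Prod.snd hT))

lemma norm_tensorOne_of_restrictI_eq_zero {T : Adj Y} (h : X.restrictI Y 1 T = 0) :
    ‖T‖ = ‖tensorOne Y X T‖ := by
  rw [← NonUnitalStarAlgHom.norm_map (restrictTensor X Y) restrictTensor_injective T]
  change max ‖X.restrictI Y 1 T‖ ‖tensorOne Y X T‖ = _
  rw [h, norm_zero, max_eq_right (norm_nonneg _)]

/-- If `T` vanishes on `Y ker φ` and `T ⊗ 1` is compact, then `T` is the limit of the operators
`u T` for `u` in an approximate unit of `𝒦(Y)`. -/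
lemma tendsto_mul_of_tensorOne_mem_compacts {l : Filter (Cpt Y)}
    (hl : ∀ S : Cpt Y, Tendsto (fun u => u * S) l (𝓝 S)) (hb : ∀ᶠ u in l, ‖u‖ ≤ 1)
    {T : Adj Y} (h : X.restrictI Y 1 T = 0) (hT : tensorOne Y X T ∈ Adj.compacts _) :
    Tendsto (fun u : Cpt Y => u.op * T) l (𝓝 T) := by
  have h1 := tendsto_mul_of_mem_compacts (f := fun u : Cpt Y => tensorOne Y X u.op)
    (tendsto_tensorOne_apply hl hb)
    (hb.mono fun u hu => (NonUnitalStarAlgHom.norm_apply_le (tensorOne Y X) u.op).trans hu) hT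
  refine tendsto_iff_norm_sub_tendsto_zero.2 ?_
  refine (tendsto_iff_norm_sub_tendsto_zero.1 h1).congr fun u => ?_
  -- `u T - T` still vanishes on `Y ker φ`, so its norm is that of `(u ⊗ 1)(T ⊗ 1) - T ⊗ 1`, which
  -- tends to zero because `T ⊗ 1` is compact.
  rw [norm_tensorOne_of_restrictI_eq_zero (T := u.op * T - T) (X := X)
    (by rw [map_sub, map_mul, h, mul_zero, sub_zero])]
  rw [map_sub, map_mul]

lemma mem_compacts_of_tensorOne {T : Adj Y} (h : X.restrictI Y 1 T = 0)
    (hT : tensorOne Y X T ∈ Adj.compacts _) : T ∈ Adj.compacts Y := by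
  obtain ⟨l, hl, h1, -, hb⟩ := Cpt.exists_approximateUnit Y
  have hcl : IsClosed (Adj.compacts Y : Set (Adj Y)) := inferInstance
  exact hcl.mem_of_tendsto (tendsto_mul_of_tensorOne_mem_compacts h1 hb h hT)
    (Eventually.of_forall fun u => Adj.mul_mem_compacts' T u.op_mem)

/-! ### Creation and annihilation operators between `X` and `Y ⊗_φ X` -/

/-- The creation operator `x ↦ ξ ⊗ x`. -/
def creation (ξ : Y) : X.toHilbMod →L[ℂ] HilbMod.tensor Y X :=
  LinearMap.mkContinuous (tensorι Y X ∘ₗ TensorProduct.mk ℂ Y X.toHilbMod ξ) ‖ξ‖ fun x =>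
    HilbMod.norm_tmul_le ξ x

lemma creation_apply (ξ : Y) (x : X.toHilbMod) : creation ξ x = HilbMod.tmul ξ x := rfl

/-- The map `y ⊗ x ↦ φ(⟨ξ, y⟩) x` on the algebraic tensor product. -/
def annihilationAlg (ξ : Y) : Y ⊗[ℂ] X.toHilbMod →ₗ[ℂ] X.toHilbMod :=
  TensorProduct.lift <| LinearMap.mk₂ ℂ (fun (y : Y) (x : X.toHilbMod) => X.φ (Y.ip ξ y) x)
    (fun y y' x => by rw [Y.ip_add_right, map_add, Adj.add_apply])
    (fun c y x => by rw [Y.ip_smul_right, map_smul, Adj.smul_apply])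
    (fun y x x' => Adj.map_add' _ _ _)
    (fun c y x => Adj.map_smul' _ _ _)

lemma ip_creation_tensorι (ξ : Y) (x : X.toHilbMod) (u : Y ⊗[ℂ] X.toHilbMod) :
    (HilbMod.tensor Y X).ip (creation ξ x) (tensorι Y X u) =
      X.toHilbMod.ip x (annihilationAlg ξ u) := by
  induction u with
  | zero => rw [map_zero, map_zero, HilbMod.ip_zero_right, HilbMod.ip_zero_right]
  | add v w hv hw =>
    rw [map_add, map_add, HilbMod.ip_add_right, HilbMod.ip_add_right, hv, hw]
  | tmul y x' => exact ip_tmul Y X ξ y x x'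

/-- The annihilation operator `y ⊗ x ↦ φ(⟨ξ, y⟩) x`, the adjoint of `creation ξ`. -/
def annihilation (ξ : Y) : HilbMod.tensor Y X →L[ℂ] X.toHilbMod :=
  (tensorForm Y X).extend (annihilationAlg ξ) ‖ξ‖ (norm_nonneg _) fun u => by
    -- For `v = T_ξ* u`, Cauchy–Schwarz gives `‖v‖² = ‖⟨T_ξ v, u⟩‖ ≤ ‖ξ‖ ‖v‖ ‖u‖`; the bound follows
    -- on dividing by `‖v‖`.
    have h1 := (HilbMod.tensor Y X).norm_ip_le (creation ξ (annihilationAlg ξ u)) (tensorι Y X u)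
    rw [ip_creation_tensorι, ← HilbMod.norm_sq] at h1
    have h2 : ‖creation ξ (annihilationAlg (X := X) ξ u)‖ ≤ ‖ξ‖ * ‖annihilationAlg (X := X) ξ u‖ :=
      HilbMod.norm_tmul_le ξ _
    have h3 : ‖tensorι Y X u‖ ^ 2 = ‖(tensorForm Y X).form u u‖ := by
      rw [HilbMod.norm_sq, ip_tensorι]; rfl
    rw [← h3, ← mul_pow]
    refine pow_le_pow_left₀ (norm_nonneg _) ?_ 2
    rcases (norm_nonneg (annihilationAlg (X := X) ξ u)).eq_or_lt with h0 | h0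
    · rw [← h0]; positivity
    · refine le_of_mul_le_mul_left ?_ h0
      calc _ = ‖annihilationAlg (X := X) ξ u‖ ^ 2 := (pow_two _).symm
        _ ≤ _ := h1
        _ ≤ (‖ξ‖ * ‖annihilationAlg (X := X) ξ u‖) * ‖tensorι Y X u‖ := by gcongr
        _ = _ := by ring

lemma annihilation_tensorι (ξ : Y) (u : Y ⊗[ℂ] X.toHilbMod) :
    annihilation ξ (tensorι Y X u) = annihilationAlg ξ u :=
  RightForm.extend_toCompletion _ _ _ _ _ u

lemma annihilation_tmul (ξ y : Y) (x : X.toHilbMod) :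
    annihilation ξ (HilbMod.tmul y x) = X.φ (Y.ip ξ y) x :=
  annihilation_tensorι ξ _

lemma ip_creation (ξ : Y) (x : X.toHilbMod) (z : HilbMod.tensor Y X) :
    (HilbMod.tensor Y X).ip (creation ξ x) z = X.toHilbMod.ip x (annihilation ξ z) := by
  refine (denseRange_tensorι Y X).induction_on (p := fun z =>
    (HilbMod.tensor Y X).ip (creation ξ x) z = X.toHilbMod.ip x (annihilation ξ z)) z
    (isClosed_eq ((HilbMod.tensor Y X).ipL _).continuous
      ((X.toHilbMod.ipL x).continuous.comp (annihilation ξ).continuous)) fun u => ?_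
  rw [annihilation_tensorι, ip_creation_tensorι]

lemma ip_annihilation (ξ : Y) (x : X.toHilbMod) (z : HilbMod.tensor Y X) :
    X.toHilbMod.ip (annihilation ξ z) x = (HilbMod.tensor Y X).ip z (creation ξ x) := by
  rw [← HilbMod.star_ip, ← ip_creation, HilbMod.star_ip]

lemma annihilation_act (ξ : Y) (z : HilbMod.tensor Y X) (a : A) :
    annihilation ξ ((HilbMod.tensor Y X).act z a) = X.toHilbMod.act (annihilation ξ z) a :=
  HilbMod.ext_ip fun x => by
    rw [← ip_creation, HilbMod.ip_act_right, HilbMod.ip_act_right, ← ip_creation]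

lemma creation_act (ξ : Y) (x : X.toHilbMod) (a : A) :
    creation ξ (X.toHilbMod.act x a) = (HilbMod.tensor Y X).act (creation ξ x) a :=
  HilbMod.ext_ip fun z => by
    rw [← ip_annihilation, HilbMod.ip_act_right, HilbMod.ip_act_right, ← ip_annihilation]

/-- The compression `K ↦ T_ξ* K T_η` from operators on `Y ⊗ X` to operators on `X`, where
`T_ξ` is the creation operator. -/
def compress (ξ η : Y) : Adj (HilbMod.tensor Y X) →L[ℂ] Adj X.toHilbMod :=
  LinearMap.mkContinuous
    { toFun := fun K => Adj.mk (annihilation ξ ∘L K.toL ∘L creation η)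
        (annihilation η ∘L (star K).toL ∘L creation ξ) fun x y => by
          change X.toHilbMod.ip (annihilation ξ (K (creation η x))) y =
            X.toHilbMod.ip x (annihilation η (star K (creation ξ y)))
          rw [ip_annihilation, Adj.ip_left, ip_creation]
      map_add' := fun K L => Adj.ext fun x =>
        (annihilation ξ).map_add (K (creation η x)) (L (creation η x))
      map_smul' := fun c K => Adj.ext fun x =>
        (annihilation ξ).map_smul c (K (creation η x)) }
    (‖annihilation (X := X) ξ‖ * ‖creation (X := X) η‖) fun K => by
      refine Adj.norm_le _ (by positivity) fun x => ?_
      change ‖annihilation ξ (K (creation η x))‖ ≤ _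
      calc _ ≤ ‖annihilation (X := X) ξ‖ * (‖K‖ * (‖creation (X := X) η‖ * ‖x‖)) := by
            refine (ContinuousLinearMap.le_opNorm _ _).trans ?_
            gcongr
            refine (Adj.norm_apply_le _ _).trans ?_
            gcongr
            exact ContinuousLinearMap.le_opNorm _ _
        _ = _ := by ring

lemma compress_apply (ξ η : Y) (K : Adj (HilbMod.tensor Y X)) (x : X.toHilbMod) :
    compress ξ η K x = annihilation ξ (K (creation η x)) := rfl

/-- The rank-one operator `θ_{p,q}` is compressed to `θ_{T_ξ* p, T_η* q}`; linearity and continuity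
do the rest. -/
lemma compress_mem_compacts (ξ η : Y) {K : Adj (HilbMod.tensor Y X)} (hK : K ∈ Adj.compacts _) :
    compress ξ η K ∈ Adj.compacts X.toHilbMod := by
  refine map_mem_closure (t := Adj.finiteRank X.toHilbMod) (compress ξ η).continuous hK
    fun K hK => ?_
  change compress ξ η K ∈ Adj.finiteRank X.toHilbMod
  induction hK using Submodule.span_induction with
  | mem K hK =>
    obtain ⟨p, rfl⟩ := hK
    refine Submodule.subset_span ⟨(annihilation ξ p.1, annihilation η p.2), ?_⟩
    ext x
    change _ = compress ξ η (Adj.theta p.1 p.2) x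
    rw [compress_apply, Adj.theta_apply, Adj.theta_apply, annihilation_act, ip_annihilation]
  | zero => rw [map_zero]; exact Submodule.zero_mem _
  | add S S' _ _ h h' => rw [map_add]; exact Submodule.add_mem _ h h'
  | smul c S _ h => rw [map_smul]; exact Submodule.smul_mem _ _ h

lemma compress_tensorOne (ξ η : Y) (T : Adj Y) :
    compress ξ η (tensorOne Y X T) = X.φ (Y.ip ξ (T η)) := by
  ext x
  rw [compress_apply, creation_apply, tensorOne_tmul, annihilation_tmul]

/-- If `T ⊗ 1` is compact, then `⟨ξ, T η⟩` acts on `X` by a compact operator. -/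
lemma φ_ip_mem_compacts {T : Adj Y} (hT : tensorOne Y X T ∈ Adj.compacts _) (ξ η : Y) :
    X.φ (Y.ip ξ (T η)) ∈ Adj.compacts X.toHilbMod := by
  rw [← compress_tensorOne]
  exact compress_mem_compacts ξ η hT

/-- One has `⟨ξ, T η⟩ b = ⟨ξ, T(η b)⟩` with `η b ∈ Y ker φ`. Together with `φ_ip_mem_compacts` this
puts the coefficients `⟨ξ, T η⟩` in `J_X`, where covariance can be applied. -/
lemma ip_apply_mul_eq_zero {T : Adj Y} (h : X.restrictI Y 1 T = 0) (ξ η : Y) {b : A}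
    (hb : X.φ b = 0) : Y.ip ξ (T η) * b = 0 := by
  have hmem : Y.act η b ∈ X.submI Y 1 := by
    refine (X.mem_submI_iff Y 1).2 fun x m hm hk => ?_
    obtain rfl : m = 1 := le_antisymm hk hm
    change X.φ _ = 0
    rw [Y.ip_act_right, map_mul, hb, mul_zero]
  have h1 : T (Y.act η b) = 0 :=
    congrArg (fun S : Adj (X.subI Y 1) => X.subIval Y 1 (S (X.subImk Y 1 _ hmem))) h
  rw [← Y.ip_act_right, ← Adj.map_act, h1, Y.ip_zero_right]

/-- Both sides have the same inner product with every elementary tensor, and vectors of length zero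
vanish in the completion. -/
lemma HilbMod.tmul_act (y : Y) (a : A) (x : X.toHilbMod) :
    HilbMod.tmul (Y.act y a) x = HilbMod.tmul y (X.φ a x) := by
  refine HilbMod.ext_ip fun z => ?_
  refine (denseRange_tensorι Y X).induction_on (p := fun z =>
    (HilbMod.tensor Y X).ip z (HilbMod.tmul (Y.act y a) x) =
      (HilbMod.tensor Y X).ip z (HilbMod.tmul y (X.φ a x))) z
    (isClosed_eq
      ((HilbMod.tensor Y X).continuous_ip.comp (continuous_id.prodMk continuous_const))
      ((HilbMod.tensor Y X).continuous_ip.comp (continuous_id.prodMk continuous_const)))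
    fun u => ?_
  induction u with
  | zero => rw [map_zero, HilbMod.ip_zero_left, HilbMod.ip_zero_left]
  | add v w hv hw => rw [map_add, HilbMod.ip_add_left, HilbMod.ip_add_left, hv, hw]
  | tmul y' x' =>
    refine (ip_tmul Y X y' _ x' _).trans ((?_ : _ = _).trans (ip_tmul Y X y' y x' _).symm)
    rw [Y.ip_act_right, map_mul, Adj.mul_apply]

/-- The operator `T_ξ K T_η*` on `Y ⊗ X`, for an operator `K` on `X`. -/
def inflate (ξ η : Y) : Adj X.toHilbMod →L[ℂ] Adj (HilbMod.tensor Y X) :=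
  LinearMap.mkContinuous
    { toFun := fun K => Adj.mk (creation ξ ∘L K.toL ∘L annihilation η)
        (creation η ∘L (star K).toL ∘L annihilation ξ) fun x y => by
          change (HilbMod.tensor Y X).ip (creation ξ (K (annihilation η x))) y =
            (HilbMod.tensor Y X).ip x (creation η (star K (annihilation ξ y)))
          rw [ip_creation, Adj.ip_left, ip_annihilation]
      map_add' := fun K L => Adj.ext fun x =>
        (creation ξ).map_add (K (annihilation η x)) (L (annihilation η x))
      map_smul' := fun c K => Adj.ext fun x =>
        (creation ξ).map_smul c (K (annihilation η x)) }
    (‖creation (X := X) ξ‖ * ‖annihilation (X := X) η‖) fun K => by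
      refine Adj.norm_le _ (by positivity) fun x => ?_
      change ‖creation ξ (K (annihilation η x))‖ ≤ _
      calc _ ≤ ‖creation (X := X) ξ‖ * (‖K‖ * (‖annihilation (X := X) η‖ * ‖x‖)) := by
            refine (ContinuousLinearMap.le_opNorm _ _).trans ?_
            gcongr
            refine (Adj.norm_apply_le _ _).trans ?_
            gcongr
            exact ContinuousLinearMap.le_opNorm _ _
        _ = _ := by ring

lemma inflate_apply (ξ η : Y) (K : Adj X.toHilbMod) (z : HilbMod.tensor Y X) :
    inflate ξ η K z = creation ξ (K (annihilation η z)) := rfl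

lemma inflate_theta (ξ η : Y) (x y : X.toHilbMod) :
    inflate ξ η (Adj.theta x y) = Adj.theta (HilbMod.tmul ξ x) (HilbMod.tmul η y) := by
  ext z
  rw [inflate_apply, Adj.theta_apply, Adj.theta_apply, creation_act, ← ip_creation]
  rfl

/-- This links the two levels: `θ_{ξ a, η} ⊗ 1` factors through the operator `φ(a)` on `X`. If
`φ(a)` is compact, it is thereby a limit of combinations of the rank-one operators in
`inflate_theta`. -/
lemma inflate_φ (ξ η : Y) (a : A) :
    inflate ξ η (X.φ a) = tensorOne Y X (Adj.theta (Y.act ξ a) η) := by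
  refine Adj.toL_injective <| Adj.ext_tmul fun y x => ?_
  change inflate ξ η (X.φ a) (HilbMod.tmul y x) =
    tensorOne Y X (Adj.theta (Y.act ξ a) η) (HilbMod.tmul y x)
  rw [inflate_apply, annihilation_tmul, creation_apply, tensorOne_tmul, Adj.theta_apply,
    HilbMod.tmul_act, HilbMod.tmul_act]

end Tensor

end CuntzPimsner

/-! ### Images of compact operators under a covariant representation -/

namespace CuntzPimsner

variable {A : Type u} [NonUnitalCStarAlgebra A] [PartialOrder A] [StarOrderedRing A]
variable {B : Type v} [NonUnitalCStarAlgebra B]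

open Filter Topology

lemma continuous_starHom {E F : Type*} [NonUnitalCStarAlgebra E] [NonUnitalCStarAlgebra F]
    (f : E →⋆ₙₐ[ℂ] F) : Continuous f :=
  AddMonoidHomClass.continuous_of_bound f 1 fun a => by
    rw [one_mul]; exact NonUnitalStarAlgHom.norm_apply_le f a

/-- A closed subspace of `𝒦(Y)` which contains the rank-one operators is everything. -/
lemma Cpt.mem_of_theta_mem {Y : HilbMod A} {M : Submodule ℂ (Cpt Y)}
    (hM : IsClosed (M : Set (Cpt Y))) (h : ∀ x y, Cpt.theta x y ∈ M) (S : Cpt Y) : S ∈ M := by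
  have hfin : ∀ T (hT : T ∈ Adj.finiteRank Y),
      Cpt.mk T (Submodule.le_topologicalClosure _ hT) ∈ M := by
    intro T hT
    induction hT using Submodule.span_induction with
    | mem T hT =>
      obtain ⟨p, rfl⟩ := hT
      exact h p.1 p.2
    | zero => exact M.zero_mem
    | add _ _ _ _ h h' => exact M.add_mem h h'
    | smul c _ _ h => exact M.smul_mem c h
  refine hM.closure_subset (Metric.mem_closure_iff.2 fun ε hε => ?_)
  obtain ⟨w, hw, hw'⟩ := Metric.mem_closure_iff.1 (show S.op ∈ closure (Adj.finiteRank Y : Set _)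
    from S.op_mem) ε hε
  exact ⟨_, hfin w hw, hw'⟩

section Covariance

variable {Y : HilbMod A} (π : A →⋆ₙₐ[ℂ] B) (s : Y →L[ℂ] B)

/-- The relation holds on the graph and is closed, so it holds on the closure of the graph. -/
lemma covHom_mul_apply (hs : ∀ x y, star (s x) * s y = π (Y.ip x y)) (S : Cpt Y) (x : Y) :
    covHom π s hs S * s x = s (S.op x) := by
  refine closure_minimal (s := (covGraph s : Set (Adj Y × B)))
    (t := {z | z.2 * s x = s (z.1 x)}) (fun z hz => covGraph_mul_apply π s hs hz x)
    (isClosed_eq (by fun_prop) ?_) (mem_covClosure_covFun π s hs S)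
  exact s.continuous.comp ((ContinuousLinearMap.apply ℂ Y x).continuous.comp
    (Adj.isometry_toL.continuous.comp continuous_fst))

/-- Here `z` only has to act as a multiplier. The lemma is meant for `z = (ι_p^r(S), t^{(p)}(S))`,
whose first entry need not be compact. -/
lemma mul_mem_covClosure_of {z : Adj Y × B} (hz : ∀ x, z.2 * s x = s (z.1 x)) {w : Adj Y × B}
    (hw : w ∈ covClosure s) : z * w ∈ covClosure s :=
  map_mem_closure (f := fun w : Adj Y × B => z * w) (by fun_prop) hw
    fun _ h => mul_mem_covGraph_of s hz h

/-- If `π` is injective then `s` is isometric. -/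
lemma norm_eq_of_injective (hπ : Function.Injective π)
    (hs : ∀ x y, star (s x) * s y = π (Y.ip x y)) (x : Y) : ‖s x‖ = ‖x‖ := by
  have h : ‖s x‖ ^ 2 = ‖x‖ ^ 2 := by
    rw [HilbMod.norm_sq, pow_two, ← CStarRing.norm_star_mul_self, hs]
    exact NonUnitalStarAlgHom.norm_map π hπ _
  exact (pow_left_inj₀ (norm_nonneg _) (norm_nonneg _) two_ne_zero).1 h

end Covariance

namespace Representation

variable {X : HilbBimod A} (ρ : Representation X B)

/-- The map `t^{(1)}`, on `𝒦(X)`. -/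
def tOne : Cpt X.toHilbMod →⋆ₙₐ[ℂ] B := ρ.tCpt 1

lemma tOne_theta (x y : X.toHilbMod) : ρ.tOne (Cpt.theta x y) = ρ.t x * star (ρ.t y) :=
  ρ.tCpt_theta 1 x y

variable {ρ} in
lemma tOne_φ (hρ : ρ.IsCuntzPimsner) {j : A} (hj : X.φ j ∈ Adj.compacts X.toHilbMod)
    (hj' : ∀ b, X.φ b = 0 → j * b = 0) : ρ.tOne (Cpt.mk (X.φ j) hj) = ρ.π j :=
  (hρ j hj hj').symm

section Step

variable {Y : HilbMod A} (s : Y →L[ℂ] B) (hs : ∀ x y, star (s x) * s y = ρ.π (Y.ip x y))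

/-- For `k = θ_{x,y}` the pair is the generator of the graph belonging to `ξ ⊗ x` and `η ⊗ y`. Both
entries are linear and continuous in `k`. -/
lemma inflate_mem_covClosure (ξ η : Y) (k : Cpt X.toHilbMod) :
    (inflate ξ η k.op, s ξ * ρ.tOne k * star (s η)) ∈ covClosure (ρ.step s hs) := by
  let L : Cpt X.toHilbMod →ₗ[ℂ] Adj (HilbMod.tensor Y X) × B :=
    { toFun := fun k => (inflate ξ η k.op, s ξ * ρ.tOne k * star (s η))
      map_add' := fun k l => Prod.ext (map_add (inflate ξ η) k.op l.op) (by
        simp only [map_add, mul_add, add_mul]; rfl)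
      map_smul' := fun c k => Prod.ext (map_smul (inflate ξ η) c k.op) (by
        simp only [map_smul, mul_smul_comm, smul_mul_assoc]; rfl) }
  have hL : Continuous L := by
    have h1 : Continuous fun k : Cpt X.toHilbMod => k.op := continuous_starHom Cpt.incl
    have h2 : Continuous fun k : Cpt X.toHilbMod => ρ.tOne k := continuous_starHom ρ.tOne
    exact ((inflate ξ η).continuous.comp h1).prodMk
      ((continuous_const.mul h2).mul continuous_const)
  refine Cpt.mem_of_theta_mem (M := (covClosure (ρ.step s hs)).comap L)
    ((Submodule.isClosed_topologicalClosure _).preimage hL) (fun x y => ?_) k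
  change (inflate ξ η (Adj.theta x y), s ξ * ρ.tOne (Cpt.theta x y) * star (s η)) ∈
    covClosure (ρ.step s hs)
  have e : s ξ * ρ.tOne (Cpt.theta x y) * star (s η) =
      ρ.step s hs (HilbMod.tmul ξ x) * star (ρ.step s hs (HilbMod.tmul η y)) := by
    rw [tOne_theta, step_tmul, step_tmul, star_mul]
    simp only [mul_assoc]
  rw [inflate_theta, e]
  exact Submodule.le_topologicalClosure _ (theta_mem_covGraph _ _ _)

-- Take `k = φ(j)` in `inflate_mem_covClosure`. Covariance replaces `t^{(1)}(φ(j))` by `π(j)`, which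
-- `s(ξ)` absorbs, while `T_ξ φ(j) T_η*` becomes `θ_{ξ j, η} ⊗ 1`. This is how covariance enters for
-- a general module `Y`.
variable {ρ} in
lemma tensorOne_theta_mem_covClosure (hρ : ρ.IsCuntzPimsner) (ξ η : Y) {j : A}
    (hj : X.φ j ∈ Adj.compacts X.toHilbMod) (hj' : ∀ b, X.φ b = 0 → j * b = 0) :
    (tensorOne Y X (Adj.theta (Y.act ξ j) η), s (Y.act ξ j) * star (s η)) ∈
      covClosure (ρ.step s hs) := by
  have h := ρ.inflate_mem_covClosure s hs ξ η (Cpt.mk (X.φ j) hj)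
  rwa [tOne_φ hρ hj hj', ← map_act_of ρ.π s hs, Cpt.op_mk, inflate_φ] at h

variable {ρ} in
/-- Covariance for operators on `Y`: if `T` vanishes on `Y ker φ` and `T ⊗ 1` is compact, then
the images of `T` and of `T ⊗ 1` agree. -/
lemma covHom_eq_covHom_step (hρ : ρ.IsCuntzPimsner) {T : Cpt Y} (h : X.restrictI Y 1 T.op = 0)
    (hT : tensorOne Y X T.op ∈ Adj.compacts (HilbMod.tensor Y X)) :
    covHom ρ.π (ρ.step s hs) (ρ.star_step_mul s hs) (Cpt.mk (tensorOne Y X T.op) hT) =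
      covHom ρ.π s hs T := by
  refine covFun_eq ρ.π (ρ.step s hs) (ρ.star_step_mul s hs) ?_
  let L : Cpt Y →ₗ[ℂ] Adj (HilbMod.tensor Y X) × B :=
    { toFun := fun k => (tensorOne Y X k.op, covHom ρ.π s hs k)
      map_add' := fun k l => Prod.ext (map_add (tensorOne Y X) k.op l.op)
        (map_add (covHom ρ.π s hs) k l)
      map_smul' := fun c k => Prod.ext (map_smul (tensorOne Y X) c k.op)
        (map_smul (covHom ρ.π s hs) c k) }
  have hL : Continuous L := by
    have h1 : Continuous fun k : Cpt Y => k.op := continuous_starHom Cpt.incl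
    exact ((continuous_starHom (tensorOne Y X).toNonUnitalStarAlgHom).comp h1).prodMk
      (continuous_starHom _)
  -- `N` consists of those `k` for which `k ⊗ 1` and the image of `k` are paired in the graph
  -- closure over `Y ⊗_φ X`. It is a closed subspace, and the claim is `T ∈ N`.
  let N : Submodule ℂ (Cpt Y) := (covClosure (ρ.step s hs)).comap L
  have hN : IsClosed (N : Set (Cpt Y)) :=
    (Submodule.isClosed_topologicalClosure _).preimage hL
  -- Between rank-one operators, `T` becomes `θ_{x j, y'}` with `j = ⟨y, T x'⟩ ∈ J_X`.
  have h1 : ∀ x y x' y' : Y, Cpt.theta x y * T * Cpt.theta x' y' ∈ N := fun x y x' y' => by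
    have e : Cpt.theta x y * T * Cpt.theta x' y' =
        Cpt.theta (Y.act x (Y.ip y (T.op x'))) y' := by
      refine Cpt.op_injective ?_
      change Adj.theta x y * T.op * Adj.theta x' y' = Adj.theta _ _
      rw [mul_assoc, Adj.mul_theta, Adj.mul_theta, Adj.theta_apply]
    rw [e]
    change (tensorOne Y X (Adj.theta _ _), covHom ρ.π s hs (Cpt.theta _ _)) ∈
      covClosure (ρ.step s hs)
    rw [covHom_theta]
    exact tensorOne_theta_mem_covClosure s hs hρ _ _ (φ_ip_mem_compacts hT _ _)
      fun b hb => ip_apply_mul_eq_zero h _ _ hb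
  -- By density the rank-one factors are replaced by arbitrary compact ones, on the left and then on
  -- the right; an approximate unit finally removes them.
  have h2 : ∀ (R : Cpt Y) (x' y' : Y), R * T * Cpt.theta x' y' ∈ N := fun R x' y' => by
    refine Cpt.mem_of_theta_mem
      (M := N.comap (LinearMap.mulRight ℂ (T * Cpt.theta x' y'))) (hN.preimage ?_) (fun x y => ?_) R
      |> fun h => by simpa [mul_assoc] using! h
    · exact continuous_id.mul continuous_const
    · simpa [mul_assoc] using! h1 x y x' y'
  have h3 : ∀ R S : Cpt Y, R * T * S ∈ N := fun R S => by
    refine Cpt.mem_of_theta_mem (M := N.comap (LinearMap.mulLeft ℂ (R * T))) (hN.preimage ?_)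
      (fun x y => h2 R x y) S
    exact continuous_const.mul continuous_id
  obtain ⟨l, hl, hl1, hl2, -⟩ := Cpt.exists_approximateUnit Y
  have h4 : ∀ S : Cpt Y, T * S ∈ N := fun S =>
    hN.mem_of_tendsto ((hl1 T).mul_const S) (Eventually.of_forall fun u => h3 u S)
  exact hN.mem_of_tendsto (hl2 T) (Eventually.of_forall h4)

/-- Left multiplication by `b` intertwines `ρ.step s` with `T ⊗ 1` if it intertwines `s` with
`T`. -/
lemma mul_step_eq {b : B} {T : Adj Y} (h : ∀ y, b * s y = s (T y)) (z : HilbMod.tensor Y X) :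
    b * ρ.step s hs z = ρ.step s hs (tensorOne Y X T z) := by
  have e : (ContinuousLinearMap.mul ℂ B b).comp (ρ.step s hs) =
      (ρ.step s hs).comp (tensorOne Y X T).toL := by
    refine ContinuousLinearMap.ext fun z => ?_
    refine (denseRange_tensorι Y X).induction_on (p := fun z =>
      b * ρ.step s hs z = ρ.step s hs ((tensorOne Y X T).toL z)) z
      (isClosed_eq (by fun_prop) (by fun_prop)) fun u => ?_
    induction u with
    | zero => simp
    | add v w hv hw => simp only [map_add, mul_add, hv, hw]
    | tmul y x =>
      have h1 : (tensorOne Y X T).toL (tensorι Y X (y ⊗ₜ x)) = HilbMod.tmul (T y) x :=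
        tensorOne_tmul Y X T y x
      rw [h1, step_tmul, ← h, mul_assoc]
      exact congrArg (b * ·) (ρ.step_tmul s hs y x)
  exact DFunLike.congr_fun e z

end Step

/-- Under `𝒦(A) = A` the operator `θ_{a,b}` is `a b*`, and `π(a b*) = π(a) π(b)*`. By linearity and
continuity this decides all compact operators. -/
lemma tCpt_zero (S : Cpt (X.pow 0)) : ρ.tCpt 0 S = ρ.π (HilbMod.compactsToAlg S) := by
  let L : Cpt (X.pow 0) →ₗ[ℂ] B := ((ρ.tCpt 0 : Cpt (X.pow 0) →ₗ[ℂ] B)) -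
    ((ρ.π.comp HilbMod.compactsToAlg : Cpt (X.pow 0) →⋆ₙₐ[ℂ] B) : Cpt (X.pow 0) →ₗ[ℂ] B)
  have hL : Continuous L := (continuous_starHom (ρ.tCpt 0)).sub
    (continuous_starHom (ρ.π.comp HilbMod.compactsToAlg))
  have h : S ∈ LinearMap.ker L := by
    refine Cpt.mem_of_theta_mem ((isClosed_singleton (x := (0 : B))).preimage hL)
      (fun x y => ?_) S
    have e : HilbMod.compactsToAlg (Cpt.theta (Y := HilbMod.self A) x y) =
        HilbMod.toAlg x * star (HilbMod.toAlg y) :=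
      HilbMod.leftMul_injective <| by
        rw [HilbMod.leftMul_compactsToAlg, HilbMod.leftMul_mul_star]; rfl
    change ρ.tCpt 0 (Cpt.theta x y) - ρ.π (HilbMod.compactsToAlg (Cpt.theta x y)) = 0
    rw [sub_eq_zero]
    refine (ρ.tCpt_theta 0 x y).trans (Eq.trans ?_ (congrArg ρ.π e).symm)
    rw [map_mul, map_star]; rfl
  exact sub_eq_zero.1 h

/-- Induction on `q`: from degree `q ≥ 1` to `q + 1` a factor `t(ξ)` is appended on the right, so
`ι_p^q(S)` is replaced by `ι_p^q(S) ⊗ 1`. From degree `0` to `1` it is the relation `π(a) t(ξ) =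
t(φ(a) ξ)`. -/
lemma tCpt_mul_tPow {p q : ℕ} (h : p ≤ q) (S : Cpt (X.pow p)) (η : X.pow q) :
    ρ.tCpt p S * ρ.tPow q η = ρ.tPow q (X.iota h S η) := by
  induction q, h using Nat.le_induction with
  | base =>
    rw [X.iota_self]
    exact covHom_mul_apply _ _ _ S η
  | succ q hq ih =>
    cases q with
    | zero =>
      obtain rfl : p = 0 := Nat.le_zero.1 hq
      rw [tCpt_zero]
      exact ρ.π_mul_t _ η
    | succ q =>
      rw [X.iota_succ hq]
      exact ρ.mul_step_eq (ρ.tPow (q + 1)) (ρ.star_tPow_mul (q + 1)) ih η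

/-- By `tCpt_mul_tPow` the pair `(ι_p^r(S), t^{(p)}(S))` is a multiplier of the graph closure in
degree `r`. The rule mirrors `itilde_mul`, and so makes `κ_n` multiplicative. -/
lemma tCpt_mul_tCpt {p r : ℕ} (h : p ≤ r) (S : Cpt (X.pow p)) (T : Cpt (X.pow r)) :
    ρ.tCpt p S * ρ.tCpt r T =
      ρ.tCpt r (Cpt.mk (X.iota h S * T.op) (Adj.mul_mem_compacts _ T.op_mem)) :=
  (covFun_eq ρ.π (ρ.tPow r) (ρ.star_tPow_mul r)
    (S := Cpt.mk (X.iota h S * T.op) (Adj.mul_mem_compacts _ T.op_mem))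
    (mul_mem_covClosure_of (ρ.tPow r) (z := (X.iota h S, ρ.tCpt p S))
    (ρ.tCpt_mul_tPow h S) (mem_covClosure_covFun ρ.π (ρ.tPow r) (ρ.star_tPow_mul r) T))).symm

end Representation

end CuntzPimsner

/-! ### The algebras `C_n`: vanishing criterion, injective connecting maps, completeness -/

namespace CuntzPimsner

variable {A : Type u} [NonUnitalCStarAlgebra A] [PartialOrder A] [StarOrderedRing A]
variable {B : Type v} [NonUnitalCStarAlgebra B]

open Filter Topology

namespace HilbBimod

variable {X : HilbBimod A}

/-- Since `φ_{m+1}(a) = φ_m(a) ⊗ 1` for `m ≥ 1`, the kernels increase with `m`; hence `I_k = ker φ`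
for every `k ≥ 1`. -/
lemma leftAct_eq_zero {a : A} (ha : X.φ a = 0) : ∀ {m : ℕ}, 0 < m → X.leftAct m a = 0
  | 0, h => absurd h (lt_irrefl 0)
  | 1, _ => ha
  | m + 2, _ => by
    change tensorOne (X.pow (m + 1)) X (X.leftAct (m + 1) a) = 0
    rw [leftAct_eq_zero ha m.succ_pos, map_zero]

/-- Thus only two submodules occur: `Y I_0 = Y`, and `Y I_k = Y ker φ` for `k ≥ 1`. -/
lemma mem_submI_of_one {Y : HilbMod A} {k : ℕ} {x : Y} (hx : x ∈ X.submI Y 1) :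
    x ∈ X.submI Y k :=
  fun _ hm _ => leftAct_eq_zero (hx 1 one_pos le_rfl) hm

lemma mem_submI_one_iff {Y : HilbMod A} {x : Y} :
    x ∈ X.submI Y 1 ↔ ∀ y, X.φ (Y.ip y x) = 0 := by
  rw [mem_submI_iff]
  refine ⟨fun h y => h y 1 one_pos le_rfl, fun h y m hm hk => ?_⟩
  obtain rfl : m = 1 := le_antisymm hk hm
  exact h y

lemma restrictI_eq_zero_iff {Y : HilbMod A} {k : ℕ} {T : Adj Y} :
    X.restrictI Y k T = 0 ↔ ∀ x ∈ X.submI Y k, T x = 0 := by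
  refine ⟨fun h x hx => ?_, fun h => ?_⟩
  · exact congrArg (fun S : Adj (X.subI Y k) => X.subIval Y k (S (X.subImk Y k x hx))) h
  · ext x
    exact Subtype.ext (h _ x.2)

lemma restrictI_one_eq_zero {Y : HilbMod A} {k : ℕ} {T : Adj Y} (h : X.restrictI Y k T = 0) :
    X.restrictI Y 1 T = 0 := by
  rw [restrictI_eq_zero_iff] at h ⊢
  exact fun x hx => h x (mem_submI_of_one hx)

lemma eq_zero_of_restrictI_zero {Y : HilbMod A} {T : Adj Y} (h : X.restrictI Y 0 T = 0) :
    T = 0 := by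
  rw [restrictI_eq_zero_iff] at h
  exact Adj.ext fun x => h x (X.mem_submI_zero Y x)

-- Terms with `p > q` contribute nothing in degree `q`, so all upper limits `≥ q` give the same
-- operator `T_q = X.tot q q S`.
variable (X) in
lemma tot_eq_tot {n m q : ℕ} (hn : q ≤ n) (hm : q ≤ m) (S : ∀ p, Cpt (X.pow p)) :
    X.tot n q S = X.tot m q S := by
  have key : ∀ n, q ≤ n → X.tot n q S = X.tot q q S := fun n hn => by
    refine (Finset.sum_subset (Finset.range_mono (Nat.succ_le_succ hn)) fun p _ hp => ?_).symm
    rw [dif_neg fun h => hp (Finset.mem_range_succ_iff.2 h)]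
  rw [key n hn, key m hm]

variable (X) in
lemma tot_self_succ (n : ℕ) (S : ∀ p, Cpt (X.pow p)) :
    X.tot (n + 1) (n + 1) S = X.tot n (n + 1) S + (S (n + 1)).op := by
  rw [tot, Finset.sum_range_succ, dif_pos le_rfl, iota_self]
  rfl

variable (X) in
lemma tot_zero_zero (S : ∀ p, Cpt (X.pow p)) : X.tot 0 0 S = (S 0).op := by
  rw [tot, zero_add, Finset.sum_range_one, dif_pos le_rfl, iota_self]

-- The passage from degree `0` to degree `1` is exceptional: `L_a` continues to `φ(a)` on `X`, not
-- to `L_a ⊗ 1` on `A ⊗_φ X`. This is why the case `n = 0` is treated separately below.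
variable (X) in
lemma tot_zero_one (S : ∀ p, Cpt (X.pow p)) :
    X.tot 0 1 S = X.φ (HilbMod.compactsToAlg (S 0)) := by
  rw [tot, zero_add, Finset.sum_range_one, dif_pos zero_le_one]
  rfl

/-- As a vector of the module `A`, `b` lies in `A ker φ`, because `⟨y, b⟩ = y* b`. This yields the
annihilator condition in `J_X` in degree zero. -/
lemma mul_eq_zero_of_restrictI {a : A} (h : X.restrictI (HilbMod.self A) 1 (HilbMod.leftMul a) = 0)
    {b : A} (hb : X.φ b = 0) : a * b = 0 := by
  refine restrictI_eq_zero_iff.1 h (HilbMod.ofAlg b) (mem_submI_one_iff.2 fun y => ?_)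
  change X.φ (star (HilbMod.toAlg y) * b) = 0
  rw [map_mul, hb, mul_zero]

/-- An element of `𝒦(A) = A` which acts as zero both on `ker φ` and on `X` is zero. -/
lemma leftMul_eq_zero_of_restrictI {a : A}
    (h : X.restrictI (HilbMod.self A) 1 (HilbMod.leftMul a) = 0) (ha : X.φ a = 0) :
    HilbMod.leftMul a = 0 := by
  refine Adj.eq_zero_of_restrictI (X := X) h fun x y => ?_
  change X.φ (star (HilbMod.toAlg x) * (a * HilbMod.toAlg y)) = 0
  rw [map_mul, map_mul, ha, zero_mul, mul_zero]

/-- The restriction to `X^{⊗n} ker φ` and the continuation to degree `n + 1` together determine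
`T_n`: for `n ≥ 1` by the injectivity behind `restrictTensor`, for `n = 0` by the same argument with
`φ` in place of `T ↦ T ⊗ 1`. -/
lemma tot_eq_zero_of_tot_succ_eq_zero {n : ℕ} {S : ∀ p, Cpt (X.pow p)}
    (h : X.restrictI (X.pow n) 1 (X.tot n n S) = 0) (h' : X.tot n (n + 1) S = 0) :
    X.tot n n S = 0 := by
  cases n with
  | zero =>
    rw [tot_zero_one] at h'
    rw [tot_zero_zero] at h ⊢
    have e : HilbMod.leftMul (HilbMod.compactsToAlg (S 0)) = (S 0).op :=
      HilbMod.leftMul_compactsToAlg (S 0)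
    exact e.symm.trans (leftMul_eq_zero_of_restrictI (e.symm ▸ h) h')
  | succ n =>
    rw [X.tot_succ le_rfl] at h'
    exact Adj.eq_zero_of_restrictI h (φ_ip_eq_zero_of_tensorOne h')

lemma sumC_eq_zero_iff {n m : ℕ} {S : ∀ p, Cpt (X.pow p)} :
    X.sumC n m S = 0 ↔ ∀ q ≤ m, X.restrictI (X.pow q) (m - q) (X.tot n q S) = 0 := by
  refine ⟨fun h q hq => ?_, fun h => funext fun q => ?_⟩
  · have := congrArg (fun x : X.D m => x ⟨q, Nat.lt_succ_of_le hq⟩) h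
    rw [sumC_apply] at this
    exact this
  · rw [sumC_apply]
    exact h q (Nat.le_of_lt_succ q.2)

/-- The component in degree `q < n` is a restriction to `X^{⊗q} ker φ`, because `n - q ≥ 1`; the
component in degree `n` is unrestricted, because `I_0 = A`. Both well-definedness and injectivity of
`κ_n` use this form. -/
lemma sumC_self_eq_zero_iff {n : ℕ} {S : ∀ p, Cpt (X.pow p)} :
    X.sumC n n S = 0 ↔
      (∀ q < n, X.restrictI (X.pow q) 1 (X.tot q q S) = 0) ∧ X.tot n n S = 0 := by
  rw [sumC_eq_zero_iff]
  refine ⟨fun h => ⟨fun q hq => ?_, ?_⟩, fun h q hq => ?_⟩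
  · have := restrictI_one_eq_zero (h q hq.le)
    rwa [X.tot_eq_tot hq.le le_rfl] at this
  · have := h n le_rfl
    rw [Nat.sub_self] at this
    exact eq_zero_of_restrictI_zero this
  · rcases hq.eq_or_lt with rfl | hq
    · rw [h.2, map_zero]
    · rw [X.tot_eq_tot hq.le le_rfl, restrictI_eq_zero_iff]
      intro x hx
      exact restrictI_eq_zero_iff.1 (h.1 q hq) x (X.submI_anti _ (by omega) hx)

/-- The connecting maps are injective. -/
lemma C.map_succ_injective (n : ℕ) :
    Function.Injective (C.map (Nat.le_succ n) : X.C n →⋆ₙₐ[ℂ] X.C (n + 1)) := by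
  rw [injective_iff_map_eq_zero]
  intro x hx
  obtain ⟨S, rfl⟩ := C.exists_eq_mk x
  have h1 : X.sumC n (n + 1) S = 0 :=
    (C.val_map_mk (Nat.le_succ n) S).symm.trans (congrArg C.val hx)
  rw [sumC_eq_zero_iff] at h1
  refine C.val_injective ((C.val_mk' n S).trans ?_)
  -- In `C_{n+1}` the degree-`n` component only sees `X^{⊗n} ker φ`; what is lost by this
  -- restriction is recovered from degree `n + 1`.
  have h2 : ∀ q ≤ n, X.restrictI (X.pow q) 1 (X.tot q q S) = 0 := fun q hq => by
    have := restrictI_one_eq_zero (h1 q (hq.trans (Nat.le_succ n)))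
    rwa [X.tot_eq_tot hq le_rfl] at this
  refine sumC_self_eq_zero_iff.2 ⟨fun q hq => h2 q hq.le,
    tot_eq_zero_of_tot_succ_eq_zero (h2 n le_rfl) ?_⟩
  have := h1 (n + 1) le_rfl
  rw [Nat.sub_self] at this
  exact eq_zero_of_restrictI_zero this

lemma C.map_mk_eq {n m : ℕ} (h : n ≤ m) (S : ∀ p, Cpt (X.pow p)) :
    C.map h (C.mk n S) = C.mk m fun p => if p ≤ n then S p else 0 := by
  refine C.val_injective ((C.val_map_mk h S).trans ((C.val_mk m _).trans ?_).symm)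
  have h1 := Finset.sum_subset (Finset.range_mono (Nat.succ_le_succ h))
    (f := fun p => X.itilde m p (if p ≤ n then S p else 0)) fun p _ hp => by
      rw [if_neg fun h => hp (Finset.mem_range_succ_iff.2 h), map_zero]
  rw [← h1]
  exact Finset.sum_congr rfl fun p hp => by rw [if_pos (Finset.mem_range_succ_iff.1 hp)]

-- The last component carries no restriction, as `I_0 = A`, and `ι_n^n(S) = S`.
variable (X) in
lemma itilde_self_injective (n : ℕ) : Function.Injective (X.itilde n n) := by
  rw [injective_iff_map_eq_zero]
  intro S hS
  have h1 : X.itildeComp n n (n - n) S = 0 := congrArg (fun x : X.D n => x (Fin.last n)) hS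
  rw [itildeComp, dif_pos le_rfl, Nat.sub_self] at h1
  have h2 := eq_zero_of_restrictI_zero (T := X.iota (le_refl n) S) h1
  rw [iota_self] at h2
  exact Cpt.op_injective h2

/-- The inclusion of `C_n` as a `*`-homomorphism. -/
def C.valHom (X : HilbBimod A) (n : ℕ) : X.C n →⋆ₙₐ[ℂ] X.D n :=
  NonUnitalStarSubalgebraClass.subtype (X.cSub n)

/-- `C_{n+1}` is the sum of the image of `C_n` and of `ι̃(𝒦(X^{⊗(n+1)}))`. Both are images of
`C*`-algebras under injective `*`-homomorphisms, hence closed, where the induction hypothesis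
supplies completeness of `C_n`. By `itilde_mul` the second absorbs products with the first. -/
lemma isClosed_cSub_succ {n : ℕ} (h : IsClosed (X.cSub n : Set (X.D n))) :
    IsClosed (X.cSub (n + 1) : Set (X.D (n + 1))) := by
  have : CompleteSpace (X.C n) := h.completeSpace_coe
  let _ : NonUnitalCStarAlgebra (X.C n) := {}
  let f : X.C n →⋆ₙₐ[ℂ] X.D (n + 1) := (C.valHom X (n + 1)).comp (C.map (Nat.le_succ n))
  have hf : Function.Injective f :=
    (C.val_injective (X := X) (n := n + 1)).comp (C.map_succ_injective n)
  let R : NonUnitalStarSubalgebra ℂ (X.D (n + 1)) := NonUnitalStarAlgHom.range f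
  let I : NonUnitalStarSubalgebra ℂ (X.D (n + 1)) :=
    NonUnitalStarAlgHom.range (X.itilde (n + 1) (n + 1))
  have hR : IsClosed (R : Set (X.D (n + 1))) := by
    have := (NonUnitalStarAlgHom.isometry f hf).isClosedEmbedding.isClosed_range
    simpa [R] using! this
  have hI : IsClosed (I : Set (X.D (n + 1))) := by
    have := (NonUnitalStarAlgHom.isometry _ (X.itilde_self_injective
      (n + 1))).isClosedEmbedding.isClosed_range
    simpa [I] using! this
  have hfS : ∀ S, f (C.mk n S) = X.sumC n (n + 1) S := fun S => C.val_map_mk (Nat.le_succ n) S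
  have hRI : ∀ r ∈ R, ∀ i ∈ I, r * i ∈ I := by
    rintro _ ⟨x, rfl⟩ _ ⟨T, rfl⟩
    obtain ⟨S, rfl⟩ := C.exists_eq_mk x
    change f (C.mk n S) * X.itilde (n + 1) (n + 1) T ∈ I
    rw [hfS, sumC, Finset.sum_mul]
    refine sum_mem fun p hp => ?_
    rw [X.itilde_mul ((Finset.mem_range_succ_iff.1 hp).trans (Nat.le_succ n))]
    exact ⟨_, rfl⟩
  have e : (X.cSub (n + 1) : Set (X.D (n + 1))) = {x | ∃ r ∈ R, ∃ i ∈ I, x = r + i} := by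
    ext x
    constructor
    · rintro ⟨S, rfl⟩
      refine ⟨_, ⟨C.mk n S, rfl⟩, _, ⟨S (n + 1), rfl⟩, ?_⟩
      rw [Finset.sum_range_succ]
      exact congrArg (· + _) (hfS S).symm
    · rintro ⟨_, ⟨x, rfl⟩, _, ⟨T, rfl⟩, rfl⟩
      refine add_mem (Subtype.property (p := (· ∈ X.cSub (n + 1))) (C.map (Nat.le_succ n) x)) ?_
      refine ⟨Pi.single (n + 1) T, ?_⟩
      rw [Finset.sum_range_succ, Pi.single_eq_same, Finset.sum_eq_zero, zero_add]
      · rfl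
      · intro p hp
        rw [Pi.single_eq_of_ne (Finset.mem_range.1 hp).ne, map_zero]
  rw [e]
  exact isClosed_add_ideal R hR I hI hRI

variable (X) in
lemma isClosed_cSub : ∀ n, IsClosed (X.cSub n : Set (X.D n))
  | 0 => by
    have e : (X.cSub 0 : Set (X.D 0)) = Set.range (X.itilde 0 0) := by
      ext x
      constructor
      · rintro ⟨S, rfl⟩
        exact ⟨S 0, by rw [zero_add, Finset.sum_range_one]⟩
      · rintro ⟨T, rfl⟩
        exact ⟨Pi.single 0 T, by rw [zero_add, Finset.sum_range_one, Pi.single_eq_same]⟩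
    rw [e]
    exact (NonUnitalStarAlgHom.isometry _
      (X.itilde_self_injective 0)).isClosedEmbedding.isClosed_range
  | n + 1 => isClosed_cSub_succ (isClosed_cSub n)

/-- Completeness makes `*`-homomorphisms from `C_n` into `C*`-algebras contractive, and isometric
when they are injective. -/
instance (n : ℕ) : CompleteSpace (X.C n) := (X.isClosed_cSub n).completeSpace_coe

instance (n : ℕ) : NonUnitalCStarAlgebra (X.C n) where

end HilbBimod

/-! ### The relation between `∑ t^{(p)}(S_p)` and the operators `T_q` -/

namespace Representation

variable {X : HilbBimod A} (ρ : Representation X B)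

lemma tCpt_mem_core {n : ℕ} (S : Cpt (X.pow n)) : ρ.tCpt n S ∈ ρ.core := by
  refine Cpt.mem_of_theta_mem (M := ρ.core.comap (ρ.tCpt n : Cpt (X.pow n) →ₗ[ℂ] B))
    ((Submodule.isClosed_topologicalClosure _).preimage (continuous_starHom (ρ.tCpt n)))
    (fun x y => ?_) S
  refine Submodule.le_topologicalClosure _ (Submodule.subset_span ⟨n, x, y, ?_⟩)
  exact ρ.tCpt_theta n x y

-- For `n ≥ 1` the operator in degree `n + 1` is `T_n ⊗ 1`, and `mem_compacts_of_tensorOne` and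
-- `covHom_eq_covHom_step` apply. For `n = 0` and `T_0 = L_a` it is `φ(a)`; the hypotheses then say
-- that `a ∈ J_X`, and the claim is covariance itself.
variable {ρ} in
lemma exists_tCpt_tot_eq (hρ : ρ.IsCuntzPimsner) {n : ℕ} {S : ∀ p, Cpt (X.pow p)}
    (h : X.restrictI (X.pow n) 1 (X.tot n n S) = 0)
    (hc : X.tot n (n + 1) S ∈ Adj.compacts (X.pow (n + 1))) :
    ∃ hc' : X.tot n n S ∈ Adj.compacts (X.pow n),
      ρ.tCpt (n + 1) (Cpt.mk _ hc) = ρ.tCpt n (Cpt.mk _ hc') := by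
  cases n with
  | zero =>
    have e0 := X.tot_zero_zero S
    refine ⟨by rw [e0]; exact (S 0).op_mem, ?_⟩
    have e1 : Cpt.mk (X.tot 0 0 S) (by rw [e0]; exact (S 0).op_mem) = S 0 := Cpt.op_injective e0
    rw [e1, tCpt_zero]
    have e2 := X.tot_zero_one S
    have hc2 : X.φ (HilbMod.compactsToAlg (S 0)) ∈ Adj.compacts X.toHilbMod := by
      rw [← e2]; exact hc
    rw [e0] at h
    have h' : X.restrictI (HilbMod.self A) 1 (HilbMod.leftMul (HilbMod.compactsToAlg (S 0))) = 0 :=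
      (congrArg (X.restrictI (HilbMod.self A) 1) (HilbMod.leftMul_compactsToAlg (S 0))).trans h
    rw [← tOne_φ hρ hc2 fun b hb => HilbBimod.mul_eq_zero_of_restrictI h' hb]
    exact congrArg ρ.tOne (Cpt.op_injective e2)
  | succ n =>
    have e := X.tot_succ (le_refl (n + 1)) S
    have hc2 : tensorOne (X.pow (n + 1)) X (X.tot (n + 1) (n + 1) S) ∈ Adj.compacts _ := by
      rw [← e]; exact hc
    have hc' := mem_compacts_of_tensorOne h hc2
    refine ⟨hc', ?_⟩
    refine Eq.trans ?_ (covHom_eq_covHom_step (ρ.tPow (n + 1)) (ρ.star_tPow_mul (n + 1)) hρ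
      (T := Cpt.mk _ hc') h hc2)
    exact congrArg (ρ.tCpt (n + 2)) (Cpt.op_injective e)

-- In degree `n + 1`, compactness of `T_{n+1}` and of `S_{n+1}` makes the continuation of `T_n`
-- compact, so `exists_tCpt_tot_eq` moves it down to degree `n`. Compactness of `T_n`, rather than
-- `T_n = 0`, is what this induction passes on.
variable {ρ} in
lemma tCpt_tot (hρ : ρ.IsCuntzPimsner) {n : ℕ} {S : ∀ p, Cpt (X.pow p)}
    (h : ∀ q < n, X.restrictI (X.pow q) 1 (X.tot q q S) = 0)
    (hc : X.tot n n S ∈ Adj.compacts (X.pow n)) :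
    ρ.tCpt n (Cpt.mk _ hc) = ∑ p ∈ Finset.range (n + 1), ρ.tCpt p (S p) := by
  induction n with
  | zero =>
    rw [zero_add, Finset.sum_range_one]
    exact congrArg (ρ.tCpt 0) (Cpt.op_injective (X.tot_zero_zero S))
  | succ n ih =>
    have e := X.tot_self_succ n S
    have hc1 : X.tot n (n + 1) S ∈ Adj.compacts (X.pow (n + 1)) := by
      have := sub_mem hc (S (n + 1)).op_mem
      rwa [e, add_sub_cancel_right] at this
    obtain ⟨hc', h'⟩ := exists_tCpt_tot_eq hρ (h n n.lt_succ_self) hc1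
    have e' : Cpt.mk _ hc = Cpt.mk _ hc1 + S (n + 1) := Cpt.op_injective e
    rw [e', map_add, h', ih (fun q hq => h q (hq.trans n.lt_succ_self)) hc',
      Finset.sum_range_succ _ (n + 1)]

-- Here `T_n = 0` is compact with image `0`, so `tCpt_tot` evaluates the sum. This is the
-- well-definedness of `κ_n`.
variable {ρ} in
lemma sum_tCpt_eq_zero (hρ : ρ.IsCuntzPimsner) {n : ℕ} {S : ∀ p, Cpt (X.pow p)}
    (h : X.sumC n n S = 0) : ∑ p ∈ Finset.range (n + 1), ρ.tCpt p (S p) = 0 := by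
  obtain ⟨h1, h2⟩ := HilbBimod.sumC_self_eq_zero_iff.1 h
  have hc : X.tot n n S ∈ Adj.compacts (X.pow n) := by rw [h2]; exact zero_mem _
  rw [← tCpt_tot hρ h1 hc]
  have : Cpt.mk _ hc = 0 := Cpt.op_injective h2
  rw [this, map_zero]

lemma tPow_norm (hπ : Function.Injective ρ.π) (n : ℕ) (x : X.pow n) : ‖ρ.tPow n x‖ = ‖x‖ :=
  norm_eq_of_injective ρ.π (ρ.tPow n) hπ (ρ.star_tPow_mul n) x

/-- `t_q(η)* t_p(ζ) = 0` for `q < p` and `η ∈ X^{⊗q} ker φ`. -/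
lemma star_tPow_mul_tPow_eq_zero {p q : ℕ} (h : q < p) {η : X.pow q}
    (hη : η ∈ X.submI (X.pow q) 1) (ζ : X.pow p) : star (ρ.tPow q η) * ρ.tPow p ζ = 0 := by
  have hφ : ∀ y, X.φ ((X.pow q).ip η y) = 0 := fun y => by
    rw [← HilbMod.star_ip, map_star, HilbBimod.mem_submI_one_iff.1 hη y, star_zero]
  -- By density it suffices to treat elementary tensors, on which `t_{r+2}` is a product.
  have key : ∀ r, (∀ (y : X.pow (r + 1)) (x : X.toHilbMod),
      star (ρ.tPow q η) * ρ.tPow (r + 2) (HilbMod.tmul y x) = 0) →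
      ∀ z : X.pow (r + 2), star (ρ.tPow q η) * ρ.tPow (r + 2) z = 0 := fun r hr z => by
    refine (denseRange_tensorι (X.pow (r + 1)) X).induction_on (p := fun z =>
      star (ρ.tPow q η) * ρ.tPow (r + 2) z = 0) z
      (isClosed_eq (continuous_const.mul (ρ.tPow (r + 2)).continuous) continuous_const) fun u => ?_
    induction u with
    | zero => rw [map_zero]; exact (congrArg _ (map_zero (ρ.tPow (r + 2)))).trans (mul_zero _)
    | add v w hv hw =>
      rw [map_add]
      refine (congrArg _ (map_add (ρ.tPow (r + 2)) _ _)).trans ?_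
      rw [mul_add, hv, hw, add_zero]
    | tmul y x => exact hr y x
  induction p, h using Nat.le_induction with
  | base =>
    -- For `p = q + 1` and `q ≥ 1`, `t_q(η)* t_q(y) t(x) = t(φ(⟨η, y⟩) x) = 0`. For `q = 0` one
    -- needs `φ(η*) = 0`, which the `C*`-identity gives from `φ(η)* φ(η) = φ(⟨η, η⟩) = 0`.
    cases q with
    | zero =>
      change star (ρ.tPow 0 η) * ρ.t ζ = 0
      have h1 : star (ρ.tPow 0 η) = ρ.π (star (HilbMod.toAlg η)) := (map_star ρ.π _).symm
      have h2 : X.φ (star (HilbMod.toAlg η)) = 0 := by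
        have h3 : X.φ (star (HilbMod.toAlg η) * HilbMod.toAlg η) = 0 := hφ η
        rw [map_mul, map_star, CStarRing.star_mul_self_eq_zero_iff] at h3
        rw [map_star, h3, star_zero]
      refine (congrArg (· * ρ.t ζ) h1).trans ((ρ.π_mul_t _ ζ).trans ?_)
      rw [h2]
      exact map_zero ρ.t
    | succ q =>
      refine key q (fun y x => ?_) ζ
      rw [tPow_succ, ← mul_assoc, star_tPow_mul, ρ.π_mul_t, hφ, Adj.zero_apply, map_zero]
  | succ p hp ih =>
    cases p with
    | zero => exact absurd hp (Nat.not_succ_le_zero _)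
    | succ p =>
      refine key p (fun y x => ?_) ζ
      rw [tPow_succ, ← mul_assoc, ih, zero_mul]

/-- For `S = θ_{x,y}` the product contains the factor `t_p(y)* t_q(η)`, the adjoint of the one that
vanishes in `star_tPow_mul_tPow_eq_zero`. -/
lemma tCpt_mul_tPow_eq_zero {p q : ℕ} (h : q < p) (S : Cpt (X.pow p)) {η : X.pow q}
    (hη : η ∈ X.submI (X.pow q) 1) : ρ.tCpt p S * ρ.tPow q η = 0 := by
  refine Cpt.mem_of_theta_mem (M := LinearMap.ker ((LinearMap.mulRight ℂ (ρ.tPow q η)) ∘ₗ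
    (ρ.tCpt p : Cpt (X.pow p) →ₗ[ℂ] B))) ?_ (fun x y => ?_) S
  · exact (isClosed_singleton (x := (0 : B))).preimage
      ((continuous_starHom (ρ.tCpt p)).mul continuous_const)
  · change ρ.tCpt p (Cpt.theta x y) * ρ.tPow q η = 0
    have h1 : star (ρ.tPow p y) * ρ.tPow q η = 0 := by
      have := congrArg star (ρ.star_tPow_mul_tPow_eq_zero h hη y)
      rwa [star_mul, star_star, star_zero] at this
    rw [tCpt_theta, mul_assoc, h1, mul_zero]

/-- Terms with `p ≤ q` act through `ι_p^q`. Terms with `p > q` occur only if `q < n`, and they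
annihilate `t_q(η)` for `η ∈ X^{⊗q} ker φ`. -/
lemma sum_tCpt_mul_tPow {n q : ℕ} {S : ∀ p, Cpt (X.pow p)} {η : X.pow q}
    (hη : q < n → η ∈ X.submI (X.pow q) 1) :
    (∑ p ∈ Finset.range (n + 1), ρ.tCpt p (S p)) * ρ.tPow q η = ρ.tPow q (X.tot n q S η) := by
  rw [Finset.sum_mul, HilbBimod.tot, Adj.sum_apply, map_sum]
  refine Finset.sum_congr rfl fun p hp => ?_
  split_ifs with h
  · exact ρ.tCpt_mul_tPow h _ _
  · rw [ρ.tCpt_mul_tPow_eq_zero (not_le.1 h) _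
      (hη ((not_le.1 h).trans_le (Finset.mem_range_succ_iff.1 hp))), Adj.zero_apply, map_zero]

/-- Each `t_q` is isometric, so multiplying the vanishing sum by `t_q(η)` gives `T_q η = 0`, for `η
∈ X^{⊗q} ker φ` if `q < n` and for every `η` if `q = n`. These are the conditions of
`sumC_self_eq_zero_iff`. -/
lemma sumC_eq_zero_of_sum_tCpt (hπ : Function.Injective ρ.π) {n : ℕ} {S : ∀ p, Cpt (X.pow p)}
    (h : ∑ p ∈ Finset.range (n + 1), ρ.tCpt p (S p) = 0) : X.sumC n n S = 0 := by
  have key : ∀ q (η : X.pow q), (q < n → η ∈ X.submI (X.pow q) 1) → X.tot n q S η = 0 :=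
    fun q η hη => by
      have h1 := ρ.sum_tCpt_mul_tPow (S := S) hη
      rw [h, zero_mul] at h1
      rw [← norm_eq_zero, ← ρ.tPow_norm hπ, ← h1, norm_zero]
  refine HilbBimod.sumC_self_eq_zero_iff.2 ⟨fun q hq => ?_, ?_⟩
  · rw [← X.tot_eq_tot hq.le le_rfl, HilbBimod.restrictI_eq_zero_iff]
    exact fun x hx => key q x fun _ => hx
  · exact Adj.ext fun x => key n x fun hn => absurd hn (lt_irrefl n)

end Representation

end CuntzPimsner

/-! ### The homomorphisms `κ_n` and `κ` -/

namespace CuntzPimsner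

variable {A : Type u} [NonUnitalCStarAlgebra A] [PartialOrder A] [StarOrderedRing A]
variable {B : Type v} [NonUnitalCStarAlgebra B]

namespace Representation

open HilbBimod

variable {X : HilbBimod A} (ρ : Representation X B)

/-- The map underlying `κ_n`. -/
def kappaFun (n : ℕ) (x : X.C n) : B :=
  ∑ p ∈ Finset.range (n + 1), ρ.tCpt p ((C.exists_eq_mk x).choose p)

variable {ρ}

/-- Two families with the same sum in `C_n` differ by one with sum zero, to which `sum_tCpt_eq_zero`
applies; the choice of family is therefore immaterial. -/
lemma kappaFun_mk (hρ : ρ.IsCuntzPimsner) (n : ℕ) (S : ∀ p, Cpt (X.pow p)) :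
    ρ.kappaFun n (C.mk n S) = ∑ p ∈ Finset.range (n + 1), ρ.tCpt p (S p) := by
  have h := congrArg C.val (C.exists_eq_mk (C.mk n S)).choose_spec
  rw [C.val_mk', C.val_mk', ← sub_eq_zero, ← sumC_sub] at h
  have h2 := sum_tCpt_eq_zero hρ h
  simp only [map_sub, Finset.sum_sub_distrib] at h2
  exact (sub_eq_zero.1 h2).symm

/-- `κ_n` as a linear map. -/
def kappaLinear (hρ : ρ.IsCuntzPimsner) (n : ℕ) : X.C n →ₗ[ℂ] B where
  toFun := ρ.kappaFun n
  map_add' x y := by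
    obtain ⟨S, rfl⟩ := C.exists_eq_mk x
    obtain ⟨T, rfl⟩ := C.exists_eq_mk y
    rw [← C.mk_add, kappaFun_mk hρ, kappaFun_mk hρ, kappaFun_mk hρ, ← Finset.sum_add_distrib]
    simp only [map_add]
  map_smul' c x := by
    obtain ⟨S, rfl⟩ := C.exists_eq_mk x
    rw [← C.mk_smul, kappaFun_mk hρ, kappaFun_mk hρ, RingHom.id_apply, Finset.smul_sum]
    simp only [map_smul]

lemma kappaLinear_mk (hρ : ρ.IsCuntzPimsner) (n : ℕ) (S : ∀ p, Cpt (X.pow p)) :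
    kappaLinear hρ n (C.mk n S) = ∑ p ∈ Finset.range (n + 1), ρ.tCpt p (S p) :=
  kappaFun_mk hρ n S

lemma kappaLinear_star (hρ : ρ.IsCuntzPimsner) (n : ℕ) (x : X.C n) :
    kappaLinear hρ n (star x) = star (kappaLinear hρ n x) := by
  obtain ⟨S, rfl⟩ := C.exists_eq_mk x
  rw [← C.mk_star, kappaLinear_mk, kappaLinear_mk, star_sum]
  simp only [map_star]

/-- The element `ι̃_p^n(S)` of `C_n`. -/
def gen (n p : ℕ) (S : Cpt (X.pow p)) : X.C n := C.mk n (Pi.single p S)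

lemma val_gen {n p : ℕ} (h : p ≤ n) (S : Cpt (X.pow p)) :
    (gen n p S).val = X.itilde n p S := by
  refine (C.val_mk n _).trans ?_
  rw [Finset.sum_eq_single_of_mem p (Finset.mem_range_succ_iff.2 h), Pi.single_eq_same]
  intro r _ hr
  rw [Pi.single_eq_of_ne hr, map_zero]

lemma kappaLinear_gen (hρ : ρ.IsCuntzPimsner) {n p : ℕ} (h : p ≤ n) (S : Cpt (X.pow p)) :
    kappaLinear hρ n (gen n p S) = ρ.tCpt p S := by
  rw [gen, kappaLinear_mk, Finset.sum_eq_single_of_mem p (Finset.mem_range_succ_iff.2 h),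
    Pi.single_eq_same]
  intro r _ hr
  rw [Pi.single_eq_of_ne hr, map_zero]

lemma mk_eq_sum_gen (n : ℕ) (S : ∀ p, Cpt (X.pow p)) :
    C.mk n S = ∑ p ∈ Finset.range (n + 1), gen n p (S p) := by
  refine C.val_injective ((C.val_mk n S).trans ?_)
  refine Eq.trans ?_ (map_sum (C.valHom X n) _ _).symm
  exact Finset.sum_congr rfl fun p hp => (val_gen (Finset.mem_range_succ_iff.1 hp) (S p)).symm

lemma gen_mul_gen {n p r : ℕ} (h : p ≤ r) (hr : r ≤ n) (S : Cpt (X.pow p)) (T : Cpt (X.pow r)) :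
    gen n p S * gen n r T =
      gen n r (Cpt.mk (X.iota h S * T.op) (Adj.mul_mem_compacts _ T.op_mem)) := by
  refine C.val_injective ?_
  refine (map_mul (C.valHom X n) _ _).trans ?_
  change (gen n p S).val * (gen n r T).val = _
  rw [val_gen (h.trans hr), val_gen hr, val_gen hr, X.itilde_mul h]

lemma kappaLinear_gen_mul_gen (hρ : ρ.IsCuntzPimsner) {n p r : ℕ} (hp : p ≤ n) (hr : r ≤ n)
    (S : Cpt (X.pow p)) (T : Cpt (X.pow r)) :
    kappaLinear hρ n (gen n p S * gen n r T) =
      kappaLinear hρ n (gen n p S) * kappaLinear hρ n (gen n r T) := by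
  have key : ∀ {p r : ℕ} (_ : p ≤ r) (_ : r ≤ n) (S : Cpt (X.pow p)) (T : Cpt (X.pow r)),
      kappaLinear hρ n (gen n p S * gen n r T) =
        kappaLinear hρ n (gen n p S) * kappaLinear hρ n (gen n r T) := fun h hr S T => by
    rw [gen_mul_gen h hr, kappaLinear_gen hρ hr, kappaLinear_gen hρ hr,
      kappaLinear_gen hρ (h.trans hr), ρ.tCpt_mul_tCpt h]
  have hstar : ∀ {p : ℕ} (S : Cpt (X.pow p)), star (gen n p S) = gen n p (star S) := fun S => by
    rw [gen, ← C.mk_star, gen, Pi.single_star]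
    rfl
  rcases le_total p r with h | h
  · exact key h hr S T
  -- The product rule requires the left degree to be at most the right one; the other order follows
  -- by taking adjoints.
  · have h1 := congrArg star (key h hp (star T) (star S))
    rw [← hstar, ← hstar] at h1
    rwa [← kappaLinear_star, star_mul, star_star, star_star, star_mul, ← kappaLinear_star,
      ← kappaLinear_star, star_star, star_star] at h1

/-- The `*`-homomorphism `κ_n : C_n → B`, `∑_{p ≤ n} ι̃_p^n(S_p) ↦ ∑_{p ≤ n} t^{(p)}(S_p)`. -/
def kappa (hρ : ρ.IsCuntzPimsner) (n : ℕ) : X.C n →⋆ₙₐ[ℂ] B where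
  toFun := kappaLinear hρ n
  map_smul' := map_smul (kappaLinear hρ n)
  map_zero' := map_zero (kappaLinear hρ n)
  map_add' := map_add (kappaLinear hρ n)
  map_mul' x y := by
    obtain ⟨S, rfl⟩ := C.exists_eq_mk x
    obtain ⟨T, rfl⟩ := C.exists_eq_mk y
    rw [mk_eq_sum_gen n S, mk_eq_sum_gen n T, Finset.sum_mul_sum]
    simp only [map_sum, Finset.sum_mul_sum]
    exact Finset.sum_congr rfl fun p hp => Finset.sum_congr rfl fun r hr =>
      kappaLinear_gen_mul_gen hρ (Finset.mem_range_succ_iff.1 hp)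
        (Finset.mem_range_succ_iff.1 hr) _ _
  map_star' := kappaLinear_star hρ n

lemma kappa_mk (hρ : ρ.IsCuntzPimsner) (n : ℕ) (S : ∀ p, Cpt (X.pow p)) :
    kappa hρ n (C.mk n S) = ∑ p ∈ Finset.range (n + 1), ρ.tCpt p (S p) :=
  kappaFun_mk hρ n S

lemma kappa_mem_core (hρ : ρ.IsCuntzPimsner) (n : ℕ) (x : X.C n) : kappa hρ n x ∈ ρ.core := by
  obtain ⟨S, rfl⟩ := C.exists_eq_mk x
  rw [kappa_mk]
  exact Submodule.sum_mem _ fun p _ => ρ.tCpt_mem_core (S p)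

lemma kappa_map (hρ : ρ.IsCuntzPimsner) {n m : ℕ} (h : n ≤ m) (x : X.C n) :
    kappa hρ m (C.map h x) = kappa hρ n x := by
  obtain ⟨S, rfl⟩ := C.exists_eq_mk x
  rw [C.map_mk_eq, kappa_mk, kappa_mk]
  have h1 := Finset.sum_subset (Finset.range_mono (Nat.succ_le_succ h))
    (f := fun p => ρ.tCpt p (if p ≤ n then S p else 0)) fun p _ hp => by
      rw [if_neg fun h => hp (Finset.mem_range_succ_iff.2 h), map_zero]
  rw [← h1]
  exact Finset.sum_congr rfl fun p hp => by rw [if_pos (Finset.mem_range_succ_iff.1 hp)]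

lemma kappa_injective (hρ : ρ.IsCuntzPimsner) (hπ : Function.Injective ρ.π) (n : ℕ) :
    Function.Injective (kappa hρ n) := by
  rw [injective_iff_map_eq_zero]
  intro x hx
  obtain ⟨S, rfl⟩ := C.exists_eq_mk x
  rw [kappa_mk] at hx
  exact C.val_injective ((C.val_mk' n S).trans (ρ.sumC_eq_zero_of_sum_tCpt hπ hx))

/-- The map induced by the `κ_n` on the algebraic inductive limit. -/
def kappaAlgFun (hρ : ρ.IsCuntzPimsner) (z : X.AlgLim) : B :=
  kappa hρ _ (AlgLim.exists_of z).choose_spec.choose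

/-- Two representatives of one class agree at some later stage, and the `κ_n` are compatible with
the connecting maps. -/
lemma kappaAlgFun_of (hρ : ρ.IsCuntzPimsner) (n : ℕ) (x : X.C n) :
    kappaAlgFun hρ (AlgLim.of n x) = kappa hρ n x := by
  obtain ⟨k, hn, hm, h⟩ :=
    AlgLim.of_eq_of (AlgLim.exists_of (AlgLim.of n x)).choose_spec.choose_spec
  rw [← kappa_map hρ hn, h, kappa_map]
  rfl

/-- The seminorm is an infimum over representatives `y ∈ C_m`, and each `κ_m` is contractive because
`C_m` is a `C*`-algebra. -/
lemma norm_kappaAlgFun_le (hρ : ρ.IsCuntzPimsner) (z : X.AlgLim) : ‖kappaAlgFun hρ z‖ ≤ ‖z‖ := by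
  obtain ⟨n, x, hz⟩ := AlgLim.exists_of z
  refine le_csInf ⟨_, n, x, hz, rfl⟩ ?_
  rintro _ ⟨m, y, rfl, rfl⟩
  rw [kappaAlgFun_of]
  exact NonUnitalStarAlgHom.norm_apply_le (kappa hρ m) y

lemma algLim_exists_of₂ (z w : X.AlgLim) : ∃ n x y, z = AlgLim.of n x ∧ w = AlgLim.of n y := by
  obtain ⟨n, x, y, hx, hy, -⟩ := AlgLim.exists_norm_lt₂ z w (lt_add_one ‖z‖) (lt_add_one ‖w‖)
  exact ⟨n, x, y, hx, hy⟩

/-- The map induced by the `κ_n` on the algebraic inductive limit, as a bounded linear map. -/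
def kappaAlg (hρ : ρ.IsCuntzPimsner) : X.AlgLim →L[ℂ] B :=
  LinearMap.mkContinuous
    { toFun := kappaAlgFun hρ
      map_add' := fun z w => by
        obtain ⟨n, x, y, rfl, rfl⟩ := algLim_exists_of₂ z w
        rw [← AlgLim.of_add, kappaAlgFun_of, kappaAlgFun_of, kappaAlgFun_of, map_add]
      map_smul' := fun c z => by
        obtain ⟨n, x, rfl⟩ := AlgLim.exists_of z
        rw [← AlgLim.of_smul, kappaAlgFun_of, kappaAlgFun_of, map_smul, RingHom.id_apply] } 1
    fun z => by rw [one_mul]; exact norm_kappaAlgFun_le hρ z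

lemma kappaAlg_of (hρ : ρ.IsCuntzPimsner) (n : ℕ) (x : X.C n) :
    kappaAlg hρ (AlgLim.of n x) = kappa hρ n x := kappaAlgFun_of hρ n x

/-- The map induced by the `κ_n` on the inductive limit, as a bounded linear map. -/
def kappaLimL (hρ : ρ.IsCuntzPimsner) : X.Lim →L[ℂ] B :=
  (kappaAlg hρ).extend (Lim.coe (X := X))

lemma kappaLimL_coe (hρ : ρ.IsCuntzPimsner) (z : X.AlgLim) :
    kappaLimL hρ (Lim.coe z) = kappaAlg hρ z :=
  ContinuousLinearMap.extend_eq _ (e := Lim.coe (X := X)) Lim.denseRange_coe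
    (UniformSpace.Completion.isUniformInducing_coe X.AlgLim) z

/-- The `*`-homomorphism `κ : lim C_n → B` induced by the `κ_n`. -/
def kappaLim (hρ : ρ.IsCuntzPimsner) : X.Lim →⋆ₙₐ[ℂ] B where
  toFun := kappaLimL hρ
  map_smul' c z := (kappaLimL hρ).map_smul c z
  map_zero' := map_zero (kappaLimL hρ)
  map_add' := map_add (kappaLimL hρ)
  map_mul' z w := by
    refine Lim.induction_on₂ z w (isClosed_eq (by fun_prop) (by fun_prop)) fun z w => ?_
    obtain ⟨n, x, y, rfl, rfl⟩ := algLim_exists_of₂ z w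
    rw [← Lim.coe_mul, kappaLimL_coe, kappaLimL_coe, kappaLimL_coe, ← AlgLim.of_mul, kappaAlg_of,
      kappaAlg_of, kappaAlg_of, map_mul]
  map_star' z := by
    refine Lim.induction_on z (isClosed_eq (by fun_prop) (by fun_prop)) fun z => ?_
    obtain ⟨n, x, rfl⟩ := AlgLim.exists_of z
    rw [← Lim.coe_star, kappaLimL_coe, kappaLimL_coe, ← AlgLim.of_star, kappaAlg_of,
      kappaAlg_of, map_star]

lemma kappaLim_coe_of (hρ : ρ.IsCuntzPimsner) (n : ℕ) (x : X.C n) :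
    kappaLim hρ (Lim.coe (AlgLim.of n x)) = kappa hρ n x :=
  (kappaLimL_coe hρ _).trans (kappaAlg_of hρ n x)

lemma kappaLim_mem_core (hρ : ρ.IsCuntzPimsner) (z : X.Lim) : kappaLim hρ z ∈ ρ.core := by
  refine Lim.induction_on z ((Submodule.isClosed_topologicalClosure _).preimage
    (kappaLimL hρ).continuous) fun z => ?_
  obtain ⟨n, x, rfl⟩ := AlgLim.exists_of z
  rw [kappaLim_coe_of]
  exact kappa_mem_core hρ n x

/-- An injective `κ_n` is isometric, so the class of `x` has norm at most `‖x‖ = ‖κ_n(x)‖`; this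
estimate passes to the completion. The reverse one holds for any `*`-homomorphism of `C*`-algebras.
-/
lemma isometry_kappaLim (hρ : ρ.IsCuntzPimsner) (hπ : Function.Injective ρ.π) :
    Isometry (kappaLim hρ) := by
  refine AddMonoidHomClass.isometry_of_norm _ fun z => ?_
  refine le_antisymm (NonUnitalStarAlgHom.norm_apply_le (kappaLim hρ) z) ?_
  refine Lim.induction_on z (isClosed_le continuous_norm
    (kappaLimL hρ).continuous.norm) fun z => ?_
  obtain ⟨n, x, rfl⟩ := AlgLim.exists_of z
  rw [kappaLim_coe_of, Lim.norm_coe,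
    NonUnitalStarAlgHom.norm_map (kappa hρ n) (kappa_injective hρ hπ n)]
  exact AlgLim.norm_of_le n x

/-- An isometric image of a complete space is closed, so it suffices to reach the generators:
`t_n(ξ) t_n(η)*` is the image of `ι̃_n^n(θ_{ξ,η})`. -/
lemma range_kappaLim (hρ : ρ.IsCuntzPimsner) (hπ : Function.Injective ρ.π) :
    Set.range (kappaLim hρ) = (ρ.core : Set B) := by
  refine Set.Subset.antisymm ?_ ?_
  · rintro _ ⟨z, rfl⟩
    exact kappaLim_mem_core hρ z
  · have hcl : IsClosed ((LinearMap.range (kappaLimL hρ).toLinearMap : Submodule ℂ B) : Set B) := by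
      have := (isometry_kappaLim hρ hπ).isClosedEmbedding.isClosed_range
      exact this
    refine Submodule.topologicalClosure_minimal _ (Submodule.span_le.2 ?_) hcl
    rintro _ ⟨n, ξ, η, rfl⟩
    refine ⟨Lim.coe (AlgLim.of n (gen n n (Cpt.theta ξ η))), ?_⟩
    refine (kappaLim_coe_of hρ n _).trans ?_
    refine (kappaLinear_gen hρ le_rfl _).trans ?_
    exact ρ.tCpt_theta n ξ η

end Representation

end CuntzPimsner

end
open CuntzPimsner CuntzPimsner.HilbBimod in
theorem mainTheorem3 {A : Type u} [NonUnitalCStarAlgebra A] [PartialOrder A] [StarOrderedRing A]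
    (X : HilbBimod A) {B : Type v} [NonUnitalCStarAlgebra B] (ρ : Representation X B)
    (hρ : ρ.IsCuntzPimsner) :
    ∃ (κ : ∀ n : ℕ, X.C n →⋆ₙₐ[ℂ] B) (K : X.Lim →⋆ₙₐ[ℂ] B),
      (∀ (n : ℕ) (S : ∀ p : ℕ, Cpt (X.pow p)),
        κ n (C.mk n S) = ∑ p ∈ Finset.range (n + 1), ρ.tCpt p (S p)) ∧
      (∀ (n : ℕ) (x : X.C n), κ n x ∈ ρ.core) ∧
      (∀ (n m : ℕ) (h : n ≤ m) (x : X.C n), κ m (C.map h x) = κ n x) ∧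
      (∀ (n : ℕ) (x : X.C n), K (Lim.of n x) = κ n x) ∧
      (∀ z : X.Lim, K z ∈ ρ.core) ∧
      (Function.Injective ρ.π →
        (∀ n : ℕ, Function.Injective (κ n)) ∧ Isometry K ∧ Set.range K = (ρ.core : Set B)) :=
  ⟨Representation.kappa hρ, Representation.kappaLim hρ, Representation.kappa_mk hρ,
    Representation.kappa_mem_core hρ, fun _ _ h x => Representation.kappa_map hρ h x,
    Representation.kappaLim_coe_of hρ, Representation.kappaLim_mem_core hρ,
    fun hπ => ⟨Representation.kappa_injective hρ hπ, Representation.isometry_kappaLim hρ hπ,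
      Representation.range_kappaLim hρ hπ⟩⟩
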